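/- Let $k$ be a field; algebras are associative, not necessarily unital $k$-algebras, and tensor products are over $k$. A crossed module $(R,A,\rho)$ of algebras is an algebra homomorphism $\rho:R\to A$ with an action of $A$ on $R$ (an $A$-bimodule structure with $a(rr')=(ar)r'$, $(ra)r'=r(ar')$, $(rr')a=r(r'a)$) such that $\rho(ar)=a\rho(r)$, $\rho(ra)=\rho(r)a$ and $\rho(r)r'=rr'=r\rho(r')$. Morphisms are the pairs of algebra homomorphisms that are compatible with $\rho$ and with the actions. The functor $(R,A,\rho)\mapsto R\times A$ from crossed modules to vector spaces has the left adjoint $\mathbb F(V)=(\ker p_2,\,T(V)*T(V),\,\mathrm{inc})$, where $T(V)$ is the free algebra on $V$, $*$ is the coproduct of algebras and $p_2:T(V)*T(V)\to T(V)$ is $0$ on the first factor and the identity on the second. Let $\mathcal P$ be the class of crossed modules $(R,A,\rho)$ for which the counit $\tau:\mathbb F(R\times A)\to (R,A,\rho)$ has a section, i.e. there is a morphism $\vartheta:(R,A,\rho)\to\mathbb F(R\times A)$ with $\tau\vartheta=1$. For an algebra $A$ let $CC(A)$ be the total complex of the cyclic bicomplex, whose columns of even index are the Hochschild complex $(A^{\otimes(n+1)},b)_{n\ge0}$,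 whose columns of odd index are $(A^{\otimes (n+1)},-b')_{n\ge0}$, and whose horizontal maps are alternately $1-t$ and $N$; let $CC^{\{2\}}(A)$ be the total complex of its columns $0$ and $1$. For a crossed module $(R,A,\rho)$ let $\mathfrak N_*(R,A,\rho)$ be its nerve, the simplicial algebra with $\mathfrak N_n=R\rtimes(\cdots(R\rtimes A)\cdots)$ ($n$ factors $R$) that is the nerve of the internal category $R\rtimes A\rightrightarrows A$ with source $(r,a)\mapsto a$ and target $(r,a)\mapsto\rho(r)+a$, and put $CC(R,A,\rho)=\operatorname{Tot}CC(\mathfrak N_*(R,A,\rho))$ and $CC^{\{2\}}(R,A,\rho)=\operatorname{Tot}CC^{\{2\}}(\mathfrak N_*(R,A,\rho))$. Let $\beta(R,A,\rho)$ and $\gamma(R,A,\rho)$ be the cokernels of the maps $CC^{\{2\}}(0,A,0)\to CC^{\{2\}}(R,A,\rho)$ and $CC(0,A,0)\to CC(R,A,\rho)$ induced by the morphism $(0,1_A):(0,A,0)\to(R,A,\rho)$. Let $[A,R]\subseteq R$ be the subspace spanned by all $ar-ra$ with $a\in A$, $r\in R$. **Proposition.** Let $(R,A,\rho)$ be a crossed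 module of algebras over $k$ that belongs to $\mathcal P$. Then (i) $H_n(\beta(R,A,\rho))=0$ for all $n>2$; (ii) if in addition $k$ has characteristic zero, then $H_n(\gamma(R,A,\rho))=0$ for all $n>1$, and there is an isomorphism of vector spaces $H_2(\beta(R,A,\rho))\cong R/[A,R]$. -/

import Mathlib

universe u v w x

noncomputable section

open CategoryTheory CategoryTheory.Limits
open scoped ZeroObject

/-- Non-unital associative algebras over the field `k`. -/
structure NUAlg (k : Type u) [Field k] : Type (max u (v + 1)) where
  carrier : Type v
  [ring : NonUnitalRing carrier]
  [module : Module k carrier]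
  [tower : IsScalarTower k carrier carrier]
  [comm : SMulCommClass k carrier carrier]

namespace NUAlg

variable {k : Type u} [Field k]

instance : CoeSort (NUAlg.{u, v} k) (Type v) := ⟨NUAlg.carrier⟩

attribute [instance] NUAlg.ring NUAlg.module NUAlg.tower NUAlg.comm

/-- Morphisms of `NUAlg k`: homomorphisms of non-unital algebras. -/
@[ext]
structure Hom (A B : NUAlg.{u, v} k) : Type v where
  hom : A →ₙₐ[k] B

instance : Category (NUAlg.{u, v} k) where
  Hom A B := Hom A B
  id A := ⟨NonUnitalAlgHom.id k A⟩
  comp f g := ⟨NonUnitalAlgHom.comp g.hom f.hom⟩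

end NUAlg

/-! ### Hochschild and bar complexes -/

namespace Hochschild

section Unbundled

variable (k : Type u) [Field k] (A : Type v) [NonUnitalRing A] [Module k A]

/-- `A^{⊗ n}`. -/
abbrev TPow (n : ℕ) : Type (max u v) := PiTensorProduct k (fun _ : Fin n => A)

/-- The rotation `a_0 ⊗ ⋯ ⊗ a_n ↦ a_n ⊗ a_0 ⊗ ⋯ ⊗ a_{n-1}`, without sign. -/
def rot (n : ℕ) : Module.End k (TPow k A (n + 1)) :=
  (PiTensorProduct.reindex k (fun _ : Fin (n + 1) => A) (finRotate (n + 1))).toLinearMap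

/-- The cyclic operator `t (a_0 ⊗ ⋯ ⊗ a_n) = (-1)^n a_n ⊗ a_0 ⊗ ⋯ ⊗ a_{n-1}`. -/
def cyc (n : ℕ) : Module.End k (TPow k A (n + 1)) := (-1 : k) ^ n • rot k A n

/-- The norm operator `N = 1 + t + ⋯ + t^n` on `A^{⊗ (n+1)}`. -/
def norm (n : ℕ) : Module.End k (TPow k A (n + 1)) :=
  ∑ i ∈ Finset.range (n + 1), cyc k A n ^ i

variable {k A}

/-- `(a_0, …, a_{n+1}) ↦ (a_0, …, a_i a_{i+1}, …, a_{n+1})`, for `i ≤ n`. -/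
def mulAt {n : ℕ} (i : ℕ) (a : Fin (n + 2) → A) : Fin (n + 1) → A := fun j =>
  if (j : ℕ) < i then a j.castSucc
  else if (j : ℕ) = i then a j.castSucc * a j.succ else a j.succ

theorem mulAt_update {n : ℕ} (i : ℕ) (j : Fin (n + 2)) (hi : i ≤ n) [IsScalarTower k A A] [SMulCommClass k A A]
    (a : Fin (n + 2) → A) :
    ∃ (j' : Fin (n + 1)) (L : A →ₗ[k] A), ∀ x,
      mulAt i (Function.update a j x) = Function.update (mulAt i a) j' (L x) := by
  rcases lt_trichotomy (j : ℕ) i with h | h | h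
  · refine ⟨⟨j, by omega⟩, LinearMap.id, fun x => ?_⟩
    ext l
    simp only [mulAt, Function.update_apply, Fin.ext_iff, Fin.val_castSucc, Fin.val_succ]
    split_ifs <;> first | rfl | omega
  · refine ⟨⟨j, by omega⟩, LinearMap.mulRight k (a ⟨j + 1, by omega⟩), fun x => ?_⟩
    ext l
    simp only [mulAt, Function.update_apply, Fin.ext_iff, Fin.val_castSucc, Fin.val_succ]
    split_ifs <;> first | rfl | omega | skip
    simp only [LinearMap.mulRight_apply]
    congr 2
    ext
    simp; omega
  · by_cases h' : (j : ℕ) = i + 1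
    · refine ⟨⟨i, by omega⟩, LinearMap.mulLeft k (a ⟨i, by omega⟩), fun x => ?_⟩
      ext l
      simp only [mulAt, Function.update_apply, Fin.ext_iff, Fin.val_castSucc, Fin.val_succ]
      split_ifs <;> first | rfl | omega | skip
      simp only [LinearMap.mulLeft_apply]
      congr 2
      ext
      simp; omega
    · refine ⟨⟨j - 1, by omega⟩, LinearMap.id, fun x => ?_⟩
      ext l
      simp only [mulAt, Function.update_apply, Fin.ext_iff, Fin.val_castSucc, Fin.val_succ]
      split_ifs <;> first | rfl | omega

variable (k A) [IsScalarTower k A A] [SMulCommClass k A A]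

/-- The multilinear map `(a_0, …, a_{n+1}) ↦ a_0 ⊗ ⋯ ⊗ a_i a_{i+1} ⊗ ⋯ ⊗ a_{n+1}`
(with `i` replaced by `n` if `i > n`). -/
def mulAtMultilinear (n i : ℕ) :
    MultilinearMap k (fun _ : Fin (n + 2) => A) (TPow k A (n + 1)) where
  toFun a := PiTensorProduct.tprod k (mulAt (min i n) a)
  map_update_add' := by
    intro inst a j x y
    obtain rfl := Subsingleton.elim inst (instDecidableEqFin _)
    obtain ⟨j', L, h⟩ := mulAt_update (k := k) (min i n) j (by omega) a
    simp only [h, map_add, MultilinearMap.map_update_add]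
  map_update_smul' := by
    intro inst a j c x
    obtain rfl := Subsingleton.elim inst (instDecidableEqFin _)
    obtain ⟨j', L, h⟩ := mulAt_update (k := k) (min i n) j (by omega) a
    simp only [h, map_smul, MultilinearMap.map_update_smul]

/-- The face `a_0 ⊗ ⋯ ⊗ a_{n+1} ↦ a_0 ⊗ ⋯ ⊗ a_i a_{i+1} ⊗ ⋯ ⊗ a_{n+1}`; used for `i ≤ n`. -/
def face (n i : ℕ) : TPow k A (n + 2) →ₗ[k] TPow k A (n + 1) :=
  PiTensorProduct.lift (mulAtMultilinear k A n i)

theorem face_tprod (n i : ℕ) (hi : i ≤ n) (a : Fin (n + 2) → A) :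
    face k A n i (PiTensorProduct.tprod k a) = PiTensorProduct.tprod k (mulAt i a) := by
  simp [face, mulAtMultilinear, hi]


/-- `b' : A^{⊗ (n+2)} → A^{⊗ (n+1)}`. -/
def bBar (n : ℕ) : TPow k A (n + 2) →ₗ[k] TPow k A (n + 1) :=
  ∑ i ∈ Finset.range (n + 1), (-1 : k) ^ i • face k A n i

/-- `b : A^{⊗ (n+2)} → A^{⊗ (n+1)}`, that is `b'` plus the term
`(-1)^{n+1} a_{n+1} a_0 ⊗ a_1 ⊗ ⋯ ⊗ a_n`. -/
def bHoch (n : ℕ) : TPow k A (n + 2) →ₗ[k] TPow k A (n + 1) :=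
  bBar k A n + (-1 : k) ^ (n + 1) • (face k A n 0 ∘ₗ rot k A (n + 1))

variable {k A}

theorem rot_tprod (n : ℕ) (a : Fin (n + 1) → A) :
    rot k A n (PiTensorProduct.tprod k a) =
      PiTensorProduct.tprod k (fun j => a ((finRotate (n + 1)).symm j)) := by
  simp [rot]

theorem finRotate_symm_val {n : ℕ} (j : Fin (n + 1)) :
    (((finRotate (n + 1)).symm j : Fin (n + 1)) : ℕ) = if (j : ℕ) = 0 then n else j - 1 := by
  obtain ⟨i, rfl⟩ := (finRotate (n + 1)).surjective j
  rw [Equiv.symm_apply_apply]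
  by_cases h : i = Fin.last n
  · subst h; simp
  · have : (i : ℕ) < n := Fin.val_lt_last h
    rw [coe_finRotate_of_ne_last h]; simp

theorem rot_pow (n : ℕ) : rot k A n ^ (n + 1) = 1 := by
  have key : ∀ m, ∀ a : Fin (n + 1) → A, (rot k A n ^ m) (PiTensorProduct.tprod k a) =
      PiTensorProduct.tprod k (fun j => a (((finRotate (n + 1)) ^ m).symm j)) := by
    intro m
    induction m with
    | zero => intro a; rfl
    | succ m ih =>
      intro a
      rw [pow_succ, Module.End.mul_apply, rot_tprod, ih]
      congr 1
      ext j
      rw [pow_succ]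
      rfl
  refine PiTensorProduct.ext (MultilinearMap.ext fun a => ?_)
  have h1 : (finRotate (n + 1)) ^ (n + 1) = 1 := by
    have h2 : ∀ (m : ℕ) (i : Fin (n + 1)),
        (((finRotate (n + 1)) ^ m) i : ℕ) = (i + m) % (n + 1) := by
      intro m
      induction m with
      | zero => intro i; simp [Nat.mod_eq_of_lt i.isLt]
      | succ m ih =>
        intro i
        rw [pow_succ', Equiv.Perm.mul_apply, finRotate_apply, Fin.val_add, ih]
        simp [← add_assoc]
    ext i
    rw [h2]
    simp [Nat.mod_eq_of_lt i.isLt]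
  simp only [LinearMap.compMultilinearMap_apply, key, h1]
  rfl

theorem face_face (n i j : ℕ) (hij : i < j) (hj : j ≤ n + 1) :
    face k A n i ∘ₗ face k A (n + 1) j = face k A n (j - 1) ∘ₗ face k A (n + 1) i := by
  refine PiTensorProduct.ext (MultilinearMap.ext fun a => ?_)
  simp only [LinearMap.compMultilinearMap_apply, LinearMap.comp_apply]
  rw [face_tprod _ _ _ _ hj, face_tprod _ _ _ _ (by omega), face_tprod _ _ _ _ (by omega),
    face_tprod _ _ _ _ (by omega)]
  congr 1
  ext l
  simp only [mulAt, Fin.val_castSucc, Fin.val_succ]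
  split_ifs <;> first | rfl | omega | (simp only [mul_assoc]; rfl)

theorem face_rot (n i : ℕ) (hi : i + 1 ≤ n) :
    face k A n (i + 1) ∘ₗ rot k A (n + 1) = rot k A n ∘ₗ face k A n i := by
  refine PiTensorProduct.ext (MultilinearMap.ext fun a => ?_)
  simp only [LinearMap.compMultilinearMap_apply, LinearMap.comp_apply]
  rw [rot_tprod, face_tprod _ _ _ _ hi, face_tprod _ _ _ _ (by omega), rot_tprod]
  congr 1
  ext l
  have hl := l.isLt
  have e : ∀ {p q : Fin (n + 2)}, (p : ℕ) = q → a p = a q := fun h => by rw [Fin.ext h]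
  simp only [mulAt, finRotate_symm_val]
  have e' : ∀ {p q r s : Fin (n + 2)}, (p : ℕ) = q → (r : ℕ) = s → a p * a r = a q * a s :=
    fun h h' => by rw [e h, e h']
  rcases Nat.eq_zero_or_pos (l : ℕ) with h0 | h0
  · simp only [h0, if_true]
    rw [if_pos (by omega), if_neg (by omega), if_neg (by omega)]
    refine e ?_
    simp only [finRotate_symm_val, Fin.val_castSucc, Fin.val_succ, h0, if_true]
  · have h0' : (l : ℕ) ≠ 0 := by omega
    have h0'' : (l : ℕ) + 1 ≠ 0 := by omega
    simp only [h0', if_false]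
    split_ifs <;> first
      | omega
      | (refine e ?_
         simp only [finRotate_symm_val, Fin.val_castSucc, Fin.val_succ, h0', h0'', if_false]
         try omega)
      | (refine e' ?_ ?_ <;>
         simp only [finRotate_symm_val, Fin.val_castSucc, Fin.val_succ, h0', h0'', if_false] <;>
         try omega)

/-! The signed faces `g_i = (-1)^i d_i` and their relations with `t`. -/

theorem cyc_pow (n : ℕ) : cyc k A n ^ (n + 1) = 1 := by
  rw [cyc, smul_pow, rot_pow, ← pow_mul, Even.neg_one_pow (Nat.even_mul_succ_self n), one_smul]

/-- The signed faces `(-1)^i d_i`. -/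
def sface (k : Type u) [Field k] (A : Type v) [NonUnitalRing A] [Module k A]
    [IsScalarTower k A A] [SMulCommClass k A A] (n i : ℕ) :
    TPow k A (n + 2) →ₗ[k] TPow k A (n + 1) :=
  (-1 : k) ^ i • face k A n i

theorem sface_cyc (n i : ℕ) (hi : i + 1 ≤ n) :
    sface k A n (i + 1) ∘ₗ cyc k A (n + 1) = cyc k A n ∘ₗ sface k A n i := by
  simp only [sface, cyc, LinearMap.comp_smul, LinearMap.smul_comp, face_rot n i hi, smul_smul]
  congr 1
  ring

theorem sface_cyc_apply (n i : ℕ) (hi : i + 1 ≤ n) (x) :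
    sface k A n (i + 1) (cyc k A (n + 1) x) = cyc k A n (sface k A n i x) :=
  LinearMap.congr_fun (sface_cyc n i hi) x

theorem sface_cyc_pow (n i : ℕ) (hi : i ≤ n) (x) :
    sface k A n i ((cyc k A (n + 1) ^ i) x) = (cyc k A n ^ i) (sface k A n 0 x) := by
  induction i with
  | zero => rfl
  | succ i ih =>
    rw [pow_succ', Module.End.mul_apply, sface_cyc_apply _ _ hi, ih (by omega), pow_succ',
      Module.End.mul_apply]

theorem cyc_sface_last (n : ℕ) (x) :
    cyc k A n (sface k A n n x) = sface k A n 0 (cyc k A (n + 1) (cyc k A (n + 1) x)) := by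
  have h : x = (cyc k A (n + 1) ^ n) (cyc k A (n + 1) (cyc k A (n + 1) x)) := by
    rw [← Module.End.mul_apply, ← Module.End.mul_apply, ← pow_succ, ← pow_succ, cyc_pow,
      Module.End.one_apply]
  conv_lhs => rw [h]
  rw [sface_cyc_pow _ _ le_rfl, ← Module.End.mul_apply, ← pow_succ', cyc_pow, Module.End.one_apply]

theorem bBar_apply (n : ℕ) (x) :
    bBar k A n x = ∑ i ∈ Finset.range (n + 1), sface k A n i x := by
  simp [bBar, sface]

theorem bHoch_apply (n : ℕ) (x) :
    bHoch k A n x = bBar k A n x + sface k A n 0 (cyc k A (n + 1) x) := by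
  simp [bHoch, sface, cyc]

/-- `b (1 - t) = (1 - t) b'`. -/
theorem bHoch_one_sub_cyc (n : ℕ) (x) :
    bHoch k A n ((1 - cyc k A (n + 1)) x) = (1 - cyc k A n) (bBar k A n x) := by
  have h1 : bBar k A n (cyc k A (n + 1) x) =
      cyc k A n (bBar k A n x) - cyc k A n (sface k A n n x) + sface k A n 0 (cyc k A (n + 1) x) := by
    rw [bBar_apply, bBar_apply, Finset.sum_range_succ', Finset.sum_range_succ, map_add, map_sum]
    rw [Finset.sum_congr rfl fun i hi =>
      sface_cyc_apply n i (by have := Finset.mem_range.1 hi; omega) x]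
    abel
  simp only [LinearMap.sub_apply, Module.End.one_apply, map_sub, bHoch_apply, h1]
  rw [cyc_sface_last]
  abel

theorem norm_cyc (n : ℕ) : norm k A n * cyc k A n = norm k A n := by
  have h := geom_sum_mul (cyc k A n) (n + 1)
  rw [cyc_pow, sub_self, mul_sub, mul_one, sub_eq_zero] at h
  exact h

theorem cyc_norm (n : ℕ) : cyc k A n * norm k A n = norm k A n := by
  have h := mul_geom_sum (cyc k A n) (n + 1)
  rw [cyc_pow, sub_self, sub_mul, one_mul, sub_eq_zero] at h
  exact h

theorem norm_cyc_pow (n i : ℕ) : norm k A n * cyc k A n ^ i = norm k A n := by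
  induction i with
  | zero => simp
  | succ i ih => rw [pow_succ, ← mul_assoc, ih, norm_cyc]

theorem cyc_pow_norm (n i : ℕ) : cyc k A n ^ i * norm k A n = norm k A n := by
  induction i with
  | zero => simp
  | succ i ih => rw [pow_succ, mul_assoc, cyc_norm, ih]

/-- `b' N = N b`. -/
theorem bBar_norm (n : ℕ) (x) :
    bBar k A n (norm k A (n + 1) x) = norm k A n (bHoch k A n x) := by
  have h1 : bBar k A n (norm k A (n + 1) x) = norm k A n (sface k A n 0 (norm k A (n + 1) x)) := by
    rw [bBar_apply]
    conv_rhs => rw [norm, LinearMap.sum_apply]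
    refine Finset.sum_congr rfl fun i hi => ?_
    conv_lhs => rw [← cyc_pow_norm (n + 1) i, Module.End.mul_apply]
    exact sface_cyc_pow n i (by have := Finset.mem_range.1 hi; omega) _
  have h2 : ∀ i ∈ Finset.range (n + 1), norm k A n (sface k A n i x) =
      norm k A n (sface k A n 0 ((cyc k A (n + 1) ^ (n + 2 - i)) x)) := by
    intro i hi
    have hi' := Finset.mem_range.1 hi
    have h : x = (cyc k A (n + 1) ^ i) ((cyc k A (n + 1) ^ (n + 2 - i)) x) := by
      rw [← Module.End.mul_apply, ← pow_add, Nat.add_sub_cancel' (by omega), cyc_pow,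
        Module.End.one_apply]
    conv_lhs => rw [h]
    rw [sface_cyc_pow _ _ (by omega), ← Module.End.mul_apply, norm_cyc_pow]
  rw [h1, bHoch_apply, map_add, bBar_apply, map_sum, Finset.sum_congr rfl h2]
  rw [← map_sum, ← map_sum, ← map_add, ← map_add]
  congr 2
  conv_lhs => rw [← norm_cyc, Module.End.mul_apply, norm, LinearMap.sum_apply]
  rw [← Finset.sum_range_reflect, Finset.sum_range_succ]
  congr 1
  · refine Finset.sum_congr rfl fun i hi => ?_
    have hi' := Finset.mem_range.1 hi
    rw [← Module.End.mul_apply, ← pow_succ]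
    congr 2
    omega
  · simp

/-- The faces of the Hochschild complex, including the last one. -/
def hface (k : Type u) [Field k] (A : Type v) [NonUnitalRing A] [Module k A]
    [IsScalarTower k A A] [SMulCommClass k A A] (n i : ℕ) :
    TPow k A (n + 2) →ₗ[k] TPow k A (n + 1) :=
  if i ≤ n then face k A n i else face k A n 0 ∘ₗ rot k A (n + 1)

theorem face_rot_apply (n i : ℕ) (hi : i + 1 ≤ n) (x) :
    face k A n (i + 1) (rot k A (n + 1) x) = rot k A n (face k A n i x) :=
  LinearMap.congr_fun (face_rot n i hi) x

theorem face_face_apply (n i j : ℕ) (hij : i < j) (hj : j ≤ n + 1) (x) :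
    face k A n i (face k A (n + 1) j x) = face k A n (j - 1) (face k A (n + 1) i x) :=
  LinearMap.congr_fun (face_face n i j hij hj) x

theorem rot_face_last (n : ℕ) (x) :
    rot k A n (face k A n n x) = face k A n 0 (rot k A (n + 1) (rot k A (n + 1) x)) := by
  have h := cyc_sface_last (k := k) (A := A) n x
  simp only [cyc, sface, LinearMap.smul_apply, map_smul, smul_smul] at h
  rw [← mul_pow, pow_zero, mul_one, ← mul_pow] at h
  simpa using h

theorem hface_hface (n i j : ℕ) (hij : i < j) (hj : j ≤ n + 2) :
    hface k A n i ∘ₗ hface k A (n + 1) j = hface k A n (j - 1) ∘ₗ hface k A (n + 1) i := by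
  refine LinearMap.ext fun x => ?_
  simp only [LinearMap.comp_apply]
  rcases Nat.lt_or_ge j (n + 2) with h | h
  · simp only [hface, if_pos (show j ≤ n + 1 by omega), if_pos (show j - 1 ≤ n by omega),
      if_pos (show i ≤ n by omega), if_pos (show i ≤ n + 1 by omega)]
    exact face_face_apply n i j hij (by omega) x
  obtain rfl : j = n + 2 := by omega
  simp only [hface, if_neg (show ¬ n + 2 ≤ n + 1 by omega), if_neg (show ¬ n + 2 - 1 ≤ n by omega),
    if_pos (show i ≤ n + 1 by omega), LinearMap.comp_apply]
  rcases Nat.lt_or_ge i (n + 1) with h' | h'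
  · rw [if_pos (by omega), ← face_rot_apply (n + 1) i (by omega),
      face_face_apply n 0 (i + 1) (by omega) (by omega), Nat.add_sub_cancel]
  · obtain rfl : i = n + 1 := by omega
    rw [if_neg (by omega), LinearMap.comp_apply, rot_face_last, ← face_rot_apply (n + 1) 0 (by omega),
      face_face_apply n 0 1 (by omega) (by omega)]

theorem sum_sign_cancel {M : Type w} [AddCommGroup M] [Module k M] (m : ℕ) (g : ℕ → ℕ → M)
    (hg : ∀ i j, i < j → j ≤ m → g i j = g (j - 1) i) :
    ∑ j ∈ Finset.range (m + 1), ∑ i ∈ Finset.range m, ((-1 : k) ^ j * (-1) ^ i) • g i j = 0 := by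
  rw [Finset.sum_comm, ← Finset.sum_product']
  refine Finset.sum_involution
    (fun p _ => if p.1 < p.2 then (p.2 - 1, p.1) else (p.2, p.1 + 1)) ?_ ?_ ?_ ?_
  · rintro ⟨i, j⟩ h
    simp only [Finset.mem_product, Finset.mem_range] at h
    dsimp only
    split_ifs with hij
    · obtain ⟨j, rfl⟩ : ∃ j', j = j' + 1 := ⟨j - 1, by omega⟩
      rw [hg i (j + 1) hij (by omega), Nat.add_sub_cancel, ← add_smul]
      convert zero_smul k _
      ring
    · rw [hg j (i + 1) (by omega) (by omega), Nat.add_sub_cancel, ← add_smul]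
      convert zero_smul k _
      ring
  · rintro ⟨i, j⟩ h _
    dsimp only
    split_ifs <;> simp only [ne_eq, Prod.mk.injEq] <;> omega
  · rintro ⟨i, j⟩ h
    simp only [Finset.mem_product, Finset.mem_range] at h ⊢
    split_ifs <;> dsimp only <;> omega
  · rintro ⟨i, j⟩ h
    dsimp only
    by_cases hij : i < j
    · rw [if_pos hij, if_neg (by dsimp only; omega)]
      exact Prod.ext (by first | rfl | (dsimp only; omega)) (by first | rfl | (dsimp only; omega))
    · rw [if_neg hij, if_pos (by dsimp only; omega)]
      exact Prod.ext (by first | rfl | (dsimp only; omega)) (by first | rfl | (dsimp only; omega))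

theorem bBar_bBar (n : ℕ) : bBar k A n ∘ₗ bBar k A (n + 1) = 0 := by
  have := sum_sign_cancel (k := k) (n + 1)
    (fun i j => face k A n i ∘ₗ face k A (n + 1) j) (fun i j hij hj => face_face n i j hij hj)
  refine LinearMap.ext fun x => ?_
  simpa only [bBar, LinearMap.sum_apply, LinearMap.comp_apply, LinearMap.smul_apply, map_sum,
    map_smul, Finset.smul_sum, smul_smul] using LinearMap.congr_fun this x

theorem bHoch_eq (n : ℕ) :
    bHoch k A n = ∑ i ∈ Finset.range (n + 2), (-1 : k) ^ i • hface k A n i := by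
  rw [Finset.sum_range_succ, bHoch, bBar]
  congr 1
  · refine Finset.sum_congr rfl fun i hi => ?_
    have := Finset.mem_range.1 hi
    rw [hface, if_pos (by omega)]
  · rw [hface, if_neg (by omega)]

theorem bHoch_bHoch (n : ℕ) : bHoch k A n ∘ₗ bHoch k A (n + 1) = 0 := by
  have := sum_sign_cancel (k := k) (n + 2)
    (fun i j => hface k A n i ∘ₗ hface k A (n + 1) j) (fun i j hij hj => hface_hface n i j hij hj)
  refine LinearMap.ext fun x => ?_
  simpa only [bHoch_eq, LinearMap.sum_apply, LinearMap.comp_apply, LinearMap.smul_apply, map_sum,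
    map_smul, Finset.smul_sum, smul_smul] using LinearMap.congr_fun this x

variable {B : Type w} [NonUnitalRing B] [Module k B] [IsScalarTower k B B] [SMulCommClass k B B]

/-- The map `f^{⊗ n}`. -/
def tmap (f : A →ₙₐ[k] B) (n : ℕ) : TPow k A n →ₗ[k] TPow k B n :=
  PiTensorProduct.map (fun _ => (f : A →ₗ[k] B))

theorem tmap_tprod (f : A →ₙₐ[k] B) (n : ℕ) (a : Fin n → A) :
    tmap f n (PiTensorProduct.tprod k a) = PiTensorProduct.tprod k (fun i => f (a i)) := by
  simp [tmap]

theorem tmap_id (n : ℕ) : tmap (NonUnitalAlgHom.id k A) n = LinearMap.id := by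
  refine PiTensorProduct.ext (MultilinearMap.ext fun a => ?_)
  simp only [LinearMap.compMultilinearMap_apply, tmap_tprod]
  rfl

theorem tmap_comp {C : Type x} [NonUnitalRing C] [Module k C] (g : B →ₙₐ[k] C) (f : A →ₙₐ[k] B)
    (n : ℕ) : tmap (g.comp f) n = tmap g n ∘ₗ tmap f n := by
  refine PiTensorProduct.ext (MultilinearMap.ext fun a => ?_)
  simp only [LinearMap.compMultilinearMap_apply, LinearMap.comp_apply, tmap_tprod]
  rfl

theorem tmap_face (f : A →ₙₐ[k] B) (n i : ℕ) :
    tmap f (n + 1) ∘ₗ face k A n i = face k B n i ∘ₗ tmap f (n + 2) := by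
  refine PiTensorProduct.ext (MultilinearMap.ext fun a => ?_)
  simp only [LinearMap.compMultilinearMap_apply, LinearMap.comp_apply, tmap_tprod, face,
    PiTensorProduct.lift.tprod, mulAtMultilinear, MultilinearMap.coe_mk]
  congr 1
  ext j
  simp only [mulAt]
  split_ifs <;> simp

theorem tmap_rot (f : A →ₙₐ[k] B) (n : ℕ) :
    tmap f (n + 1) ∘ₗ rot k A n = rot k B n ∘ₗ tmap f (n + 1) := by
  refine PiTensorProduct.ext (MultilinearMap.ext fun a => ?_)
  simp only [LinearMap.compMultilinearMap_apply, LinearMap.comp_apply, tmap_tprod, rot_tprod]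

theorem tmap_cyc (f : A →ₙₐ[k] B) (n : ℕ) (x) :
    tmap f (n + 1) (cyc k A n x) = cyc k B n (tmap f (n + 1) x) := by
  simp only [cyc, LinearMap.smul_apply, map_smul]
  rw [← LinearMap.comp_apply, tmap_rot, LinearMap.comp_apply]

theorem tmap_cyc_pow (f : A →ₙₐ[k] B) (n i : ℕ) (x) :
    tmap f (n + 1) ((cyc k A n ^ i) x) = (cyc k B n ^ i) (tmap f (n + 1) x) := by
  induction i with
  | zero => rfl
  | succ i ih => simp only [pow_succ', Module.End.mul_apply, tmap_cyc, ih]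

theorem tmap_norm (f : A →ₙₐ[k] B) (n : ℕ) (x) :
    tmap f (n + 1) (norm k A n x) = norm k B n (tmap f (n + 1) x) := by
  simp only [norm, LinearMap.sum_apply, map_sum, tmap_cyc_pow]

theorem tmap_bBar (f : A →ₙₐ[k] B) (n : ℕ) :
    tmap f (n + 1) ∘ₗ bBar k A n = bBar k B n ∘ₗ tmap f (n + 2) := by
  refine LinearMap.ext fun x => ?_
  simp only [LinearMap.comp_apply, bBar, LinearMap.sum_apply, map_sum, LinearMap.smul_apply,
    map_smul]
  refine Finset.sum_congr rfl fun i _ => ?_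
  rw [← LinearMap.comp_apply, tmap_face, LinearMap.comp_apply]

theorem tmap_bHoch (f : A →ₙₐ[k] B) (n : ℕ) :
    tmap f (n + 1) ∘ₗ bHoch k A n = bHoch k B n ∘ₗ tmap f (n + 2) := by
  refine LinearMap.ext fun x => ?_
  rw [bHoch, bHoch, LinearMap.comp_add, LinearMap.add_comp, tmap_bBar, LinearMap.comp_smul,
    LinearMap.smul_comp, ← LinearMap.comp_assoc, tmap_face, LinearMap.comp_assoc, tmap_rot,
    ← LinearMap.comp_assoc]

end Unbundled

/-! ### The complexes as functors -/

section Functors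

variable (k : Type u) [Field k]

/-- The Hochschild complex `C(A)`, with `C_n(A) = A^{⊗ (n+1)}` and differential `b`. -/
abbrev hochschildObj (A : NUAlg.{u, v} k) : ChainComplex (ModuleCat.{max u v} k) ℕ :=
  ChainComplex.of (fun n => ModuleCat.of k (TPow k A (n + 1)))
    (fun n => ModuleCat.ofHom (bHoch k A n))
    (fun n => by rw [← ModuleCat.ofHom_comp, bHoch_bHoch]; rfl)

theorem hochschildObj_d (A : NUAlg.{u, v} k) (n : ℕ) :
    (hochschildObj k A).d (n + 1) n = ModuleCat.ofHom (bHoch k A n) :=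
  ChainComplex.of_d (fun n => ModuleCat.of k (TPow k A (n + 1)))
    (fun n => ModuleCat.ofHom (bHoch k A n)) n

/-- The Hochschild complex as a functor of the algebra. -/
def hochschildComplex : NUAlg.{u, v} k ⥤ ChainComplex (ModuleCat.{max u v} k) ℕ where
  obj A := hochschildObj k A
  map f := ChainComplex.ofHom (fun n => ModuleCat.ofHom (tmap f.hom (n + 1)))
    (fun n => by
      rw [hochschildObj_d, hochschildObj_d, ← ModuleCat.ofHom_comp, ← ModuleCat.ofHom_comp,
        tmap_bHoch])
  map_id A := by
    ext n : 1
    exact congrArg ModuleCat.ofHom (tmap_id (k := k) (A := A) (n + 1))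
  map_comp f g := by
    ext n : 1
    exact congrArg ModuleCat.ofHom (tmap_comp g.hom f.hom (n + 1))

/-- The bar complex `C^{bar}(A)`, with `C^{bar}_n(A) = A^{⊗ (n+1)}` and differential `b'`. -/
abbrev barObj (A : NUAlg.{u, v} k) : ChainComplex (ModuleCat.{max u v} k) ℕ :=
  ChainComplex.of (fun n => ModuleCat.of k (TPow k A (n + 1)))
    (fun n => ModuleCat.ofHom (bBar k A n))
    (fun n => by rw [← ModuleCat.ofHom_comp, bBar_bBar]; rfl)

theorem barObj_d (A : NUAlg.{u, v} k) (n : ℕ) :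
    (barObj k A).d (n + 1) n = ModuleCat.ofHom (bBar k A n) :=
  ChainComplex.of_d (fun n => ModuleCat.of k (TPow k A (n + 1)))
    (fun n => ModuleCat.ofHom (bBar k A n)) n

/-- The bar complex as a functor of the algebra. -/
def barComplex : NUAlg.{u, v} k ⥤ ChainComplex (ModuleCat.{max u v} k) ℕ where
  obj A := barObj k A
  map f := ChainComplex.ofHom (fun n => ModuleCat.ofHom (tmap f.hom (n + 1)))
    (fun n => by
      rw [barObj_d, barObj_d, ← ModuleCat.ofHom_comp, ← ModuleCat.ofHom_comp,
        tmap_bBar])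
  map_id A := by
    ext n : 1
    exact congrArg ModuleCat.ofHom (tmap_id (k := k) (A := A) (n + 1))
  map_comp f g := by
    ext n : 1
    exact congrArg ModuleCat.ofHom (tmap_comp g.hom f.hom (n + 1))

/-- The map `1 - t` from the bar complex to the Hochschild complex. -/
def oneSubCycObj (A : NUAlg.{u, v} k) : barObj k A ⟶ hochschildObj k A :=
  ChainComplex.ofHom (fun n => ModuleCat.ofHom ((1 - cyc k A n : Module.End k (TPow k A (n + 1)))))
    (fun n => by
      rw [hochschildObj_d, barObj_d, ← ModuleCat.ofHom_comp, ← ModuleCat.ofHom_comp]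
      exact congrArg ModuleCat.ofHom (LinearMap.ext fun x => bHoch_one_sub_cyc n x))

/-- The map `1 - t` from the bar complex to the Hochschild complex, as a natural transformation. -/
def oneSubCyc : barComplex.{u, v} k ⟶ hochschildComplex.{u, v} k where
  app A := oneSubCycObj k A
  naturality A B f := by
    ext n : 1
    have h : (1 - cyc k B n : Module.End k (TPow k B (n + 1))) ∘ₗ tmap f.hom (n + 1) = tmap f.hom (n + 1) ∘ₗ (1 - cyc k A n : Module.End k (TPow k A (n + 1))) :=
      LinearMap.ext fun x => by simp [tmap_cyc]
    exact congrArg ModuleCat.ofHom h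

/-- The map `N` from the Hochschild complex to the bar complex. -/
def normMapObj (A : NUAlg.{u, v} k) : hochschildObj k A ⟶ barObj k A :=
  ChainComplex.ofHom (fun n => ModuleCat.ofHom (norm k A n))
    (fun n => by
      rw [hochschildObj_d, barObj_d, ← ModuleCat.ofHom_comp, ← ModuleCat.ofHom_comp]
      exact congrArg ModuleCat.ofHom (LinearMap.ext fun x => bBar_norm n x))

/-- The map `N` from the Hochschild complex to the bar complex, as a natural transformation. -/
def normMap : hochschildComplex.{u, v} k ⟶ barComplex.{u, v} k where
  app A := normMapObj k A
  naturality A B f := by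
    ext n : 1
    have h : norm k B n ∘ₗ tmap f.hom (n + 1) = tmap f.hom (n + 1) ∘ₗ norm k A n :=
      LinearMap.ext fun x => by simp [tmap_norm]
    exact congrArg ModuleCat.ofHom h

theorem normMap_oneSubCyc : normMap.{u, v} k ≫ oneSubCyc.{u, v} k = 0 := by
  ext A n : 3
  refine congrArg ModuleCat.ofHom ?_
  change (1 - cyc k A n) * norm k A n = 0
  rw [sub_mul, one_mul, cyc_norm, sub_self]

theorem oneSubCyc_normMap : oneSubCyc.{u, v} k ≫ normMap.{u, v} k = 0 := by
  ext A n : 3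
  refine congrArg ModuleCat.ofHom ?_
  change norm k A n * (1 - cyc k A n) = 0
  rw [mul_sub, mul_one, norm_cyc, sub_self]

/-- The columns of the cyclic bicomplex: `C(A), C^{bar}(A), C(A), C^{bar}(A), …`. -/
def cyclicColumn : ℕ → (NUAlg.{u, v} k ⥤ ChainComplex (ModuleCat.{max u v} k) ℕ)
  | 0 => hochschildComplex k
  | 1 => barComplex k
  | p + 2 => cyclicColumn p

/-- The horizontal maps of the cyclic bicomplex, from column `p + 1` to column `p`:
`1 - t, N, 1 - t, N, …`. -/
def cyclicRow : ∀ p : ℕ, cyclicColumn.{u, v} k (p + 1) ⟶ cyclicColumn.{u, v} k p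
  | 0 => oneSubCyc k
  | 1 => normMap k
  | p + 2 => cyclicRow p

theorem cyclicRow_comp : ∀ p : ℕ, cyclicRow.{u, v} k (p + 1) ≫ cyclicRow.{u, v} k p = 0
  | 0 => normMap_oneSubCyc k
  | 1 => oneSubCyc_normMap k
  | p + 2 => cyclicRow_comp p

/-- The cyclic bicomplex, functorially in the algebra; squares commute, and the signs `(-1)^p`
of the vertical differentials in column `p` are supplied by the total complex. -/
def cyclicBicomplex : NUAlg.{u, v} k ⥤ HomologicalComplex₂ (ModuleCat.{max u v} k)
    (ComplexShape.down ℕ) (ComplexShape.down ℕ) :=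
  (ChainComplex.of (cyclicColumn.{u, v} k) (cyclicRow k) (cyclicRow_comp k)).asFunctor

/-- The columns `0` and `1` of the cyclic bicomplex. -/
def cyclicColumnTwo : ℕ → (NUAlg.{u, v} k ⥤ ChainComplex (ModuleCat.{max u v} k) ℕ)
  | 0 => hochschildComplex k
  | 1 => barComplex k
  | _ + 2 => 0

/-- The horizontal maps of the cyclic bicomplex with columns `≥ 2` deleted. -/
def cyclicRowTwo : ∀ p : ℕ, cyclicColumnTwo.{u, v} k (p + 1) ⟶ cyclicColumnTwo.{u, v} k p
  | 0 => oneSubCyc k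
  | _ + 1 => 0

theorem cyclicRowTwo_comp (p : ℕ) : cyclicRowTwo.{u, v} k (p + 1) ≫ cyclicRowTwo.{u, v} k p = 0 :=
  zero_comp

/-- The cyclic bicomplex with all columns of index `≥ 2` deleted. -/
def cyclicBicomplexTwo : NUAlg.{u, v} k ⥤ HomologicalComplex₂ (ModuleCat.{max u v} k)
    (ComplexShape.down ℕ) (ComplexShape.down ℕ) :=
  (ChainComplex.of (cyclicColumnTwo.{u, v} k) (cyclicRowTwo k) (cyclicRowTwo_comp k)).asFunctor

/-- `CC(A)`: the total complex of the cyclic bicomplex. -/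
def CC : NUAlg.{u, v} k ⥤ ChainComplex (ModuleCat.{max u v} k) ℕ :=
  cyclicBicomplex k ⋙ HomologicalComplex₂.totalFunctor _ _ _ (ComplexShape.down ℕ)

/-- `CC^{2}(A)`: the total complex of the first two columns of the cyclic bicomplex. -/
def CCTwo : NUAlg.{u, v} k ⥤ ChainComplex (ModuleCat.{max u v} k) ℕ :=
  cyclicBicomplexTwo k ⋙ HomologicalComplex₂.totalFunctor _ _ _ (ComplexShape.down ℕ)

variable {k}

/-- The total complex `Tot Φ(A_*)` of a functorial chain complex `Φ` applied to a simplicial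
algebra. -/
def totSimplicial (Φ : NUAlg.{u, v} k ⥤ ChainComplex (ModuleCat.{max u v} k) ℕ) :
    SimplicialObject (NUAlg.{u, v} k) ⥤ ChainComplex (ModuleCat.{max u v} k) ℕ :=
  ((SimplicialObject.whiskering _ _).obj Φ ⋙ AlgebraicTopology.alternatingFaceMapComplex _) ⋙
    HomologicalComplex₂.totalFunctor _ _ _ (ComplexShape.down ℕ)

end Functors

end Hochschild

/-! ### Actions, semidirect products and crossed modules -/

/-- An action of the algebra `A` on the algebra `R`: an `A`-bimodule structure on `R` that is
compatible with the multiplication of `R`. Here `la a r` is `a r` and `ra r a` is `r a`. -/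
structure AlgAction (k : Type u) [Field k] (A R : NUAlg.{u, v} k) where
  la : A →ₗ[k] R →ₗ[k] R
  ra : R →ₗ[k] A →ₗ[k] R
  mul_la : ∀ a a' r, la (a * a') r = la a (la a' r)
  ra_mul : ∀ r a a', ra r (a * a') = ra (ra r a) a'
  la_ra : ∀ a r a', ra (la a r) a' = la a (ra r a')
  la_mul : ∀ a r r', la a (r * r') = la a r * r'
  ra_mul_la : ∀ r a r', ra r a * r' = r * la a r'
  mul_ra : ∀ r r' a, ra (r * r') a = r * ra r' a

/-- A crossed module `(R, A, ρ)` of algebras. -/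
structure XMod (k : Type u) [Field k] : Type (max u (v + 1)) where
  R : NUAlg.{u, v} k
  A : NUAlg.{u, v} k
  ρ : R →ₙₐ[k] A
  act : AlgAction k A R
  ρ_la : ∀ a r, ρ (act.la a r) = a * ρ r
  ρ_ra : ∀ r a, ρ (act.ra r a) = ρ r * a
  peiffer_left : ∀ r r', act.la (ρ r) r' = r * r'
  peiffer_right : ∀ r r', act.ra r (ρ r') = r * r'

namespace AlgAction

variable {k : Type u} [Field k] {A R : NUAlg.{u, v} k}

/-- The underlying vector space `R ⊕ A` of the semidirect product `R ⋊ A`. -/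
def SemiDirect (_act : AlgAction k A R) : Type v := R × A

variable (act : AlgAction k A R)

instance : AddCommGroup act.SemiDirect := inferInstanceAs (AddCommGroup (R × A))

instance : Module k act.SemiDirect := inferInstanceAs (Module k (R × A))

/-- `(r, a) (r', a') = (r r' + a r' + r a', a a')`. -/
instance : Mul act.SemiDirect :=
  ⟨fun x y => (x.1 * y.1 + act.la x.2 y.1 + act.ra x.1 y.2, x.2 * y.2)⟩

variable {act}

@[ext]
theorem SemiDirect.ext {x y : act.SemiDirect} (h1 : x.1 = y.1) (h2 : x.2 = y.2) : x = y :=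
  Prod.ext h1 h2

theorem SemiDirect.mul_fst (x y : act.SemiDirect) :
    (x * y).1 = x.1 * y.1 + act.la x.2 y.1 + act.ra x.1 y.2 := rfl

theorem SemiDirect.mul_snd (x y : act.SemiDirect) : (x * y).2 = x.2 * y.2 := rfl

theorem SemiDirect.add_fst (x y : act.SemiDirect) : (x + y).1 = x.1 + y.1 := rfl

theorem SemiDirect.add_snd (x y : act.SemiDirect) : (x + y).2 = x.2 + y.2 := rfl

theorem SemiDirect.smul_fst (c : k) (x : act.SemiDirect) : (c • x).1 = c • x.1 := rfl

theorem SemiDirect.smul_snd (c : k) (x : act.SemiDirect) : (c • x).2 = c • x.2 := rfl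

theorem SemiDirect.zero_fst : (0 : act.SemiDirect).1 = 0 := rfl

theorem SemiDirect.zero_snd : (0 : act.SemiDirect).2 = 0 := rfl

open SemiDirect in
instance : NonUnitalRing act.SemiDirect :=
  { (inferInstance : AddCommGroup act.SemiDirect), (inferInstance : Mul act.SemiDirect) with
    left_distrib := fun x y z => by
      ext
      · simp only [mul_fst, add_fst, add_snd, map_add, mul_add]; abel
      · simp only [mul_snd, add_snd, mul_add]
    right_distrib := fun x y z => by
      ext
      · simp only [mul_fst, add_fst, add_snd, map_add, add_mul, LinearMap.add_apply]; abel
      · simp only [mul_snd, add_snd, add_mul]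
    zero_mul := fun x => by
      ext
      · simp [mul_fst, zero_fst, zero_snd]
      · simp [mul_snd, zero_snd]
    mul_zero := fun x => by
      ext
      · simp [mul_fst, zero_fst, zero_snd]
      · simp [mul_snd, zero_snd]
    mul_assoc := fun x y z => by
      ext
      · simp only [mul_fst, mul_snd, map_add, add_mul, mul_add, LinearMap.add_apply, act.mul_la,
          act.ra_mul, act.la_ra, act.la_mul, act.ra_mul_la, act.mul_ra, mul_assoc]
        abel
      · simp only [mul_snd, mul_assoc] }

open SemiDirect in
instance : IsScalarTower k act.SemiDirect act.SemiDirect :=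
  ⟨fun c x y => by
    simp only [smul_eq_mul]
    ext
    · simp [mul_fst, smul_fst, smul_snd, smul_mul_assoc]
    · simp [mul_snd, smul_snd, smul_mul_assoc]⟩

open SemiDirect in
instance : SMulCommClass k act.SemiDirect act.SemiDirect :=
  ⟨fun c x y => by
    simp only [smul_eq_mul]
    ext
    · simp [mul_fst, smul_fst, smul_snd, mul_smul_comm]
    · simp [mul_snd, smul_snd, mul_smul_comm]⟩

end AlgAction

namespace XMod

variable {k : Type u} [Field k]

/-- Morphisms `(μ, ν)` of crossed modules. -/
@[ext]
structure Hom (X : XMod.{u, v} k) (Y : XMod.{u, w} k) : Type (max v w) where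
  μ : X.R →ₙₐ[k] Y.R
  ν : X.A →ₙₐ[k] Y.A
  comm : ∀ r, Y.ρ (μ r) = ν (X.ρ r)
  map_la : ∀ a r, μ (X.act.la a r) = Y.act.la (ν a) (μ r)
  map_ra : ∀ r a, μ (X.act.ra r a) = Y.act.ra (μ r) (ν a)

/-- The identity morphism. -/
def Hom.id (X : XMod.{u, v} k) : Hom X X where
  μ := NonUnitalAlgHom.id k X.R
  ν := NonUnitalAlgHom.id k X.A
  comm _ := rfl
  map_la _ _ := rfl
  map_ra _ _ := rfl

/-- The composition `g ∘ f`. -/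
def Hom.comp {X : XMod.{u, v} k} {Y : XMod.{u, w} k} {Z : XMod.{u, x} k} (g : Hom Y Z)
    (f : Hom X Y) : Hom X Z where
  μ := g.μ.comp f.μ
  ν := g.ν.comp f.ν
  comm r := by simp [g.comm, f.comm]
  map_la a r := by simp [g.map_la, f.map_la]
  map_ra r a := by simp [g.map_ra, f.map_ra]

instance : Category (XMod.{u, v} k) where
  Hom X Y := Hom X Y
  id X := Hom.id X
  comp f g := Hom.comp g f

variable (X : XMod.{u, v} k)

/-- The subspace `[A, R]` of `R` spanned by the elements `a r - r a`. -/
def commutator : Submodule k X.R :=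
  Submodule.span k {y | ∃ (a : X.A) (r : X.R), y = X.act.la a r - X.act.ra r a}

/-! ### The nerve -/

/-- The underlying vector space of `𝔑_n(R, A, ρ)`; its elements are `((r_1, …, r_n), a)`, and
`r_{i+1}` is the component with index `i : Fin n`. -/
def Nerve (n : ℕ) : Type v := (Fin n → X.R) × X.A

variable {X}

namespace Nerve

variable {n : ℕ}

instance : AddCommGroup (X.Nerve n) := inferInstanceAs (AddCommGroup ((Fin n → X.R) × X.A))

instance : Module k (X.Nerve n) := inferInstanceAs (Module k ((Fin n → X.R) × X.A))

@[ext]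
theorem ext {x y : X.Nerve n} (h1 : ∀ i, x.1 i = y.1 i) (h2 : x.2 = y.2) : x = y :=
  Prod.ext (funext h1) h2

theorem add_fst (x y : X.Nerve n) (i : Fin n) : (x + y).1 i = x.1 i + y.1 i := rfl

theorem add_snd (x y : X.Nerve n) : (x + y).2 = x.2 + y.2 := rfl

theorem smul_fst (c : k) (x : X.Nerve n) (i : Fin n) : (c • x).1 i = c • x.1 i := rfl

theorem smul_snd (c : k) (x : X.Nerve n) : (c • x).2 = c • x.2 := rfl

/-- `tail j ((r_1, …, r_n), a) = r_{j+1} + ⋯ + r_n`. -/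
def tail (j : ℕ) : X.Nerve n →ₗ[k] X.R where
  toFun x := ∑ i : Fin n, if j ≤ (i : ℕ) then x.1 i else 0
  map_add' x y := by
    rw [← Finset.sum_add_distrib]
    refine Finset.sum_congr rfl fun i _ => ?_
    split_ifs <;> simp [add_fst]
  map_smul' c x := by
    simp only [RingHom.id_apply, Finset.smul_sum]
    refine Finset.sum_congr rfl fun i _ => ?_
    split_ifs <;> simp [smul_fst]

/-- The multiplication of the iterated semidirect product `R ⋊ (⋯ (R ⋊ A) ⋯)`. In
`R ⋊ 𝔑_{n-1}(R, A, ρ)` the algebra `𝔑_{n-1}(R, A, ρ)` acts on `R` through the homomorphism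
`(r_2, …, r_n, a) ↦ ρ(r_2) + ⋯ + ρ(r_n) + a` to `A`, the target map of iterated composition. -/
instance : Mul (X.Nerve n) :=
  ⟨fun x y =>
    (fun j => x.1 j * y.1 j + X.act.la (X.ρ (tail (j + 1) x) + x.2) (y.1 j) +
        X.act.ra (x.1 j) (X.ρ (tail (j + 1) y) + y.2),
      x.2 * y.2)⟩

theorem mul_fst (x y : X.Nerve n) (j : Fin n) : (x * y).1 j =
    x.1 j * y.1 j + X.act.la (X.ρ (tail (j + 1) x) + x.2) (y.1 j) +
        X.act.ra (x.1 j) (X.ρ (tail (j + 1) y) + y.2) := rfl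

theorem mul_snd (x y : X.Nerve n) : (x * y).2 = x.2 * y.2 := rfl

theorem tail_of_le (x : X.Nerve n) (j : ℕ) (h : n ≤ j) : tail j x = 0 := by
  change ∑ i : Fin n, (if j ≤ (i : ℕ) then x.1 i else 0) = 0
  exact Finset.sum_eq_zero fun i _ => if_neg (by have := i.isLt; omega)

theorem tail_eq (x : X.Nerve n) (j : Fin n) : tail j x = x.1 j + tail (j + 1) x := by
  simp only [tail, LinearMap.coe_mk, AddHom.coe_mk]
  have h : ∀ i : Fin n, (if (j : ℕ) ≤ i then x.1 i else 0) =
      (if i = j then x.1 i else 0) + (if (j : ℕ) + 1 ≤ i then x.1 i else 0) := by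
    intro i
    simp only [Fin.ext_iff]
    split_ifs <;> first | omega | simp
  rw [Finset.sum_congr rfl fun i _ => h i, Finset.sum_add_distrib]
  simp

theorem tail_mul (x y : X.Nerve n) (j : ℕ) : tail j (x * y) =
    tail j x * tail j y + X.act.la x.2 (tail j y) + X.act.ra (tail j x) y.2 := by
  by_cases hj : n ≤ j
  · simp [tail_of_le _ j hj]
  · have ih := tail_mul x y (j + 1)
    have h := fun z : X.Nerve n => tail_eq z ⟨j, by omega⟩
    simp only at h
    rw [h, h, h, ih, mul_fst]
    simp only [map_add, add_mul, mul_add, LinearMap.add_apply, X.peiffer_left, X.peiffer_right]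
    abel
termination_by n - j

/-- The embedding of `𝔑_n(R, A, ρ)` in a product of copies of `R ⋊ A`, given by the compositions
of final segments. -/
def emb (x : X.Nerve n) : Fin (n + 1) → X.act.SemiDirect := fun j => (tail j x, x.2)

theorem emb_injective : Function.Injective (emb : X.Nerve n → _) := by
  intro x y h
  have h1 : ∀ j : Fin (n + 1), tail j x = tail j y := fun j =>
    congrArg (Prod.fst : X.R × X.A → X.R) (congrFun h j)
  have h2 : x.2 = y.2 := congrArg (Prod.snd : X.R × X.A → X.A) (congrFun h 0)
  refine ext (fun i => ?_) h2
  have hx := tail_eq x i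
  have hy := tail_eq y i
  have e1 := h1 i.castSucc
  have e2 := h1 i.succ
  simp only [Fin.val_castSucc, Fin.val_succ] at e1 e2
  rw [hx, hy, e2] at e1
  exact add_right_cancel e1

theorem emb_mul (x y : X.Nerve n) : emb (x * y) = emb x * emb y := by
  funext j
  exact Prod.ext (tail_mul x y j) rfl

theorem emb_add (x y : X.Nerve n) : emb (x + y) = emb x + emb y := by
  funext j
  exact Prod.ext (map_add _ x y) rfl

theorem emb_zero : emb (0 : X.Nerve n) = 0 := by
  funext j
  exact Prod.ext (map_zero _) rfl

theorem emb_smul (c : k) (x : X.Nerve n) : emb (c • x) = c • emb x := by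
  funext j
  exact Prod.ext (map_smul _ c x) rfl

instance : NonUnitalRing (X.Nerve n) :=
  { (inferInstance : AddCommGroup (X.Nerve n)), (inferInstance : Mul (X.Nerve n)) with
    left_distrib := fun x y z => emb_injective (by simp only [emb_mul, emb_add, mul_add])
    right_distrib := fun x y z => emb_injective (by simp only [emb_mul, emb_add, add_mul])
    zero_mul := fun x => emb_injective (by simp only [emb_mul, emb_zero, zero_mul])
    mul_zero := fun x => emb_injective (by simp only [emb_mul, emb_zero, mul_zero])
    mul_assoc := fun x y z => emb_injective (by simp only [emb_mul, mul_assoc]) }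

instance : IsScalarTower k (X.Nerve n) (X.Nerve n) :=
  ⟨fun c x y => emb_injective (by simp only [smul_eq_mul, emb_mul, emb_smul, smul_mul_assoc])⟩

instance : SMulCommClass k (X.Nerve n) (X.Nerve n) :=
  ⟨fun c x y => emb_injective (by simp only [smul_eq_mul, emb_mul, emb_smul, mul_smul_comm])⟩

variable {m l : ℕ}

/-- The underlying function of the homomorphism `𝔑_n → 𝔑_m` belonging to a monotone map
`θ : [m] → [n]`: it sends `(r_1, …, r_n, a)` to `(r'_1, …, r'_m, a')`, where `r'_j` is the sum
of the `r_i` with `θ(j-1) < i ≤ θ(j)` and `a'` is `a` plus the sum of the `ρ(r_i)` with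
`θ(m) < i`. -/
def mapFun (θ : Fin (m + 1) →o Fin (n + 1)) (x : X.Nerve n) : X.Nerve m :=
  (fun j => ∑ i : Fin n, if θ j.castSucc ≤ i.castSucc ∧ i.castSucc < θ j.succ then x.1 i else 0,
    X.ρ (tail (θ (Fin.last m)) x) + x.2)

theorem mapFun_fst (θ : Fin (m + 1) →o Fin (n + 1)) (x : X.Nerve n) (j : Fin m) :
    (mapFun θ x).1 j = tail (θ j.castSucc) x - tail (θ j.succ) x := by
  simp only [mapFun, tail, LinearMap.coe_mk, AddHom.coe_mk]
  rw [← Finset.sum_sub_distrib]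
  refine Finset.sum_congr rfl fun i _ => ?_
  have h : θ j.castSucc ≤ θ j.succ := θ.monotone (Fin.castSucc_lt_succ).le
  simp only [Fin.le_def, Fin.lt_def, Fin.val_castSucc] at h ⊢
  split_ifs <;> first | omega | simp

theorem tail_mapFun (θ : Fin (m + 1) →o Fin (n + 1)) (x : X.Nerve n) (j : Fin (m + 1)) :
    tail j (mapFun θ x) = tail (θ j) x - tail (θ (Fin.last m)) x := by
  induction j using Fin.reverseInduction with
  | last => rw [sub_self, tail_of_le _ _ (by simp)]
  | cast j ih =>
    have h := tail_eq (mapFun θ x) j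
    rw [Fin.val_castSucc, h, mapFun_fst]
    rw [Fin.val_succ] at ih
    rw [ih]
    abel

theorem emb_mapFun_fst (θ : Fin (m + 1) →o Fin (n + 1)) (x : X.Nerve n) (j : Fin (m + 1)) :
    (emb (mapFun θ x) j).1 = tail (θ j) x - tail (θ (Fin.last m)) x := tail_mapFun θ x j

/-- The structure homomorphisms of the nerve. -/
def mapHom (θ : Fin (m + 1) →o Fin (n + 1)) : X.Nerve n →ₙₐ[k] X.Nerve m where
  toFun := mapFun θ
  map_smul' c x := emb_injective (by
    funext j
    rw [MonoidHom.id_apply, emb_smul]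
    refine Prod.ext ?_ ?_
    · change (emb (mapFun θ (c • x)) j).1 = c • (emb (mapFun θ x) j).1
      simp only [emb_mapFun_fst, map_smul, smul_sub]
    · change X.ρ (tail _ (c • x)) + c • x.2 = c • (X.ρ (tail _ x) + x.2)
      simp only [map_smul, smul_add])
  map_zero' := emb_injective (by
    funext j
    rw [emb_zero]
    refine Prod.ext ?_ ?_
    · change (emb (mapFun θ 0) j).1 = 0
      simp only [emb_mapFun_fst, map_zero, sub_self]
    · change X.ρ (tail _ (0 : X.Nerve n)) + (0 : X.A) = 0
      simp only [map_zero, add_zero])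
  map_add' x y := emb_injective (by
    funext j
    rw [emb_add]
    refine Prod.ext ?_ ?_
    · change (emb (mapFun θ (x + y)) j).1 = (emb (mapFun θ x) j).1 + (emb (mapFun θ y) j).1
      simp only [emb_mapFun_fst, map_add]
      abel
    · change X.ρ (tail _ (x + y)) + (x.2 + y.2) = (X.ρ (tail _ x) + x.2) + (X.ρ (tail _ y) + y.2)
      simp only [map_add]
      abel)
  map_mul' x y := emb_injective (by
    funext j
    rw [emb_mul]
    refine Prod.ext ?_ ?_
    · change (emb (mapFun θ (x * y)) j).1 =
        (emb (mapFun θ x) j).1 * (emb (mapFun θ y) j).1 +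
        X.act.la (X.ρ (tail _ x) + x.2) (emb (mapFun θ y) j).1 +
        X.act.ra (emb (mapFun θ x) j).1 (X.ρ (tail _ y) + y.2)
      simp only [emb_mapFun_fst, tail_mul, map_add, map_sub, LinearMap.add_apply,
        LinearMap.sub_apply, X.peiffer_left, X.peiffer_right, mul_sub, sub_mul]
      abel
    · change X.ρ (tail _ (x * y)) + x.2 * y.2 = (X.ρ (tail _ x) + x.2) * (X.ρ (tail _ y) + y.2)
      simp only [tail_mul, map_add, map_mul, X.ρ_la, X.ρ_ra, mul_add, add_mul]
      abel)

theorem mapHom_apply (θ : Fin (m + 1) →o Fin (n + 1)) (x : X.Nerve n) :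
    mapHom θ x = mapFun θ x := rfl

theorem mapHom_id : mapHom (X := X) (OrderHom.id : Fin (n + 1) →o Fin (n + 1)) =
    NonUnitalAlgHom.id k (X.Nerve n) := by
  refine NonUnitalAlgHom.ext fun x => emb_injective ?_
  funext j
  refine Prod.ext ?_ ?_
  · change (emb (mapFun OrderHom.id x) j).1 = tail j x
    rw [emb_mapFun_fst, OrderHom.id_coe, id, id, tail_of_le x (Fin.last n) (by simp), sub_zero]
  · change X.ρ (tail (Fin.last n) x) + x.2 = x.2
    rw [tail_of_le x (Fin.last n) (by simp), map_zero, zero_add]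

theorem mapHom_comp (θ : Fin (m + 1) →o Fin (n + 1)) (ψ : Fin (l + 1) →o Fin (m + 1)) :
    mapHom (X := X) (θ.comp ψ) = (mapHom ψ).comp (mapHom θ) := by
  refine NonUnitalAlgHom.ext fun x => emb_injective ?_
  funext j
  refine Prod.ext ?_ ?_
  · change (emb (mapFun (θ.comp ψ) x) j).1 = (emb (mapFun ψ (mapFun θ x)) j).1
    simp only [emb_mapFun_fst, tail_mapFun, OrderHom.comp_coe, Function.comp_apply]
    abel
  · change X.ρ (tail (θ (ψ (Fin.last l))) x) + x.2 =
      X.ρ (tail (ψ (Fin.last l)) (mapFun θ x)) + (X.ρ (tail (θ (Fin.last m)) x) + x.2)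
    rw [tail_mapFun, map_sub]
    abel

/-- The homomorphism of nerves in degree `n` induced by a morphism of crossed modules. -/
def homMap {Y : XMod.{u, v} k} (f : Hom X Y) (n : ℕ) : X.Nerve n →ₙₐ[k] Y.Nerve n where
  toFun x := (fun i => f.μ (x.1 i), f.ν x.2)
  map_smul' c x := ext (fun i => map_smul f.μ c (x.1 i)) (map_smul f.ν c x.2)
  map_zero' := ext (fun _ => map_zero f.μ) (map_zero f.ν)
  map_add' x y := ext (fun i => map_add f.μ (x.1 i) (y.1 i)) (map_add f.ν x.2 y.2)
  map_mul' x y := by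
    have h : ∀ (z : X.Nerve n) (j : ℕ),
        tail j (((fun i => f.μ (z.1 i)), f.ν z.2) : Y.Nerve n) = f.μ (tail j z) := by
      intro z j
      simp only [tail, LinearMap.coe_mk, AddHom.coe_mk, map_sum]
      refine Finset.sum_congr rfl fun i _ => ?_
      split_ifs <;> simp
    refine ext (fun i => ?_) (map_mul f.ν x.2 y.2)
    change f.μ ((x * y).1 i) = f.μ (x.1 i) * f.μ (y.1 i) +
      Y.act.la (Y.ρ (tail (i + 1) _) + f.ν x.2) (f.μ (y.1 i)) +
      Y.act.ra (f.μ (x.1 i)) (Y.ρ (tail (i + 1) _) + f.ν y.2)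
    rw [h, h, mul_fst, map_add, map_add, map_mul, f.map_la, f.map_ra, map_add f.ν, map_add f.ν,
      f.comm, f.comm]

theorem homMap_tail {Y : XMod.{u, v} k} (f : Hom X Y) (x : X.Nerve n) (j : ℕ) :
    tail j (homMap f n x) = f.μ (tail j x) := by
  change ∑ i : Fin n, (if j ≤ (i : ℕ) then f.μ (x.1 i) else 0) =
    f.μ (∑ i : Fin n, if j ≤ (i : ℕ) then x.1 i else 0)
  rw [map_sum]
  refine Finset.sum_congr rfl fun i _ => ?_
  split_ifs <;> simp

theorem homMap_mapHom {Y : XMod.{u, v} k} (f : Hom X Y) (θ : Fin (m + 1) →o Fin (n + 1)) :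
    (homMap f m).comp (mapHom θ) = (mapHom θ).comp (homMap f n) := by
  refine NonUnitalAlgHom.ext fun x => ext (fun i => ?_) ?_
  · change f.μ ((mapFun θ x).1 i) = (mapFun θ (homMap f n x)).1 i
    simp only [mapFun_fst, map_sub, homMap_tail]
  · change f.ν (X.ρ (tail (θ (Fin.last m)) x) + x.2) =
      Y.ρ (tail (θ (Fin.last m)) (homMap f n x)) + f.ν x.2
    rw [homMap_tail, map_add, f.comm]

end Nerve

/-- The nerve, as a functor from crossed modules to simplicial algebras. -/
def nerve (k : Type u) [Field k] : XMod.{u, v} k ⥤ SimplicialObject (NUAlg.{u, v} k) where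
  obj X :=
    { obj := fun Δ => ⟨X.Nerve Δ.unop.len⟩
      map := fun f => ⟨Nerve.mapHom f.unop.toOrderHom⟩
      map_id := fun _ => NUAlg.Hom.ext Nerve.mapHom_id
      map_comp := fun f g => NUAlg.Hom.ext (Nerve.mapHom_comp f.unop.toOrderHom g.unop.toOrderHom) }
  map f :=
    { app := fun Δ => ⟨Nerve.homMap f Δ.unop.len⟩
      naturality := fun _ _ g => NUAlg.Hom.ext (Nerve.homMap_mapHom f g.unop.toOrderHom) }
  map_id _ := rfl
  map_comp _ _ := rfl

/-- The crossed module `(0, A, 0)`. -/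
def ofAlg (A : NUAlg.{u, v} k) : XMod.{u, v} k where
  R := ⟨PUnit.{v + 1}⟩
  A := A
  ρ := 0
  act :=
    { la := 0
      ra := 0
      mul_la := fun _ _ _ => rfl
      ra_mul := fun _ _ _ => rfl
      la_ra := fun _ _ _ => rfl
      la_mul := fun _ _ _ => rfl
      ra_mul_la := fun _ _ _ => rfl
      mul_ra := fun _ _ _ => rfl }
  ρ_la a r := by simp
  ρ_ra r a := by simp
  peiffer_left _ _ := rfl
  peiffer_right _ _ := rfl

/-- The morphism `(0, 1_A) : (0, A, 0) ⟶ (R, A, ρ)`. -/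
def ofBase (X : XMod.{u, v} k) : ofAlg X.A ⟶ X :=
  Hom.mk (X := ofAlg X.A) (Y := X) 0 (NonUnitalAlgHom.id k X.A)
    (fun _ => (map_zero X.ρ))
    (fun a _ => (map_zero (X.act.la a)).symm)
    (fun _ a => by simp)

end XMod

/-! ### Free algebras, coproducts and the free crossed module -/

section Augmentation

variable {k : Type u} [Field k] {E : Type v} [Ring E] [Algebra k E]

/-- The kernel of an augmentation `ε : E → k` of a unital algebra, as a non-unital algebra. -/
def augKer (ε : E →ₐ[k] k) : NonUnitalSubalgebra k E where
  carrier := {x | ε x = 0}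
  add_mem' {x y} hx hy := by simp_all
  zero_mem' := by simp
  mul_mem' {x y} hx hy := by simp_all
  smul_mem' c x hx := by simp_all

variable {ε : E →ₐ[k] k} {B : Type w} [NonUnitalRing B] [Module k B] [IsScalarTower k B B]
  [SMulCommClass k B B]

/-- The non-unital homomorphism from the augmentation ideal to `B` given by an augmented
homomorphism from `E` to the unitization of `B`. -/
def augLift (φ : E →ₐ[k] Unitization k B) (hφ : (Unitization.fstHom k B).comp φ = ε) :
    augKer ε →ₙₐ[k] B where
  toFun x := (φ x).snd
  map_smul' c x := by simp
  map_zero' := by simp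
  map_add' x y := by simp
  map_mul' x y := by
    have h : ∀ z : augKer ε, (φ z).fst = 0 := fun z =>
      (AlgHom.congr_fun hφ (z : E)).trans z.2
    simp [h]

theorem sub_algebraMap_mem (x : E) : x - algebraMap k E (ε x) ∈ augKer ε := by
  change ε (x - algebraMap k E (ε x)) = 0
  simp

/-- The augmented homomorphism from `E` to the unitization of `B` that extends a given non-unital
homomorphism on the augmentation ideal. -/
def augExtend (f : augKer ε →ₙₐ[k] B) : E →ₐ[k] Unitization k B :=
  AlgHom.ofLinearMap
    { toFun := fun x => Unitization.inl (ε x) +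
        ((f ⟨x - algebraMap k E (ε x), sub_algebraMap_mem x⟩ : B) : Unitization k B)
      map_add' := fun x y => by
        have h : (⟨x + y - algebraMap k E (ε (x + y)), sub_algebraMap_mem _⟩ : augKer ε) =
            ⟨x - algebraMap k E (ε x), sub_algebraMap_mem x⟩ +
            ⟨y - algebraMap k E (ε y), sub_algebraMap_mem y⟩ :=
          Subtype.ext (by simp only [NonUnitalSubalgebra.coe_add, map_add]; abel)
        rw [h, map_add, map_add, Unitization.inl_add, Unitization.inr_add]
        abel
      map_smul' := fun c x => by
        have h : (⟨c • x - algebraMap k E (ε (c • x)), sub_algebraMap_mem _⟩ : augKer ε) =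
            c • ⟨x - algebraMap k E (ε x), sub_algebraMap_mem x⟩ :=
          Subtype.ext (by
            simp [Algebra.smul_def, mul_sub])
        rw [h, map_smul, map_smul, RingHom.id_apply, smul_add, Unitization.inl_smul,
          Unitization.inr_smul] }
    (by
      have h : (⟨1 - algebraMap k E (ε 1), sub_algebraMap_mem _⟩ : augKer ε) = 0 :=
        Subtype.ext (by simp)
      simp only [LinearMap.coe_mk, AddHom.coe_mk]
      rw [h, map_zero, map_one]
      simp)
    (fun x y => by
      have h : (⟨x * y - algebraMap k E (ε (x * y)), sub_algebraMap_mem _⟩ : augKer ε) =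
          ε x • ⟨y - algebraMap k E (ε y), sub_algebraMap_mem y⟩ +
          ε y • ⟨x - algebraMap k E (ε x), sub_algebraMap_mem x⟩ +
          ⟨x - algebraMap k E (ε x), sub_algebraMap_mem x⟩ *
          ⟨y - algebraMap k E (ε y), sub_algebraMap_mem y⟩ :=
        Subtype.ext (by
          simp only [NonUnitalSubalgebra.coe_add, NonUnitalSubalgebra.coe_mul,
            NonUnitalSubalgebra.coe_smul, map_mul, Algebra.smul_def, mul_sub, sub_mul,
            ← Algebra.commutes (ε y)]
          abel)
      simp only [LinearMap.coe_mk, AddHom.coe_mk]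
      rw [h, map_add f, map_add f, map_smul f, map_smul f, map_mul f, map_mul ε]
      ext
      · simp
      · simp only [Unitization.snd_add, Unitization.snd_inl, Unitization.snd_inr, zero_add,
          Unitization.snd_mul, Unitization.fst_add, Unitization.fst_inl, Unitization.fst_inr,
          add_zero])

theorem augExtend_apply (f : augKer ε →ₙₐ[k] B) (x : augKer ε) :
    augExtend f x = ((f x : B) : Unitization k B) := by
  have h : ε (x : E) = 0 := x.2
  simp [augExtend, h]

theorem augKer_hom_ext {f g : augKer ε →ₙₐ[k] B} (h : augExtend f = augExtend g) : f = g := by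
  refine NonUnitalAlgHom.ext fun x => Unitization.inr_injective (R := k) ?_
  rw [← augExtend_apply, ← augExtend_apply, h]

end Augmentation

section FreeAlgebra

variable (k : Type u) [Field k] (V : Type v) [AddCommGroup V] [Module k V]

/-- The free (non-unital) algebra `T(V)` on a vector space `V`: the augmentation ideal
`V ⊕ V^{⊗ 2} ⊕ ⋯` of the tensor algebra. -/
abbrev FreeAlg : Type (max u v) :=
  augKer (TensorAlgebra.algebraMapInv : TensorAlgebra k V →ₐ[k] k)

variable {V}

/-- The inclusion `V → T(V)`. -/
def FreeAlg.ι : V →ₗ[k] FreeAlg k V where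
  toFun v := ⟨TensorAlgebra.ι k v, by
    change TensorAlgebra.algebraMapInv (TensorAlgebra.ι k v) = 0
    simp [TensorAlgebra.algebraMapInv]⟩
  map_add' v w := Subtype.ext (map_add _ v w)
  map_smul' c v := Subtype.ext (map_smul _ c v)

variable {k} {B : Type w} [NonUnitalRing B] [Module k B] [IsScalarTower k B B]
  [SMulCommClass k B B]

/-- The homomorphism `T(V) → B` that extends a linear map `V → B`. -/
def FreeAlg.lift (f : V →ₗ[k] B) : FreeAlg k V →ₙₐ[k] B :=
  augLift (TensorAlgebra.lift k ((Unitization.inrHom k k B).comp f)) (by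
    ext v
    simp [TensorAlgebra.algebraMapInv])

theorem FreeAlg.lift_ι (f : V →ₗ[k] B) (v : V) : FreeAlg.lift f (FreeAlg.ι k v) = f v := by
  change ((TensorAlgebra.lift k ((Unitization.inrHom k k B).comp f)) (TensorAlgebra.ι k v)).snd = _
  simp

theorem FreeAlg.hom_ext {f g : FreeAlg k V →ₙₐ[k] B}
    (h : ∀ v, f (FreeAlg.ι k v) = g (FreeAlg.ι k v)) : f = g := by
  refine augKer_hom_ext (TensorAlgebra.hom_ext (LinearMap.ext fun v => ?_))
  exact (augExtend_apply f (FreeAlg.ι k v)).trans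
    ((congrArg _ (h v)).trans (augExtend_apply g (FreeAlg.ι k v)).symm)

end FreeAlgebra

section Coproduct

variable (k : Type u) [Field k] (A : Type v) [NonUnitalRing A] [Module k A]
  (B : Type w) [NonUnitalRing B] [Module k B]

/-- The relations of the coproduct `A ∗ B`: products inside `A` and inside `B` are the given
ones. -/
inductive CoprodRel : TensorAlgebra k (A × B) → TensorAlgebra k (A × B) → Prop
  | inl (a a' : A) : CoprodRel (TensorAlgebra.ι k (a * a', 0))
      (TensorAlgebra.ι k (a, 0) * TensorAlgebra.ι k (a', 0))
  | inr (b b' : B) : CoprodRel (TensorAlgebra.ι k (0, b * b'))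
      (TensorAlgebra.ι k (0, b) * TensorAlgebra.ι k (0, b'))

/-- The augmentation of the unital algebra generated by `A` and `B` that vanishes on `A`
and `B`. -/
def coprodAug : RingQuot (CoprodRel k A B) →ₐ[k] k :=
  RingQuot.liftAlgHom k ⟨TensorAlgebra.algebraMapInv, fun x y h => by
    cases h <;> simp [TensorAlgebra.algebraMapInv]⟩

theorem coprodAug_ι (v : A × B) :
    coprodAug k A B (RingQuot.mkAlgHom k (CoprodRel k A B) (TensorAlgebra.ι k v)) = 0 := by
  simp [coprodAug, TensorAlgebra.algebraMapInv]

/-- The coproduct `A ∗ B` of non-unital algebras: the ideal generated by `A` and `B` in the unital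
algebra that they generate freely, subject to the multiplications of `A` and `B`. -/
abbrev AlgCoprod : Type (max u v w) := augKer (coprodAug k A B)

variable {A B}

/-- The linear map `A × B → A ∗ B`, `(a, b) ↦ u_1(a) + u_2(b)`. -/
def AlgCoprod.ι : A × B →ₗ[k] AlgCoprod k A B where
  toFun v := ⟨RingQuot.mkAlgHom k (CoprodRel k A B) (TensorAlgebra.ι k v),
    coprodAug_ι k A B v⟩
  map_add' v w := Subtype.ext
    (map_add ((RingQuot.mkAlgHom k (CoprodRel k A B)).toLinearMap ∘ₗ TensorAlgebra.ι k) v w)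
  map_smul' c v := Subtype.ext
    (map_smul ((RingQuot.mkAlgHom k (CoprodRel k A B)).toLinearMap ∘ₗ TensorAlgebra.ι k) c v)

variable (A B) in
/-- The inclusion `u_1 : A → A ∗ B`. -/
def AlgCoprod.inl : A →ₙₐ[k] AlgCoprod k A B where
  toFun a := AlgCoprod.ι k (a, 0)
  map_smul' c a := by
    rw [MonoidHom.id_apply, ← map_smul]
    simp
  map_zero' := map_zero (AlgCoprod.ι k)
  map_add' a a' := by
    rw [← map_add]
    simp
  map_mul' a a' := Subtype.ext (by
    refine (RingQuot.mkAlgHom_rel k (CoprodRel.inl a a')).trans ?_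
    rw [map_mul]
    rfl)

variable (A B) in
/-- The inclusion `u_2 : B → A ∗ B`. -/
def AlgCoprod.inr : B →ₙₐ[k] AlgCoprod k A B where
  toFun b := AlgCoprod.ι k (0, b)
  map_smul' c a := by
    rw [MonoidHom.id_apply, ← map_smul]
    simp
  map_zero' := map_zero (AlgCoprod.ι k)
  map_add' a a' := by
    rw [← map_add]
    simp
  map_mul' b b' := Subtype.ext (by
    refine (RingQuot.mkAlgHom_rel k (CoprodRel.inr b b')).trans ?_
    rw [map_mul]
    rfl)

variable {k} {C : Type x} [NonUnitalRing C] [Module k C] [IsScalarTower k C C] [SMulCommClass k C C]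

/-- The homomorphism `A ∗ B → C` given by homomorphisms `A → C` and `B → C`. -/
def AlgCoprod.lift (f : A →ₙₐ[k] C) (g : B →ₙₐ[k] C) : AlgCoprod k A B →ₙₐ[k] C :=
  augLift (RingQuot.liftAlgHom k ⟨TensorAlgebra.lift k ((Unitization.inrHom k k C).comp
      ((f : A →ₗ[k] C).coprod (g : B →ₗ[k] C))), fun x y h => by
        cases h <;> simp [Unitization.inr_mul]⟩) (by
    refine RingQuot.ringQuot_ext' k _ _ (TensorAlgebra.hom_ext (LinearMap.ext fun v => ?_))
    simp [coprodAug, TensorAlgebra.algebraMapInv])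

theorem AlgCoprod.lift_inl (f : A →ₙₐ[k] C) (g : B →ₙₐ[k] C) (a : A) :
    AlgCoprod.lift f g (AlgCoprod.inl k A B a) = f a := by
  refine (congrArg (fun z : Unitization k C => z.snd) (RingQuot.liftAlgHom_mkAlgHom_apply k _ _ _)).trans ?_
  simp

theorem AlgCoprod.lift_inr (f : A →ₙₐ[k] C) (g : B →ₙₐ[k] C) (b : B) :
    AlgCoprod.lift f g (AlgCoprod.inr k A B b) = g b := by
  refine (congrArg (fun z : Unitization k C => z.snd) (RingQuot.liftAlgHom_mkAlgHom_apply k _ _ _)).trans ?_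
  simp

theorem AlgCoprod.hom_ext {f g : AlgCoprod k A B →ₙₐ[k] C}
    (h1 : ∀ a, f (AlgCoprod.inl k A B a) = g (AlgCoprod.inl k A B a))
    (h2 : ∀ b, f (AlgCoprod.inr k A B b) = g (AlgCoprod.inr k A B b)) : f = g := by
  refine augKer_hom_ext (RingQuot.ringQuot_ext' k _ _
    (TensorAlgebra.hom_ext (LinearMap.ext fun v => ?_)))
  have hv : AlgCoprod.ι k v = AlgCoprod.inl k A B v.1 + AlgCoprod.inr k A B v.2 := by
    change AlgCoprod.ι k v = AlgCoprod.ι k (v.1, 0) + AlgCoprod.ι k (0, v.2)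
    rw [← map_add]
    simp
  have h : f (AlgCoprod.ι k v) = g (AlgCoprod.ι k v) := by rw [hv, map_add, map_add, h1, h2]
  exact (augExtend_apply f (AlgCoprod.ι k v)).trans
    ((congrArg _ h).trans (augExtend_apply g (AlgCoprod.ι k v)).symm)

end Coproduct

namespace XMod

variable {k : Type u} [Field k]

/-- The inclusion crossed module of a two-sided ideal `I` of `A`. -/
abbrev inclusion (A : NUAlg.{u, v} k) (I : NonUnitalSubalgebra k A)
    (hl : ∀ (a : A), ∀ r ∈ I, a * r ∈ I) (hr : ∀ (a : A), ∀ r ∈ I, r * a ∈ I) :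
    XMod.{u, v} k where
  R := ⟨I⟩
  A := A
  ρ := NonUnitalSubalgebraClass.subtype I
  act :=
    { la := LinearMap.mk₂ k (fun (a : A) (r : I) => (⟨a * r, hl a r r.2⟩ : I))
        (fun a a' r => Subtype.ext (add_mul a a' (r : A)))
        (fun c a r => Subtype.ext (smul_mul_assoc c a (r : A)))
        (fun a r r' => Subtype.ext (mul_add a (r : A) r'))
        (fun c a r => Subtype.ext (mul_smul_comm c a (r : A)))
      ra := LinearMap.mk₂ k (fun (r : I) (a : A) => (⟨r * a, hr a r r.2⟩ : I))
        (fun r r' a => Subtype.ext (add_mul (r : A) r' a))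
        (fun c r a => Subtype.ext (smul_mul_assoc c (r : A) a))
        (fun r a a' => Subtype.ext (mul_add (r : A) a a'))
        (fun c r a => Subtype.ext (mul_smul_comm c (r : A) a))
      mul_la := fun a a' r => Subtype.ext (mul_assoc a a' (r : A))
      ra_mul := fun r a a' => Subtype.ext (mul_assoc (r : A) a a').symm
      la_ra := fun a r a' => Subtype.ext (mul_assoc a (r : A) a')
      la_mul := fun a r r' => Subtype.ext (mul_assoc a (r : A) r').symm
      ra_mul_la := fun r a r' => Subtype.ext (mul_assoc (r : A) a r')
      mul_ra := fun r r' a => Subtype.ext (mul_assoc (r : A) r' a) }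
  ρ_la _ _ := rfl
  ρ_ra _ _ := rfl
  peiffer_left _ _ := rfl
  peiffer_right _ _ := rfl

section FreeOnAlg

variable (A : NUAlg.{u, v} k)

/-- The retraction `p_2 : A ∗ A → A` with `p_2 u_1 = 0` and `p_2 u_2 = 1`. -/
def retraction : AlgCoprod k A A →ₙₐ[k] A :=
  AlgCoprod.lift 0 (NonUnitalAlgHom.id k A)

/-- The kernel `Ā` of the retraction `p_2`. -/
abbrev retractionKer : NonUnitalSubalgebra k (AlgCoprod k A A) :=
  NonUnitalAlgHom.equalizer (retraction A) (0 : AlgCoprod k A A →ₙₐ[k] A)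

/-- The functor `F` on objects: `F(A) = (ker p_2, A ∗ A, inc)`. -/
abbrev freeOnAlg : XMod.{u, max u v} k :=
  inclusion ⟨AlgCoprod k A A⟩ (retractionKer A)
    (fun a r hr => by
      have h : retraction A r = 0 := hr
      exact (map_mul (retraction A) a r).trans (by rw [h, mul_zero]; rfl))
    (fun a r hr => by
      have h : retraction A r = 0 := hr
      exact (map_mul (retraction A) r a).trans (by rw [h, zero_mul]; rfl))

end FreeOnAlg

variable {A : NUAlg.{u, v} k} {X : XMod.{u, w} k}

/-- The inclusion `i : R → R ⋊ A`. -/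
def sdInl (X : XMod.{u, w} k) : X.R →ₙₐ[k] X.act.SemiDirect where
  toFun r := (r, 0)
  map_smul' c r := AlgAction.SemiDirect.ext rfl (smul_zero c).symm
  map_zero' := rfl
  map_add' r r' := AlgAction.SemiDirect.ext rfl (add_zero (0 : X.A)).symm
  map_mul' r r' := AlgAction.SemiDirect.ext
    (by
      change r * r' = r * r' + X.act.la 0 r' + X.act.ra r 0
      simp)
    (mul_zero (0 : X.A)).symm

/-- The inclusion `j : A → R ⋊ A`. -/
def sdInr (X : XMod.{u, w} k) : X.A →ₙₐ[k] X.act.SemiDirect where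
  toFun a := (0, a)
  map_smul' c a := AlgAction.SemiDirect.ext (smul_zero c).symm rfl
  map_zero' := rfl
  map_add' a a' := AlgAction.SemiDirect.ext (add_zero (0 : X.R)).symm rfl
  map_mul' a a' := AlgAction.SemiDirect.ext
    (by
      change 0 = 0 * 0 + X.act.la a 0 + X.act.ra 0 a'
      simp)
    rfl

/-- The source map `R ⋊ A → A`, `(r, a) ↦ a`. -/
def source (X : XMod.{u, w} k) : X.act.SemiDirect →ₙₐ[k] X.A where
  toFun x := x.2
  map_smul' _ _ := rfl
  map_zero' := rfl
  map_add' _ _ := rfl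
  map_mul' _ _ := rfl

/-- The target map `R ⋊ A → A`, `(r, a) ↦ ρ(r) + a`. -/
def target (X : XMod.{u, w} k) : X.act.SemiDirect →ₙₐ[k] X.A where
  toFun x := X.ρ x.1 + x.2
  map_smul' c x := by
    simp [AlgAction.SemiDirect.smul_fst, AlgAction.SemiDirect.smul_snd]
  map_zero' := by simp [AlgAction.SemiDirect.zero_fst, AlgAction.SemiDirect.zero_snd]
  map_add' x y := by
    simp only [AlgAction.SemiDirect.add_fst, AlgAction.SemiDirect.add_snd, map_add]
    abel
  map_mul' x y := by
    simp only [AlgAction.SemiDirect.mul_fst, AlgAction.SemiDirect.mul_snd, map_add, map_mul,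
      X.ρ_la, X.ρ_ra, mul_add, add_mul]
    abel

/-- The homomorphism `γ : A ∗ A → R ⋊ B` with `γ u_1 = i f` and `γ u_2 = j g`. -/
def liftSD (f : A →ₙₐ[k] X.R) (g : A →ₙₐ[k] X.A) : AlgCoprod k A A →ₙₐ[k] X.act.SemiDirect :=
  AlgCoprod.lift ((sdInl X).comp f) ((sdInr X).comp g)

theorem liftSD_snd (f : A →ₙₐ[k] X.R) (g : A →ₙₐ[k] X.A) (x : AlgCoprod k A A) :
    (liftSD f g x).2 = g (retraction A x) := by
  have h : (source X).comp (liftSD f g) = g.comp (retraction A) := by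
    refine AlgCoprod.hom_ext (fun a => ?_) (fun a => ?_)
    · rw [NonUnitalAlgHom.comp_apply, NonUnitalAlgHom.comp_apply, liftSD, retraction,
        AlgCoprod.lift_inl, AlgCoprod.lift_inl]
      exact (map_zero g).symm
    · rw [NonUnitalAlgHom.comp_apply, NonUnitalAlgHom.comp_apply, liftSD, retraction,
        AlgCoprod.lift_inr, AlgCoprod.lift_inr]
      rfl
  exact NonUnitalAlgHom.congr_fun h x

theorem target_liftSD (f : A →ₙₐ[k] X.R) (g : A →ₙₐ[k] X.A) (x : AlgCoprod k A A) :
    X.ρ (liftSD f g x).1 + (liftSD f g x).2 = AlgCoprod.lift (X.ρ.comp f) g x := by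
  have h : (target X).comp (liftSD f g) = AlgCoprod.lift (X.ρ.comp f) g := by
    refine AlgCoprod.hom_ext (fun a => ?_) (fun a => ?_)
    · rw [NonUnitalAlgHom.comp_apply, liftSD, AlgCoprod.lift_inl, AlgCoprod.lift_inl]
      exact add_zero (X.ρ (f a))
    · rw [NonUnitalAlgHom.comp_apply, liftSD, AlgCoprod.lift_inr, AlgCoprod.lift_inr]
      change X.ρ 0 + g a = g a
      rw [map_zero, zero_add]
  exact NonUnitalAlgHom.congr_fun h x

theorem liftSD_ker (f : A →ₙₐ[k] X.R) (g : A →ₙₐ[k] X.A) (r : retractionKer A) :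
    (liftSD f g (r : AlgCoprod k A A)).2 = 0 := by
  have h : retraction A (r : AlgCoprod k A A) = 0 := r.2
  rw [liftSD_snd, h, map_zero]

/-- The restriction `α : Ā → R` of `γ`. -/
def liftKer (f : A →ₙₐ[k] X.R) (g : A →ₙₐ[k] X.A) : retractionKer A →ₙₐ[k] X.R where
  toFun r := (liftSD f g (r : AlgCoprod k A A)).1
  map_smul' c r := congrArg (Prod.fst : X.R × X.A → X.R)
    (map_smul (liftSD f g) c (r : AlgCoprod k A A))
  map_zero' := congrArg (Prod.fst : X.R × X.A → X.R) (map_zero (liftSD f g))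
  map_add' r r' := congrArg (Prod.fst : X.R × X.A → X.R)
    (map_add (liftSD f g) (r : AlgCoprod k A A) r')
  map_mul' r r' := by
    rw [NonUnitalSubalgebra.coe_mul, map_mul, AlgAction.SemiDirect.mul_fst, liftSD_ker, liftSD_ker]
    simp

theorem liftKer_mul_left (f : A →ₙₐ[k] X.R) (g : A →ₙₐ[k] X.A) (a : AlgCoprod k A A)
    (r : retractionKer A) : (liftSD f g (a * r)).1 =
      X.act.la (AlgCoprod.lift (X.ρ.comp f) g a) (liftKer f g r) := by
  rw [map_mul, AlgAction.SemiDirect.mul_fst, liftSD_ker, ← target_liftSD, map_add,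
    LinearMap.add_apply, X.peiffer_left, map_zero, add_zero]
  rfl

theorem liftKer_mul_right (f : A →ₙₐ[k] X.R) (g : A →ₙₐ[k] X.A) (a : AlgCoprod k A A)
    (r : retractionKer A) : (liftSD f g (r * a)).1 =
      X.act.ra (liftKer f g r) (AlgCoprod.lift (X.ρ.comp f) g a) := by
  rw [map_mul, AlgAction.SemiDirect.mul_fst, liftSD_ker, ← target_liftSD, map_add (X.act.ra _),
    X.peiffer_right, map_zero, LinearMap.zero_apply, add_zero]
  rfl

/-- The morphism of crossed modules `F(A) → (R, B, ρ)` adjoint to the homomorphism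
`(f, g) : A → R × B = U(R, B, ρ)`. -/
def freeLift (f : A →ₙₐ[k] X.R) (g : A →ₙₐ[k] X.A) : Hom (freeOnAlg A) X where
  μ := liftKer f g
  ν := AlgCoprod.lift (X.ρ.comp f) g
  comm r := by
    refine Eq.trans ?_ (target_liftSD f g (r : AlgCoprod k A A))
    rw [liftSD_ker, add_zero]
    rfl
  map_la a r := liftKer_mul_left f g a r
  map_ra r a := liftKer_mul_right f g a r

/-- The free crossed module `𝔽(V) = F(T(V))` on a vector space. -/
def free (k : Type u) [Field k] (V : Type v) [AddCommGroup V] [Module k V] :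
    XMod.{u, max u v} k :=
  freeOnAlg ⟨FreeAlg k V⟩

/-- The cotriple `𝓕 = 𝔽 𝕌` on objects, where `𝕌(R, A, ρ)` is the vector space `R × A`. -/
def cotriple (X : XMod.{u, v} k) : XMod.{u, max u v} k := free k (X.R × X.A)

/-- The counit `τ : 𝓕(R, A, ρ) → (R, A, ρ)` of the adjunction between `𝔽` and `𝕌`. -/
def counit (X : XMod.{u, v} k) : Hom X.cotriple X :=
  freeLift (A := ⟨FreeAlg k (X.R × X.A)⟩) (FreeAlg.lift (LinearMap.fst k X.R X.A))
    (FreeAlg.lift (LinearMap.snd k X.R X.A))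

/-- The projective class `𝒫` of the cotriple `𝓕`: the crossed modules for which the counit has
a section. -/
def InProjectiveClass (X : XMod.{u, v} k) : Prop :=
  ∃ θ : Hom X X.cotriple, X.counit.comp θ = Hom.id X

end XMod

/-! ### The complexes `β` and `γ` -/

namespace XMod

variable {k : Type u} [Field k] (X : XMod.{u, v} k)

/-- `Φ(R, A, ρ) = Tot Φ(𝔑_*(R, A, ρ))` for a functorial chain complex `Φ`. -/
def tot (Φ : NUAlg.{u, v} k ⥤ ChainComplex (ModuleCat.{max u v} k) ℕ) :
    XMod.{u, v} k ⥤ ChainComplex (ModuleCat.{max u v} k) ℕ :=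
  nerve k ⋙ Hochschild.totSimplicial Φ

/-- `β(R, A, ρ)`: the cokernel of `CC^{2}(0, A, 0) → CC^{2}(R, A, ρ)`. -/
def beta : ChainComplex (ModuleCat.{max u v} k) ℕ :=
  cokernel ((tot (Hochschild.CCTwo k)).map X.ofBase)

/-- `γ(R, A, ρ)`: the cokernel of `CC(0, A, 0) → CC(R, A, ρ)`. -/
def gamma : ChainComplex (ModuleCat.{max u v} k) ℕ :=
  cokernel ((tot (Hochschild.CC k)).map X.ofBase)

end XMod

end

/-! Write `p_2`, `u_2` for the retraction of `T(V) ∗ T(V)` onto its second factor and the inclusion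
of that factor. In the free crossed module the idempotent `u_2 p_2` vanishes on `ker p_2` and
differs from the identity by elements of `ker p_2`. A section `θ` of the counit `τ` transports it to
`φ = τ u_2 p_2 θ : A → A`. Then `φ ρ = 0`, and `φ - 1 = ρ c` for a linear `c : A → R` with `c ρ =
-1`. Hence `ρ` is injective, `φ` is idempotent, and with `Q = im φ` the algebra `A` splits as `Q`
plus the ideal `ρ(R)`. This is `contractionOfSection`.

Since `ρ` is injective, a simplex of the nerve is determined by its vertices, which have a common
image in `Q`. Prepending the vertex `φ(a)` is an extra degeneracy of the nerve augmented to `Q`.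
Thus `Tot Φ(𝔑_*(R, A, ρ))` has the homology of `Φ(Q)` for each functorial complex `Φ`, and `Tot
Φ(𝔑_*(0, A, 0))` that of `Φ(A)`. The map `Φ(0, A, 0) → Φ(R, A, ρ)` is injective, so the homology of
its cokernel sits in a long exact sequence `H_{n+1}(Φ(Q)) → H_{n+1}(coker) → H_n(Φ(A)) → H_n(Φ(Q))`.

The algebra `A` is a retract of a free algebra (`isFreeRetract_of_section`), and so is `Q`. Explicit
homotopies on words show that a free algebra has no bar homology in positive degrees and no
Hochschild homology in degrees at least two. Hence `H_n(CC^{2}) = 0` for `n ≥ 2`, which gives (i).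
In characteristic zero, dividing by word lengths yields two further facts, `exists_bHoch_one_add_eq`
and `exists_bHoch_zero_eq`. They give `H_n(CC) = 0` for `n ≥ 1`, hence the vanishing for `γ`, and
they identify `H_1(CC^{2}(A))` with `A/[A, A]` through `connectingClass`.

Finally `H_2(β)` is the kernel of `H_1(CC^{2}(A)) → H_1(CC^{2}(Q))`, that is, of `A/[A, A] → Q/[Q,
Q]`. The splitting shows that this kernel is the image of `R`. The map `c` carries `[A, A]` into
`[A, R]` and satisfies `c ρ = -1`, so an `r` with `ρ(r)` in `[A, A]` lies in `[A, R]`; the kernel is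
therefore `R/[A, R]`. -/

noncomputable section

open CategoryTheory CategoryTheory.Limits
open scoped ZeroObject

namespace Hochschild

/-! ### Recursion on the first tensor factor. -/

section Cons

variable {k : Type u} [Field k] {A : Type v} [NonUnitalRing A] [Module k A]

/-- Left multiplication by a vector, `x ↦ (t ↦ x ⊗ t)`. -/
def tcons (n : ℕ) : A →ₗ[k] TPow k A n →ₗ[k] TPow k A (n + 1) :=
  (PiTensorProduct.lift (s := fun _ : Fin n => A)).toLinearMap ∘ₗ
    (PiTensorProduct.tprod k (s := fun _ : Fin (n + 1) => A)).curryLeft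

theorem tcons_tprod (n : ℕ) (x : A) (a : Fin n → A) :
    tcons (k := k) n x (PiTensorProduct.tprod k a) =
      PiTensorProduct.tprod k (Fin.cons x a : Fin (n + 1) → A) := by
  simp [tcons]

/-- The linear map on `A^{⊗ (n+1)}` defined by a bilinear map on `A × A^{⊗ n}`. -/
def consLift {n : ℕ} {M : Type w} [AddCommMonoid M] [Module k M]
    (f : A →ₗ[k] TPow k A n →ₗ[k] M) : TPow k A (n + 1) →ₗ[k] M :=
  PiTensorProduct.lift (LinearMap.uncurryLeft
    ((PiTensorProduct.lift (s := fun _ : Fin n => A)).symm.toLinearMap ∘ₗ f))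

theorem consLift_tcons {n : ℕ} {M : Type w} [AddCommMonoid M] [Module k M]
    (f : A →ₗ[k] TPow k A n →ₗ[k] M) (x : A) (t : TPow k A n) :
    consLift f (tcons n x t) = f x t := by
  have h : consLift f ∘ₗ tcons n x = f x := by
    refine PiTensorProduct.ext (MultilinearMap.ext fun a => ?_)
    simp [consLift, tcons_tprod]
  exact LinearMap.congr_fun h t

theorem tpow_hom_ext {n : ℕ} {M : Type w} [AddCommMonoid M] [Module k M]
    {f g : TPow k A (n + 1) →ₗ[k] M} (h : ∀ x t, f (tcons n x t) = g (tcons n x t)) : f = g := by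
  refine PiTensorProduct.ext (MultilinearMap.ext fun a => ?_)
  have := h (a 0) (PiTensorProduct.tprod k (Fin.tail a))
  rwa [tcons_tprod, Fin.cons_self_tail] at this

variable [IsScalarTower k A A] [SMulCommClass k A A]

theorem face_zero_tcons (n : ℕ) (x y : A) (t : TPow k A n) :
    face k A n 0 (tcons (n + 1) x (tcons n y t)) = tcons n (x * y) t := by
  have h : face k A n 0 ∘ₗ tcons (n + 1) x ∘ₗ tcons n y = tcons n (x * y) := by
    refine PiTensorProduct.ext (MultilinearMap.ext fun a => ?_)
    simp only [LinearMap.compMultilinearMap_apply, LinearMap.comp_apply, tcons_tprod]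
    rw [face_tprod _ _ _ _ (by omega)]
    congr 1
    ext j
    refine Fin.cases ?_ (fun j => ?_) j
    · simp [mulAt]
    · simp [mulAt]
  exact LinearMap.congr_fun h t

theorem face_succ_tcons (n i : ℕ) (hi : i ≤ n) (x : A) (t : TPow k A (n + 2)) :
    face k A (n + 1) (i + 1) (tcons (n + 2) x t) = tcons (n + 1) x (face k A n i t) := by
  have h : face k A (n + 1) (i + 1) ∘ₗ tcons (n + 2) x = tcons (n + 1) x ∘ₗ face k A n i := by
    refine PiTensorProduct.ext (MultilinearMap.ext fun a => ?_)
    simp only [LinearMap.compMultilinearMap_apply, LinearMap.comp_apply, tcons_tprod]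
    rw [face_tprod _ _ _ _ (by omega), face_tprod _ _ _ _ hi, tcons_tprod]
    congr 1
    ext j
    refine Fin.cases ?_ (fun j => ?_) j
    · simp [mulAt]
    · simp [mulAt]
  exact LinearMap.congr_fun h t

variable (k A) in
/-- The map `b' : A^{⊗ (n+1)} → A^{⊗ n}`, extended by zero to `n = 0`. -/
def bBarAug : ∀ n : ℕ, TPow k A (n + 1) →ₗ[k] TPow k A n
  | 0 => 0
  | n + 1 => bBar k A n

/-- Only the face that multiplies `x` by `y` touches `x`. Every other face comes from `y ⊗ t` with
its index shifted by one, hence the minus sign. The convention that `bBarAug` vanishes on `A^{⊗ 1}`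
makes the formula valid for `n = 0` too, so that inductions on words need no separate base case. -/
theorem bBarAug_tcons_tcons (n : ℕ) (x y : A) (t : TPow k A n) :
    bBarAug k A (n + 1) (tcons (n + 1) x (tcons n y t)) =
      tcons n (x * y) t - tcons n x (bBarAug k A n (tcons n y t)) := by
  cases n with
  | zero => simp [bBarAug, bBar_apply, sface, face_zero_tcons]
  | succ n =>
    change bBar k A (n + 1) _ = _ - tcons _ x (bBar k A n _)
    rw [bBar_apply, bBar_apply, Finset.sum_range_succ', map_sum, sub_eq_add_neg,
      ← Finset.sum_neg_distrib]
    refine (add_comm _ _).trans ?_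
    congr 1
    · simp [sface, face_zero_tcons]
    · refine Finset.sum_congr rfl fun i hi => ?_
      rw [Finset.mem_range] at hi
      simp only [sface, LinearMap.smul_apply, map_smul]
      rw [face_succ_tcons _ _ (by omega), pow_succ, mul_neg, mul_one, neg_smul]

variable (k A) in
/-- The last face `a_0 ⊗ ⋯ ⊗ a_{n+1} ↦ a_{n+1} a_0 ⊗ a_1 ⊗ ⋯ ⊗ a_n` of the Hochschild complex. -/
def lastFace (n : ℕ) : TPow k A (n + 2) →ₗ[k] TPow k A (n + 1) :=
  face k A n 0 ∘ₗ rot k A (n + 1)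

theorem lastFace_tprod (n : ℕ) (x z : A) (a : Fin n → A) :
    lastFace k A n (tcons (n + 1) x (PiTensorProduct.tprod k (Fin.snoc a z : Fin (n + 1) → A))) =
      tcons n (z * x) (PiTensorProduct.tprod k a) := by
  rw [lastFace, LinearMap.comp_apply, tcons_tprod, rot_tprod, tcons_tprod,
    face_tprod _ _ _ _ (by omega)]
  congr 1
  ext j
  have h1 : (finRotate (n + 2)).symm 0 = Fin.last (n + 1) := Fin.ext (by simp)
  have h2 : ∀ i : Fin (n + 1), (finRotate (n + 2)).symm i.succ = i.castSucc := fun i =>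
    Fin.ext ((finRotate_symm_val _).trans (by simp))
  refine Fin.cases ?_ (fun j => ?_) j
  · have h3 : (finRotate (n + 2)).symm 1 = 0 := h2 0
    simp [mulAt, h1, h3, ← Fin.succ_last]
  · simp only [mulAt, h2]
    simp

theorem bHoch_eq_add_lastFace (n : ℕ) (t : TPow k A (n + 2)) :
    bHoch k A n t = bBarAug k A (n + 1) t + (-1 : k) ^ (n + 1) • lastFace k A n t := rfl

end Cons

end Hochschild

namespace Hochschild

/-! ### Contracting homotopies for the bar and Hochschild complexes of a free algebra. -/

section Words

variable (k : Type u) [Field k] (S : Type v)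

/-- The free non-unital algebra on the set `S`, with the nonempty words in `S` as a basis. -/
abbrev WordAlg : Type (max u v) := MonoidAlgebra k (FreeSemigroup S)

variable {S}

/-- A word as an element of the free algebra. -/
def word (w : FreeSemigroup S) : WordAlg k S := MonoidAlgebra.single w 1

theorem word_mul (w w' : FreeSemigroup S) : word k (w * w') = word k w * word k w' := by
  simp [word, MonoidAlgebra.single_mul_single]

variable {k} {M : Type w} [AddCommMonoid M] [Module k M]

/-- The linear map with given values on words. -/
def wordLift (f : FreeSemigroup S → M) : WordAlg k S →ₗ[k] M :=
  (MonoidAlgebra.basis (FreeSemigroup S) k).constr k f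

theorem wordLift_word (f : FreeSemigroup S → M) (w : FreeSemigroup S) :
    wordLift f (word k w) = f w :=
  (MonoidAlgebra.basis (FreeSemigroup S) k).constr_basis k f w

theorem wordAlg_hom_ext {f g : WordAlg k S →ₗ[k] M} (h : ∀ w, f (word k w) = g (word k w)) :
    f = g :=
  (MonoidAlgebra.basis (FreeSemigroup S) k).ext h

theorem wordTPow_hom_ext {n : ℕ} {f g : TPow k (WordAlg k S) (n + 1) →ₗ[k] M}
    (h : ∀ w t, f (tcons n (word k w) t) = g (tcons n (word k w) t)) : f = g := by
  refine tpow_hom_ext fun x t => ?_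
  have : f ∘ₗ (tcons n).flip t = g ∘ₗ (tcons n).flip t := wordAlg_hom_ext fun w => h w t
  exact LinearMap.congr_fun this x

theorem wordTPow_hom_ext₂ {n : ℕ} {f g : TPow k (WordAlg k S) (n + 2) →ₗ[k] M}
    (h : ∀ w w' t, f (tcons (n + 1) (word k w) (tcons n (word k w') t)) =
      g (tcons (n + 1) (word k w) (tcons n (word k w') t))) : f = g := by
  refine wordTPow_hom_ext fun w t => ?_
  have : f ∘ₗ tcons (n + 1) (word k w) = g ∘ₗ tcons (n + 1) (word k w) :=
    wordTPow_hom_ext fun w' t => h w w' t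
  exact LinearMap.congr_fun this t

variable (k) in
/-- The linear map underlying `splitFirst`. -/
def splitFirstAux (n : ℕ) : FreeSemigroup S → (TPow k (WordAlg k S) n →ₗ[k]
    TPow k (WordAlg k S) (n + 2))
  | ⟨_, []⟩ => 0
  | ⟨v, u :: l⟩ => tcons (n + 1) (word k (.of v)) ∘ₗ tcons n (word k ⟨u, l⟩)

variable (k S) in
/-- The operator `v u ⊗ t ↦ v ⊗ u ⊗ t`, `v ⊗ t ↦ 0`, for a letter `v` and a word `u`. -/
def splitFirst (n : ℕ) : TPow k (WordAlg k S) (n + 1) →ₗ[k] TPow k (WordAlg k S) (n + 2) :=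
  consLift (wordLift (splitFirstAux k n))

theorem splitFirst_of (n : ℕ) (v : S) (t : TPow k (WordAlg k S) n) :
    splitFirst k S n (tcons n (word k (.of v)) t) = 0 := by
  rw [splitFirst, consLift_tcons, wordLift_word]
  rfl

theorem splitFirst_mul (n : ℕ) (v : S) (u : FreeSemigroup S) (t : TPow k (WordAlg k S) n) :
    splitFirst k S n (tcons n (word k (.of v * u)) t) =
      tcons (n + 1) (word k (.of v)) (tcons n (word k u) t) := by
  rw [splitFirst, consLift_tcons, wordLift_word]
  rfl

/-- A contracting homotopy for `b'`. Splitting off the first letter of the first word and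
multiplying it back is the identity on words of length at least two. If the first word is a letter,
the splitting gives zero, and the term is recovered by first multiplying it with the next factor. -/
theorem bBar_splitFirst (n : ℕ) (x : TPow k (WordAlg k S) (n + 2)) :
    bBar k (WordAlg k S) (n + 1) (splitFirst k S (n + 1) x) +
      splitFirst k S n (bBar k (WordAlg k S) n x) = x := by
  have h : bBarAug k (WordAlg k S) (n + 2) ∘ₗ splitFirst k S (n + 1) +
      splitFirst k S n ∘ₗ bBarAug k (WordAlg k S) (n + 1) = LinearMap.id := by
    refine wordTPow_hom_ext₂ fun w y t => ?_
    simp only [LinearMap.comp_apply, LinearMap.add_apply, LinearMap.id_apply]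
    induction w with
    | ih1 v =>
      rw [splitFirst_of, bBarAug_tcons_tcons, map_zero, zero_add, map_sub, splitFirst_of, sub_zero,
        ← word_mul, splitFirst_mul]
    | ih2 v u =>
      rw [splitFirst_mul, bBarAug_tcons_tcons, bBarAug_tcons_tcons, bBarAug_tcons_tcons, map_sub,
        map_sub, splitFirst_mul, ← word_mul, ← word_mul, ← word_mul, mul_assoc, splitFirst_mul]
      abel
  exact LinearMap.congr_fun h x

/-- The bar complex of a free algebra is exact in positive degrees. -/
theorem exists_bBar_eq (n : ℕ) (x : TPow k (WordAlg k S) (n + 2))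
    (hx : bBar k (WordAlg k S) n x = 0) : ∃ y, bBar k (WordAlg k S) (n + 1) y = x :=
  ⟨_, by simpa [hx] using bBar_splitFirst n x⟩

variable (k) in
/-- The bilinear map underlying `splitSecond`. -/
def splitSecondAux (n : ℕ) : S → List S → (WordAlg k S →ₗ[k] TPow k (WordAlg k S) n →ₗ[k]
    TPow k (WordAlg k S) (n + 3))
  | _, [] => 0
  | v, u :: l => splitSecondAux n u l ∘ₗ LinearMap.mulRight k (word k (.of v)) +
      LinearMap.compl₂ (tcons (n + 2)) (tcons (n + 1) (word k (.of v)) ∘ₗ tcons n (word k ⟨u, l⟩))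

variable (k S) in
/-- The operator that sends `x ⊗ v_1 ⋯ v_m ⊗ t`, for letters `v_i`, to the sum of the
`x v_1 ⋯ v_{i-1} ⊗ v_i ⊗ v_{i+1} ⋯ v_m ⊗ t` with `i < m`. -/
def splitSecond (n : ℕ) : TPow k (WordAlg k S) (n + 2) →ₗ[k] TPow k (WordAlg k S) (n + 3) :=
  consLift (LinearMap.flip (consLift (M := WordAlg k S →ₗ[k] TPow k (WordAlg k S) (n + 3))
    (wordLift fun w : FreeSemigroup S => LinearMap.flip (splitSecondAux k n w.head w.tail))))

theorem splitSecond_of (n : ℕ) (x : WordAlg k S) (v : S) (t : TPow k (WordAlg k S) n) :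
    splitSecond k S n (tcons (n + 1) x (tcons n (word k (.of v)) t)) = 0 := by
  rw [splitSecond, consLift_tcons, LinearMap.flip_apply, consLift_tcons, wordLift_word]
  rfl

theorem splitSecond_mul (n : ℕ) (x : WordAlg k S) (v : S) (u : FreeSemigroup S)
    (t : TPow k (WordAlg k S) n) :
    splitSecond k S n (tcons (n + 1) x (tcons n (word k (.of v * u)) t)) =
      splitSecond k S n (tcons (n + 1) (x * word k (.of v)) (tcons n (word k u) t)) +
      tcons (n + 2) x (tcons (n + 1) (word k (.of v)) (tcons n (word k u) t)) := by
  simp only [splitSecond, consLift_tcons, LinearMap.flip_apply, wordLift_word]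
  rfl

/-- A second contracting homotopy for `b'`, up to sign. Unlike `splitFirst`, it is left linear in
the first tensor factor, so it is compatible with the last face of `b`. The induction runs over the
second word with the first factor arbitrary, because each step moves a letter into that factor. -/
theorem bBar_splitSecond (n : ℕ) (x : TPow k (WordAlg k S) (n + 3)) :
    bBar k (WordAlg k S) (n + 2) (splitSecond k S (n + 1) x) +
      splitSecond k S n (bBar k (WordAlg k S) (n + 1) x) = -x := by
  have h : bBarAug k (WordAlg k S) (n + 3) ∘ₗ splitSecond k S (n + 1) +
      splitSecond k S n ∘ₗ bBarAug k (WordAlg k S) (n + 2) = -LinearMap.id := by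
    refine tpow_hom_ext fun x t => ?_
    have : ∀ w y t, bBarAug k (WordAlg k S) (n + 3) (splitSecond k S (n + 1)
        (tcons (n + 2) x (tcons (n + 1) (word k w) (tcons n (word k y) t)))) +
        splitSecond k S n (bBarAug k (WordAlg k S) (n + 2)
        (tcons (n + 2) x (tcons (n + 1) (word k w) (tcons n (word k y) t)))) =
        -(tcons (n + 2) x (tcons (n + 1) (word k w) (tcons n (word k y) t))) := by
      intro w y t
      induction w generalizing x with
      | ih1 v =>
        simp only [splitSecond_of, bBarAug_tcons_tcons, map_zero, zero_add, map_sub, ← word_mul,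
          splitSecond_mul, sub_zero]
        abel
      | ih2 v u _ ih =>
        have := ih (x * word k (.of v))
        simp only [splitSecond_mul, bBarAug_tcons_tcons, map_sub, map_add, ← word_mul,
          mul_assoc] at this ⊢
        rw [← sub_eq_zero] at this ⊢
        rw [← this]
        abel
    have h2 : (bBarAug k (WordAlg k S) (n + 3) ∘ₗ splitSecond k S (n + 1) +
      splitSecond k S n ∘ₗ bBarAug k (WordAlg k S) (n + 2)) ∘ₗ tcons (n + 2) x =
      (-LinearMap.id) ∘ₗ tcons (n + 2) x := wordTPow_hom_ext₂ this
    exact LinearMap.congr_fun h2 t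
  exact LinearMap.congr_fun h x

/-- With at least three factors, the last face only multiplies the first factor on the left and
deletes the last one. It does not meet the second factor, and `splitSecond` is left linear in the
first. -/
theorem lastFace_splitSecond (n : ℕ) (x : TPow k (WordAlg k S) (n + 3)) :
    lastFace k (WordAlg k S) (n + 2) (splitSecond k S (n + 1) x) =
      splitSecond k S n (lastFace k (WordAlg k S) (n + 1) x) := by
  have h : lastFace k (WordAlg k S) (n + 2) ∘ₗ splitSecond k S (n + 1) =
      splitSecond k S n ∘ₗ lastFace k (WordAlg k S) (n + 1) := by
    refine tpow_hom_ext fun x t => ?_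
    have h1 : ∀ w, lastFace k (WordAlg k S) (n + 2) ∘ₗ splitSecond k S (n + 1) ∘ₗ
        tcons (n + 2) x ∘ₗ tcons (n + 1) (word k w) = splitSecond k S n ∘ₗ
        lastFace k (WordAlg k S) (n + 1) ∘ₗ tcons (n + 2) x ∘ₗ tcons (n + 1) (word k w) := by
      intro w
      refine PiTensorProduct.ext (MultilinearMap.ext fun a => ?_)
      obtain ⟨a, z, rfl⟩ : ∃ (b : Fin n → WordAlg k S) (z : WordAlg k S), a = Fin.snoc b z :=
        ⟨_, a (Fin.last n), (Fin.snoc_init_self a).symm⟩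
      simp only [LinearMap.compMultilinearMap_apply, LinearMap.comp_apply]
      have h2 : ∀ (x : WordAlg k S) w, lastFace k (WordAlg k S) (n + 1) (tcons (n + 2) x
          (tcons (n + 1) (word k w) (PiTensorProduct.tprod k (Fin.snoc a z)))) =
          tcons (n + 1) (z * x) (tcons n (word k w) (PiTensorProduct.tprod k a)) := by
        intro x w
        rw [tcons_tprod, Fin.cons_snoc_eq_snoc_cons, lastFace_tprod]
        simp only [tcons_tprod]
      have h3 : ∀ (x : WordAlg k S) w w', lastFace k (WordAlg k S) (n + 2) (tcons (n + 3) x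
          (tcons (n + 2) (word k w)
            (tcons (n + 1) (word k w') (PiTensorProduct.tprod k (Fin.snoc a z))))) =
          tcons (n + 2) (z * x)
            (tcons (n + 1) (word k w) (tcons n (word k w') (PiTensorProduct.tprod k a))) := by
        intro x w w'
        rw [tcons_tprod, Fin.cons_snoc_eq_snoc_cons, tcons_tprod, Fin.cons_snoc_eq_snoc_cons,
          lastFace_tprod]
        simp only [tcons_tprod]
      rw [h2]
      induction w generalizing x with
      | ih1 v => rw [splitSecond_of, splitSecond_of, map_zero]
      | ih2 v u _ ih => rw [splitSecond_mul, splitSecond_mul, map_add, ih, h3, mul_assoc]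
    have h2 : (lastFace k (WordAlg k S) (n + 2) ∘ₗ splitSecond k S (n + 1)) ∘ₗ tcons (n + 2) x =
        (splitSecond k S n ∘ₗ lastFace k (WordAlg k S) (n + 1)) ∘ₗ tcons (n + 2) x :=
      wordTPow_hom_ext fun w t => LinearMap.congr_fun (h1 w) t
    exact LinearMap.congr_fun h2 t
  exact LinearMap.congr_fun h x

/-- The Hochschild complex of a free algebra is exact in degrees at least two. -/
theorem exists_bHoch_eq (n : ℕ) (x : TPow k (WordAlg k S) (n + 3))
    (hx : bHoch k (WordAlg k S) (n + 1) x = 0) : ∃ y, bHoch k (WordAlg k S) (n + 2) y = x := by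
  -- The sign undoes the `-1` of `bBar_splitSecond`. The last face commutes with `splitSecond`,
  -- while its sign in `b` alternates with the degree, so its two contributions to the homotopy
  -- formula cancel.
  refine ⟨-splitSecond k S (n + 1) x, ?_⟩
  have h1 := bBar_splitSecond n x
  have h2 := congrArg (splitSecond k S n) hx
  rw [bHoch_eq_add_lastFace, map_add, map_smul, map_zero] at h2
  have h3 : bBarAug k (WordAlg k S) (n + 3) (splitSecond k S (n + 1) x) +
      splitSecond k S n (bBarAug k (WordAlg k S) (n + 2) x) = -x := h1
  rw [map_neg, bHoch_eq_add_lastFace, lastFace_splitSecond, neg_eq_iff_eq_neg, ← h3]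
  congr 1
  rw [eq_neg_of_add_eq_zero_left h2, pow_succ (-1 : k) (n + 2), mul_neg, mul_one]
  exact neg_smul (_ : k) (_ : TPow k (WordAlg k S) (n + 3))

end Words

end Hochschild

namespace Hochschild

/-! ### Formulas for `b`, `b'` and `t` in low degrees. -/

section LowDegrees

variable {k : Type u} [Field k] {A : Type v} [NonUnitalRing A] [Module k A]

theorem rot_one_tcons (x y : A) (t : TPow k A 0) :
    rot k A 1 (tcons 1 x (tcons 0 y t)) = tcons 1 y (tcons 0 x t) := by
  have h : rot k A 1 ∘ₗ tcons 1 x ∘ₗ tcons 0 y = tcons 1 y ∘ₗ tcons 0 x := by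
    refine PiTensorProduct.ext (MultilinearMap.ext fun a => ?_)
    simp only [LinearMap.compMultilinearMap_apply, LinearMap.comp_apply, tcons_tprod]
    rw [rot, LinearEquiv.coe_coe, PiTensorProduct.reindex_tprod]
    congr 1
    ext j
    fin_cases j <;> rfl
  exact LinearMap.congr_fun h t

theorem one_sub_cyc_one_tcons (x y : A) (t : TPow k A 0) :
    (1 - cyc k A 1) (tcons 1 x (tcons 0 y t)) =
      tcons 1 x (tcons 0 y t) + tcons 1 y (tcons 0 x t) := by
  simp [cyc, rot_one_tcons]

variable [IsScalarTower k A A] [SMulCommClass k A A]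

theorem lastFace_zero_tcons (x y : A) (t : TPow k A 0) :
    lastFace k A 0 (tcons 1 x (tcons 0 y t)) = tcons 0 (y * x) t := by
  rw [lastFace, LinearMap.comp_apply, rot_one_tcons, face_zero_tcons]

theorem bBar_zero_tcons (x y : A) (t : TPow k A 0) :
    bBar k A 0 (tcons 1 x (tcons 0 y t)) = tcons 0 (x * y) t := by
  simp [bBar_apply, sface, face_zero_tcons]

theorem bHoch_zero_tcons (x y : A) (t : TPow k A 0) :
    bHoch k A 0 (tcons 1 x (tcons 0 y t)) = tcons 0 (x * y) t - tcons 0 (y * x) t := by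
  rw [bHoch_eq_add_lastFace, lastFace_zero_tcons, bBarAug, bBar_zero_tcons]
  simp [sub_eq_add_neg]

theorem bHoch_one_tcons (x y z : A) (t : TPow k A 0) :
    bHoch k A 1 (tcons 2 x (tcons 1 y (tcons 0 z t))) =
      tcons 1 (x * y) (tcons 0 z t) - tcons 1 x (tcons 0 (y * z) t) +
        tcons 1 (z * x) (tcons 0 y t) := by
  have h : lastFace k A 1 ∘ₗ tcons 2 x ∘ₗ tcons 1 y ∘ₗ tcons 0 z =
      tcons 1 (z * x) ∘ₗ tcons 0 y := by
    refine PiTensorProduct.ext (MultilinearMap.ext fun a => ?_)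
    simp only [LinearMap.compMultilinearMap_apply, LinearMap.comp_apply]
    have : (Fin.cons y (Fin.cons z a : Fin 1 → A) : Fin 2 → A) =
        Fin.snoc (Fin.cons y a : Fin 1 → A) z := by
      ext j
      fin_cases j <;> rfl
    rw [tcons_tprod 0 z, tcons_tprod 1 y, this, lastFace_tprod, tcons_tprod 0 y]
  have h' := LinearMap.congr_fun h t
  simp only [LinearMap.comp_apply] at h'
  rw [bHoch_eq_add_lastFace, h', bBarAug_tcons_tcons, bBarAug_tcons_tcons]
  simp [bBarAug]

end LowDegrees

/-! ### Sums over the factorizations of a word. -/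

section Splittings

variable {S : Type v} {M : Type w} [AddCommMonoid M]

/-- The sum of `f u v` over the ways to split a word `w` as a product `u v`, as a function of the
first letter and the remaining letters of `w`. -/
def splitSumAux : (FreeSemigroup S → FreeSemigroup S → M) → S → List S → M
  | _, _, [] => 0
  | f, v, u :: l => f (.of v) ⟨u, l⟩ + splitSumAux (fun x y => f (.of v * x) y) u l

/-- The sum of `f u v` over the ways to split a word as a product `u v`. -/
def splitSum (f : FreeSemigroup S → FreeSemigroup S → M) (w : FreeSemigroup S) : M :=
  splitSumAux f w.head w.tail

theorem splitSum_of (f : FreeSemigroup S → FreeSemigroup S → M) (v : S) :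
    splitSum f (.of v) = 0 := rfl

theorem splitSum_of_mul (f : FreeSemigroup S → FreeSemigroup S → M) (v : S) (u) :
    splitSum f (.of v * u) = f (.of v) u + splitSum (fun x y => f (.of v * x) y) u := rfl

/-- A cut of `x y` falls inside `x`, between `x` and `y`, or inside `y`. -/
theorem splitSum_mul (f : FreeSemigroup S → FreeSemigroup S → M) (x y) :
    splitSum f (x * y) = splitSum (fun u v => f u (v * y)) x + f x y +
      splitSum (fun u v => f (x * u) v) y := by
  induction x generalizing f with
  | ih1 v => simp [splitSum_of, splitSum_of_mul]
  | ih2 v x _ ih => simp only [mul_assoc, splitSum_of_mul, ih, add_assoc]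

theorem splitSum_congr {f g : FreeSemigroup S → FreeSemigroup S → M} {w}
    (h : ∀ u v, u * v = w → f u v = g u v) : splitSum f w = splitSum g w := by
  induction w generalizing f g with
  | ih1 v => rfl
  | ih2 v x _ ih =>
    rw [splitSum_of_mul, splitSum_of_mul, h _ _ rfl]
    rw [ih fun u y e => h _ _ (by rw [mul_assoc, e])]

theorem splitSum_add (f g : FreeSemigroup S → FreeSemigroup S → M) (w) :
    splitSum (fun u v => f u v + g u v) w = splitSum f w + splitSum g w := by
  induction w generalizing f g with
  | ih1 v => simp [splitSum_of]
  | ih2 v x _ ih => simp only [splitSum_of_mul, ih, add_add_add_comm]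

/-- A word of length `l` has `l - 1` cuts; the extra summand avoids the subtraction. -/
theorem splitSum_const (m : M) (w : FreeSemigroup S) :
    splitSum (fun _ _ => m) w + m = w.length • m := by
  induction w with
  | ih1 v => simp [splitSum_of]
  | ih2 v x _ ih =>
    rw [splitSum_of_mul, add_assoc, ih, FreeSemigroup.length_mul, add_smul]
    simp

end Splittings

/-! ### The two low-degree facts about free algebras in characteristic zero. -/

section CharZero

variable {k : Type u} [Field k] {S : Type v} {M : Type w} [AddCommGroup M]

/-- For a cut `x = u v` the cocycle condition gives `c(u, v y) = c(x, y) + c(y u, v)`, and the last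
term also occurs in the sum for `y x`. The same holds with `x` and `y` exchanged. After cancellation
`|x| c(x, y) - |y| c(y, x)` is left, and antisymmetry turns it into `(|x| + |y|) c(x, y)`. -/
theorem splitSum_mul_sub_splitSum_mul {c : FreeSemigroup S → FreeSemigroup S → M}
    (h1 : ∀ x y z, c x (y * z) = c (x * y) z + c (z * x) y) (h2 : ∀ x y, c x y + c y x = 0) (x y) :
    splitSum c (x * y) - splitSum c (y * x) = (x * y).length • c x y := by
  have e1 : splitSum (fun u v => c u (v * y)) x =
      splitSum (fun _ _ => c x y) x + splitSum (fun u v => c (y * u) v) x := by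
    rw [← splitSum_add]
    exact splitSum_congr fun u v h => by rw [h1, h]
  have e2 : splitSum (fun u v => c u (v * x)) y =
      splitSum (fun _ _ => c y x) y + splitSum (fun u v => c (x * u) v) y := by
    rw [← splitSum_add]
    exact splitSum_congr fun u v h => by rw [h1, h]
  rw [splitSum_mul, splitSum_mul, e1, e2, FreeSemigroup.length_mul, add_smul,
    ← splitSum_const (c x y) x]
  have e3 : y.length • c x y = -(splitSum (fun _ _ => c y x) y + c y x) := by
    rw [splitSum_const, ← smul_neg, ← eq_neg_of_add_eq_zero_left (h2 x y)]
  rw [e3]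
  abel

variable [CharZero k]

/-- The class `c` of `u ⊗ v` modulo `im b + im (1 - t)` is an antisymmetric cocycle. By
`splitSum_mul_sub_splitSum_mul`, division by the word length produces a linear map `K` with `K(x y -
y x) = c(x, y)`. Thus the quotient map factors through `b` and kills its kernel. -/
theorem exists_bHoch_one_add_eq (x : TPow k (WordAlg k S) 2)
    (hx : bHoch k (WordAlg k S) 0 x = 0) :
    ∃ u z, x = bHoch k (WordAlg k S) 1 u + (1 - cyc k (WordAlg k S) 1) z := by
  let B : Submodule k (TPow k (WordAlg k S) 2) :=
    LinearMap.range (bHoch k (WordAlg k S) 1) ⊔ LinearMap.range (1 - cyc k (WordAlg k S) 1)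
  let c : FreeSemigroup S → FreeSemigroup S → (TPow k (WordAlg k S) 0 →ₗ[k] _ ⧸ B) := fun u v =>
    B.mkQ ∘ₗ tcons 1 (word k u) ∘ₗ tcons 0 (word k v)
  have h1 : ∀ x y z, c x (y * z) = c (x * y) z + c (z * x) y := by
    intro x y z
    refine LinearMap.ext fun t => ?_
    have : B.mkQ (bHoch k (WordAlg k S) 1 (tcons 2 (word k x) (tcons 1 (word k y)
        (tcons 0 (word k z) t)))) = 0 :=
      (Submodule.Quotient.mk_eq_zero B).2 (Submodule.mem_sup_left ⟨_, rfl⟩)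
    rw [bHoch_one_tcons, map_add, map_sub, ← word_mul, ← word_mul, ← word_mul] at this
    rw [← sub_eq_zero, ← neg_eq_zero, ← this]
    simp only [c, LinearMap.comp_apply, LinearMap.add_apply]
    abel
  have h2 : ∀ x y, c x y + c y x = 0 := by
    intro x y
    refine LinearMap.ext fun t => ?_
    have : B.mkQ ((1 - cyc k (WordAlg k S) 1) (tcons 1 (word k x) (tcons 0 (word k y) t))) = 0 :=
      (Submodule.Quotient.mk_eq_zero B).2 (Submodule.mem_sup_right ⟨_, rfl⟩)
    rwa [one_sub_cyc_one_tcons, map_add] at this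
  let K : TPow k (WordAlg k S) 1 →ₗ[k] _ ⧸ B :=
    consLift (wordLift fun w => (w.length : k)⁻¹ • splitSum c w)
  have h : K ∘ₗ bHoch k (WordAlg k S) 0 = B.mkQ := by
    refine wordTPow_hom_ext₂ fun x y t => ?_
    have hl : ((x * y).length : k) ≠ 0 := by
      rw [Nat.cast_ne_zero, FreeSemigroup.length_mul, FreeSemigroup.length]
      omega
    have e : (y * x).length = (x * y).length := by simp [add_comm]
    rw [LinearMap.comp_apply, bHoch_zero_tcons, map_sub, ← word_mul, ← word_mul]
    simp only [K, consLift_tcons, wordLift_word]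
    rw [e, LinearMap.smul_apply, LinearMap.smul_apply, ← smul_sub, ← LinearMap.sub_apply,
      splitSum_mul_sub_splitSum_mul h1 h2, ← Nat.cast_smul_eq_nsmul k, LinearMap.smul_apply,
      smul_smul, inv_mul_cancel₀ hl, one_smul]
    rfl
  have hB : x ∈ B := by
    rw [← Submodule.Quotient.mk_eq_zero, ← Submodule.mkQ_apply, ← h, LinearMap.comp_apply, hx,
      map_zero]
  obtain ⟨_, ⟨u, rfl⟩, _, ⟨z, rfl⟩, h⟩ := Submodule.mem_sup.1 hB
  exact ⟨u, z, h.symm⟩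

/-- The proof gives a linear map `θ` from `A ⊗ A` to `A/[A, A]` that vanishes on `im b` and agrees
with `b'` after `1 - t`. Applying it to the hypothesis leaves the class of `b' z`. -/
theorem exists_bHoch_zero_eq (u : TPow k (WordAlg k S) 3) (z : TPow k (WordAlg k S) 2)
    (h : bHoch k (WordAlg k S) 1 u + (1 - cyc k (WordAlg k S) 1) z = 0) :
    ∃ y, bHoch k (WordAlg k S) 0 y = bBar k (WordAlg k S) 0 z := by
  let B : Submodule k (TPow k (WordAlg k S) 1) := LinearMap.range (bHoch k (WordAlg k S) 0)
  have hB : ∀ (x y : FreeSemigroup S) t, B.mkQ (tcons 0 (word k (x * y)) t) =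
      B.mkQ (tcons 0 (word k (y * x)) t) := by
    intro x y t
    rw [← sub_eq_zero, ← map_sub, word_mul, word_mul, ← bHoch_zero_tcons]
    exact (Submodule.Quotient.mk_eq_zero B).2 ⟨_, rfl⟩
  -- The weight is the proportion of letters in the second factor. In `θ(b(x ⊗ y ⊗ z))` the weights
  -- add up to `|z| - (|y| + |z|) + |y| = 0`. In `θ(x ⊗ y + y ⊗ x)` they add up to one.
  let θ : TPow k (WordAlg k S) 2 →ₗ[k] _ ⧸ B :=
    consLift (wordLift fun x => consLift (wordLift fun y =>
      ((y.length : k) / (x * y).length) • (B.mkQ ∘ₗ tcons 0 (word k (x * y)))))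
  have hθ : ∀ (x y : FreeSemigroup S) t, θ (tcons 1 (word k x) (tcons 0 (word k y) t)) =
      ((y.length : k) / (x * y).length) • B.mkQ (tcons 0 (word k (x * y)) t) := by
    intro x y t
    simp only [θ, consLift_tcons, wordLift_word]
    rfl
  have h1 : θ ∘ₗ bHoch k (WordAlg k S) 1 = 0 := by
    refine wordTPow_hom_ext₂ fun x y t => ?_
    refine LinearMap.congr_fun (f := (θ ∘ₗ bHoch k (WordAlg k S) 1) ∘ₗ tcons 2 (word k x) ∘ₗ
      tcons 1 (word k y)) (g := 0) (wordTPow_hom_ext fun z t => ?_) t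
    refine (congrArg θ (bHoch_one_tcons _ _ _ t)).trans ?_
    simp only [map_add, map_sub, ← word_mul, hθ]
    rw [mul_assoc z x y, hB z (x * y), ← mul_assoc, ← sub_smul, ← add_smul]
    have e : (z * (x * y)).length = (x * y * z).length := by simp only [FreeSemigroup.length_mul]; ring
    rw [e, ← sub_div, ← add_div, FreeSemigroup.length_mul y z]
    simp
  have h2 : θ ∘ₗ (1 - cyc k (WordAlg k S) 1) = B.mkQ ∘ₗ bBar k (WordAlg k S) 0 := by
    refine wordTPow_hom_ext₂ fun x y t => ?_
    have hl : ((x * y).length : k) ≠ 0 := by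
      rw [Nat.cast_ne_zero, FreeSemigroup.length_mul, FreeSemigroup.length]
      omega
    have e : (y * x).length = (x * y).length := by simp [add_comm]
    rw [LinearMap.comp_apply, one_sub_cyc_one_tcons, map_add, hθ, hθ, hB y x, e, ← add_smul,
      ← add_div, LinearMap.comp_apply, bBar_zero_tcons, ← word_mul, ← Nat.cast_add, add_comm,
      ← FreeSemigroup.length_mul, div_self hl, one_smul]
  have h3 := congrArg θ h
  rw [map_add, map_zero, ← LinearMap.comp_apply, h1, ← LinearMap.comp_apply, h2,
    LinearMap.zero_apply, zero_add] at h3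
  exact (Submodule.Quotient.mk_eq_zero B).1 h3

end CharZero

end Hochschild

namespace Hochschild

/-! ### Passage to retracts of free algebras. -/

section Retract

variable (k : Type u) [Field k] (A : Type v) [NonUnitalRing A] [Module k A]

/-- The algebra `A` is a retract of a free algebra. -/
def IsFreeRetract : Prop :=
  ∃ (S : Type v) (σ : A →ₙₐ[k] WordAlg k S) (ε : WordAlg k S →ₙₐ[k] A), ∀ a, ε (σ a) = a

variable {k A}

theorem IsFreeRetract.of_retract {B : Type v} [NonUnitalRing B] [Module k B]
    (h : IsFreeRetract k A) (i : B →ₙₐ[k] A) (r : A →ₙₐ[k] B) (hr : ∀ b, r (i b) = b) :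
    IsFreeRetract k B := by
  obtain ⟨S, σ, ε, hε⟩ := h
  exact ⟨S, σ.comp i, r.comp ε, fun b => by simp [hε, hr]⟩

variable [IsScalarTower k A A] [SMulCommClass k A A]

theorem tmap_comp_eq_self {B : Type w} [NonUnitalRing B] [Module k B] [IsScalarTower k B B]
    [SMulCommClass k B B] {σ : A →ₙₐ[k] B} {ε : B →ₙₐ[k] A} (h : ∀ a, ε (σ a) = a) (n : ℕ)
    (x : TPow k A n) : tmap ε n (tmap σ n x) = x := by
  have : ε.comp σ = NonUnitalAlgHom.id k A := NonUnitalAlgHom.ext h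
  rw [← LinearMap.comp_apply, ← tmap_comp, this, tmap_id, LinearMap.id_apply]

theorem tmap_bBar_apply {B : Type w} [NonUnitalRing B] [Module k B] [IsScalarTower k B B]
    [SMulCommClass k B B] (f : A →ₙₐ[k] B) (n : ℕ) (x) :
    tmap f (n + 1) (bBar k A n x) = bBar k B n (tmap f (n + 2) x) :=
  LinearMap.congr_fun (tmap_bBar f n) x

theorem tmap_bHoch_apply {B : Type w} [NonUnitalRing B] [Module k B] [IsScalarTower k B B]
    [SMulCommClass k B B] (f : A →ₙₐ[k] B) (n : ℕ) (x) :
    tmap f (n + 1) (bHoch k A n x) = bHoch k B n (tmap f (n + 2) x) :=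
  LinearMap.congr_fun (tmap_bHoch f n) x

theorem tmap_one_sub_cyc {B : Type w} [NonUnitalRing B] [Module k B] [IsScalarTower k B B]
    [SMulCommClass k B B] (f : A →ₙₐ[k] B) (n : ℕ) (x) :
    tmap f (n + 1) ((1 - cyc k A n) x) = (1 - cyc k B n) (tmap f (n + 1) x) := by
  simp [tmap_cyc]

namespace IsFreeRetract

theorem exists_bBar_eq (h : IsFreeRetract k A) (n : ℕ) (x : TPow k A (n + 2))
    (hx : bBar k A n x = 0) : ∃ y, bBar k A (n + 1) y = x := by
  obtain ⟨S, σ, ε, hε⟩ := h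
  obtain ⟨y, hy⟩ := Hochschild.exists_bBar_eq n (tmap σ _ x) (by
    rw [← tmap_bBar_apply, hx, map_zero])
  exact ⟨tmap ε _ y, by rw [← tmap_bBar_apply, hy, tmap_comp_eq_self hε]⟩

theorem exists_bHoch_eq (h : IsFreeRetract k A) (n : ℕ) (x : TPow k A (n + 3))
    (hx : bHoch k A (n + 1) x = 0) : ∃ y, bHoch k A (n + 2) y = x := by
  obtain ⟨S, σ, ε, hε⟩ := h
  obtain ⟨y, hy⟩ := Hochschild.exists_bHoch_eq n (tmap σ _ x) (by
    rw [← tmap_bHoch_apply, hx, map_zero])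
  exact ⟨tmap ε _ y, by rw [← tmap_bHoch_apply, hy, tmap_comp_eq_self hε]⟩

variable [CharZero k]

theorem exists_bHoch_one_add_eq (h : IsFreeRetract k A) (x : TPow k A 2)
    (hx : bHoch k A 0 x = 0) : ∃ u z, x = bHoch k A 1 u + (1 - cyc k A 1) z := by
  obtain ⟨S, σ, ε, hε⟩ := h
  obtain ⟨u, z, hy⟩ := Hochschild.exists_bHoch_one_add_eq (tmap σ _ x) (by
    rw [← tmap_bHoch_apply, hx, map_zero])
  exact ⟨tmap ε _ u, tmap ε _ z, by
    rw [← tmap_bHoch_apply, ← tmap_one_sub_cyc, ← map_add, ← hy, tmap_comp_eq_self hε]⟩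

theorem exists_bHoch_zero_eq (h : IsFreeRetract k A) (u : TPow k A 3) (z : TPow k A 2)
    (huz : bHoch k A 1 u + (1 - cyc k A 1) z = 0) : ∃ y, bHoch k A 0 y = bBar k A 0 z := by
  obtain ⟨S, σ, ε, hε⟩ := h
  obtain ⟨y, hy⟩ := Hochschild.exists_bHoch_zero_eq (tmap σ _ u) (tmap σ _ z) (by
    rw [← tmap_bHoch_apply, ← tmap_one_sub_cyc, ← map_add, huz, map_zero])
  exact ⟨tmap ε _ y, by
    rw [← tmap_bHoch_apply, hy, ← tmap_bBar_apply, tmap_comp_eq_self hε]⟩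

end IsFreeRetract

end Retract

end Hochschild

namespace Bicomplex

/-! ### The differential of the total complex of a first-quadrant bicomplex. -/

section Differentials

variable {C : Type u} [Category.{v} C] [Preadditive C]
  {K : HomologicalComplex₂ C (ComplexShape.down ℕ) (ComplexShape.down ℕ)}
  [K.HasTotal (ComplexShape.down ℕ)]

theorem ι_d {p q n : ℕ} (h : p + q = n + 1) :
    K.ιTotal (ComplexShape.down ℕ) p q (n + 1) h ≫ (K.total (ComplexShape.down ℕ)).d (n + 1) n =
      K.d₁ (ComplexShape.down ℕ) p q n + K.d₂ (ComplexShape.down ℕ) p q n := by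
  simp [HomologicalComplex₂.total_d]

theorem d₁_succ {p q n : ℕ} (h : p + q = n) :
    K.d₁ (ComplexShape.down ℕ) (p + 1) q n =
      (K.d (p + 1) p).f q ≫ K.ιTotal (ComplexShape.down ℕ) p q n h := by
  rw [K.d₁_eq (ComplexShape.down ℕ) (i₁ := p + 1) (i₁' := p) rfl q n h]
  simp

theorem d₂_succ {p q n : ℕ} (h : p + q = n) :
    K.d₂ (ComplexShape.down ℕ) p (q + 1) n =
      (-1 : ℤˣ) ^ p • ((K.X p).d (q + 1) q ≫ K.ιTotal (ComplexShape.down ℕ) p q n h) := by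
  rw [K.d₂_eq (ComplexShape.down ℕ) p (i₂ := q + 1) (i₂' := q) rfl n h]
  simp

theorem d₁_zero (q n : ℕ) : K.d₁ (ComplexShape.down ℕ) 0 q n = 0 :=
  K.d₁_eq_zero _ _ _ _ (by simp)

theorem d₂_zero (p n : ℕ) : K.d₂ (ComplexShape.down ℕ) p 0 n = 0 :=
  K.d₂_eq_zero _ _ _ _ (by simp)

end Differentials

/-! ### Elements of the total complex and the filtration by columns. -/

section Elements

variable {k : Type u} [Field k]
  {K : HomologicalComplex₂ (ModuleCat.{w} k) (ComplexShape.down ℕ) (ComplexShape.down ℕ)}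

/-- The summand of bidegree `(p, q)` of the total complex of a bicomplex of vector spaces. -/
def incl (K : HomologicalComplex₂ (ModuleCat.{w} k) (ComplexShape.down ℕ) (ComplexShape.down ℕ))
    {p q n : ℕ} (h : p + q = n) : (K.X p).X q →ₗ[k] (K.total (ComplexShape.down ℕ)).X n :=
  (K.ιTotal (ComplexShape.down ℕ) p q n h).hom

theorem hom_ext_incl {n : ℕ} {M : ModuleCat.{w} k}
    {f g : (K.total (ComplexShape.down ℕ)).X n →ₗ[k] M}
    (h : ∀ p q (h : p + q = n), f ∘ₗ incl K h = g ∘ₗ incl K h) : f = g := by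
  have : ModuleCat.ofHom f = ModuleCat.ofHom g := by
    refine HomologicalComplex₂.total.hom_ext _ fun p q hpq => ?_
    ext1
    exact h p q hpq
  exact congrArg ModuleCat.Hom.hom this

/-- The components of `proj`. -/
def projAux (K : HomologicalComplex₂ (ModuleCat.{w} k) (ComplexShape.down ℕ) (ComplexShape.down ℕ))
    {p q n : ℕ} (h : p + q = n) (p' q' : ℕ) (h' : p' + q' = n) :
    (K.X p').X q' ⟶ (K.X p).X q :=
  if hp : p' = p then (K.XXIsoOfEq _ _ _ hp (show q' = q by omega)).hom else 0

/-- The projection of the total complex to the summand of bidegree `(p, q)`. -/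
def proj (K : HomologicalComplex₂ (ModuleCat.{w} k) (ComplexShape.down ℕ) (ComplexShape.down ℕ))
    {p q n : ℕ} (h : p + q = n) : (K.total (ComplexShape.down ℕ)).X n →ₗ[k] (K.X p).X q :=
  (K.totalDesc (projAux K h)).hom

theorem proj_incl {p q n : ℕ} (h : p + q = n) (x : (K.X p).X q) :
    proj K h (incl K h x) = x := by
  have := K.ι_totalDesc (c₁₂ := ComplexShape.down ℕ) (projAux K h) p q h
  rw [projAux, dif_pos rfl] at this
  exact (ConcreteCategory.congr_hom this x).trans (by simp)

theorem proj_incl_of_ne {p q n p' q' : ℕ} (h : p + q = n) (h' : p' + q' = n) (hp : p' ≠ p)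
    (x : (K.X p').X q') : proj K h (incl K h' x) = 0 := by
  have := K.ι_totalDesc (c₁₂ := ComplexShape.down ℕ) (projAux K h) p' q' h'
  rw [projAux, dif_neg hp] at this
  exact ConcreteCategory.congr_hom this x

theorem total_d_incl {p q n : ℕ} (h : p + 1 + (q + 1) = n + 1) (x : (K.X (p + 1)).X (q + 1)) :
    (K.total (ComplexShape.down ℕ)).d (n + 1) n (incl K h x) =
      incl K (show p + (q + 1) = n by omega) ((K.d (p + 1) p).f (q + 1) x) +
      (-1 : ℤˣ) ^ (p + 1) •
        incl K (show p + 1 + q = n by omega) ((K.X (p + 1)).d (q + 1) q x) := by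
  have := ι_d (K := K) h
  rw [d₁_succ (show p + (q + 1) = n by omega), d₂_succ (show p + 1 + q = n by omega)] at this
  exact ConcreteCategory.congr_hom this x

theorem total_d_incl_zero_left {q n : ℕ} (h : 0 + (q + 1) = n + 1) (x : (K.X 0).X (q + 1)) :
    (K.total (ComplexShape.down ℕ)).d (n + 1) n (incl K h x) =
      incl K (show 0 + q = n by omega) ((K.X 0).d (q + 1) q x) := by
  have := ι_d (K := K) h
  rw [d₁_zero, d₂_succ (show 0 + q = n by omega), zero_add, pow_zero, one_smul] at this
  exact ConcreteCategory.congr_hom this x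

theorem total_d_incl_zero_right {p n : ℕ} (h : p + 1 + 0 = n + 1) (x : (K.X (p + 1)).X 0) :
    (K.total (ComplexShape.down ℕ)).d (n + 1) n (incl K h x) =
      incl K (show p + 0 = n by omega) ((K.d (p + 1) p).f 0 x) := by
  have := ι_d (K := K) h
  rw [d₁_succ (show p + 0 = n by omega), d₂_zero, add_zero] at this
  exact ConcreteCategory.congr_hom this x

/-- The part of the total complex in degree `n` that comes from the columns of index `< P`. -/
def fil (K : HomologicalComplex₂ (ModuleCat.{w} k) (ComplexShape.down ℕ) (ComplexShape.down ℕ))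
    (n : ℕ) : ℕ → Submodule k ((K.total (ComplexShape.down ℕ)).X n)
  | 0 => ⊥
  | P + 1 => fil K n P ⊔ ⨆ (q : ℕ) (h : P + q = n), LinearMap.range (incl K h)

theorem incl_mem_fil {p q n P : ℕ} (h : p + q = n) (hp : p < P) (x : (K.X p).X q) :
    incl K h x ∈ fil K n P := by
  induction P with
  | zero => omega
  | succ P ih =>
    rcases Nat.lt_succ_iff_lt_or_eq.1 hp with hp | rfl
    · exact Submodule.mem_sup_left (ih hp)
    · exact Submodule.mem_sup_right (Submodule.mem_iSup_of_mem q
        (Submodule.mem_iSup_of_mem h ⟨x, rfl⟩))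

theorem fil_le_iff {n P : ℕ} {N : Submodule k ((K.total (ComplexShape.down ℕ)).X n)} :
    fil K n P ≤ N ↔ ∀ p q (h : p + q = n), p < P → ∀ x, incl K h x ∈ N := by
  refine ⟨fun hN p q h hp x => hN (incl_mem_fil h hp x), fun hN => ?_⟩
  induction P with
  | zero => exact bot_le
  | succ P ih =>
    refine sup_le (ih fun p q h hp x => hN p q h (by omega) x) (iSup_le fun q => iSup_le fun h => ?_)
    rintro _ ⟨x, rfl⟩
    exact hN P q h (by omega) x

theorem fil_mono {n P P' : ℕ} (h : P ≤ P') : fil K n P ≤ fil K n P' :=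
  fil_le_iff.2 fun _ _ h' hp x => incl_mem_fil h' (by omega) x

theorem units_smul_mem_iff {M : Type w} [AddCommGroup M] [Module k M] {N : Submodule k M}
    (s : ℤˣ) {x : M} : s • x ∈ N ↔ x ∈ N := by
  rcases Int.units_eq_one_or s with rfl | rfl <;> simp

theorem fil_eq_top (n : ℕ) : fil K n (n + 1) = ⊤ := by
  rw [← Submodule.ker_mkQ (fil K n (n + 1)), LinearMap.ker_eq_top]
  refine hom_ext_incl (M := ModuleCat.of k _) fun p q h => LinearMap.ext fun x => ?_
  exact (Submodule.Quotient.mk_eq_zero _).2 (incl_mem_fil h (by omega) x)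

/-- The projection to column `p` kills all columns of smaller index. This lemma lets components of
an equation in the total complex be read off modulo lower columns. -/
theorem eq_zero_of_incl_mem_fil {p q n : ℕ} (h : p + q = n) (x : (K.X p).X q)
    (hx : incl K h x ∈ fil K n p) : x = 0 := by
  have hle : fil K n p ≤ LinearMap.ker (proj K h) :=
    fil_le_iff.2 fun p' q' h' hp x => proj_incl_of_ne h h' (by omega) x
  rw [← proj_incl h x]
  exact hle hx

theorem exists_sub_incl_mem_fil {p q n : ℕ} (h : p + q = n)
    {x : (K.total (ComplexShape.down ℕ)).X n} (hx : x ∈ fil K n (p + 1)) :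
    ∃ y, x - incl K h y ∈ fil K n p := by
  obtain ⟨a, ha, b, hb, rfl⟩ := Submodule.mem_sup.1 hx
  have hle : ⨆ (q : ℕ) (h : p + q = n), LinearMap.range (incl K h) ≤
      LinearMap.range (incl K h) :=
    iSup_le fun q' => iSup_le fun h' => by
      obtain rfl : q' = q := by omega
      exact le_rfl
  obtain ⟨y, rfl⟩ := hle hb
  exact ⟨y, by simpa using ha⟩

theorem d_incl_mem_fil {p q n : ℕ} (h : p + q = n + 1) (x : (K.X p).X q) :
    (K.total (ComplexShape.down ℕ)).d (n + 1) n (incl K h x) ∈ fil K n (p + 1) := by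
  rcases p with - | p <;> rcases q with - | q
  · omega
  · rw [total_d_incl_zero_left]
    exact incl_mem_fil _ (by omega) _
  · rw [total_d_incl_zero_right]
    exact incl_mem_fil _ (by omega) _
  · rw [total_d_incl]
    refine add_mem (incl_mem_fil _ (by omega) _) ?_
    rw [Units.smul_def]
    exact zsmul_mem (incl_mem_fil _ (by omega) _) _

theorem d_mem_fil {n P : ℕ} {x : (K.total (ComplexShape.down ℕ)).X (n + 1)}
    (hx : x ∈ fil K (n + 1) P) : (K.total (ComplexShape.down ℕ)).d (n + 1) n x ∈ fil K n P := by
  have : fil K (n + 1) P ≤ (fil K n P).comap ((K.total (ComplexShape.down ℕ)).d (n + 1) n).hom := by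
    refine fil_le_iff.2 fun p q h hp x => ?_
    exact fil_mono (show p + 1 ≤ P by omega) (d_incl_mem_fil h x)
  exact this hx

/-- The horizontal part of the differential lands in column `p - 1`, so on the associated graded of
the filtration only the signed vertical differential survives. -/
theorem d_incl_sub_mem_fil {p q n : ℕ} (h : p + (q + 1) = n + 1) (x : (K.X p).X (q + 1)) :
    (K.total (ComplexShape.down ℕ)).d (n + 1) n (incl K h x) - (-1 : ℤˣ) ^ p •
      incl K (show p + q = n by omega) ((K.X p).d (q + 1) q x) ∈ fil K n p := by
  rcases p with - | p
  · rw [total_d_incl_zero_left]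
    simp
  · rw [total_d_incl, add_sub_cancel_right]
    exact incl_mem_fil _ (by omega) _

/-- A cycle of the total complex that comes from columns in which the corresponding
homology vanishes is a boundary. -/
theorem exists_d_eq_of_mem_fil {n P : ℕ}
    (hK : ∀ p q, p + q = n + 1 → p < P → ∀ y : (K.X p).X q,
      (∀ q', q = q' + 1 → (K.X p).d q q' y = 0) → ∃ z, (K.X p).d (q + 1) q z = y)
    (x : (K.total (ComplexShape.down ℕ)).X (n + 1)) (hx : x ∈ fil K (n + 1) P)
    (hdx : (K.total (ComplexShape.down ℕ)).d (n + 1) n x = 0) :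
    ∃ z, (K.total (ComplexShape.down ℕ)).d (n + 2) (n + 1) z = x := by
  induction P generalizing x with
  | zero =>
    obtain rfl : x = 0 := hx
    exact ⟨0, map_zero _⟩
  | succ P ih =>
    have hK' : ∀ p q, p + q = n + 1 → p < P → ∀ y : (K.X p).X q,
      (∀ q', q = q' + 1 → (K.X p).d q q' y = 0) → ∃ z, (K.X p).d (q + 1) q z = y :=
      fun p q h hp => hK p q h (by omega)
    -- In total degree `n + 1` the columns of index above `n + 1` contribute nothing, and the
    -- filtration step is then trivial.
    by_cases hP : P ≤ n + 1
    · obtain ⟨q, h⟩ := Nat.exists_eq_add_of_le hP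
      obtain ⟨y, hy⟩ := exists_sub_incl_mem_fil h.symm hx
      -- The leading component `y` is a vertical cycle: modulo columns below `P`, the total
      -- differential of `x` is the signed vertical differential of `y`. Subtracting the boundary of
      -- a signed vertical primitive moves `x` one step down the filtration.
      obtain ⟨z, rfl⟩ := hK P q h.symm (by omega) y (by
        rintro q rfl
        have h1 := d_mem_fil hy
        rw [map_sub, hdx, zero_sub, neg_mem_iff] at h1
        have h2 := sub_mem h1 (d_incl_sub_mem_fil h.symm y)
        rw [sub_sub_cancel] at h2
        refine eq_zero_of_incl_mem_fil (show P + q = n by omega) _ ?_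
        rwa [units_smul_mem_iff] at h2)
      have h1 := d_incl_sub_mem_fil (show P + (q + 1) = n + 1 + 1 by omega) z
      rw [← units_smul_mem_iff ((-1 : ℤˣ) ^ P), smul_sub, smul_smul, Int.units_mul_self,
        one_smul] at h1
      have h2 := sub_mem hy h1
      rw [sub_sub_sub_cancel_right] at h2
      have h3 : (-1 : ℤˣ) ^ P • (K.total (ComplexShape.down ℕ)).d (n + 1 + 1) (n + 1)
          (incl K (show P + (q + 1) = n + 1 + 1 by omega) z) =
          (K.total (ComplexShape.down ℕ)).d (n + 1 + 1) (n + 1) ((-1 : ℤˣ) ^ P •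
            (incl K (show P + (q + 1) = n + 1 + 1 by omega) z)) := by
        rw [Units.smul_def, Units.smul_def, map_zsmul]
      rw [h3] at h2
      obtain ⟨w, hw⟩ := ih hK' _ h2 (by
        rw [map_sub, hdx, zero_sub, neg_eq_zero, ← ConcreteCategory.comp_apply,
          HomologicalComplex.d_comp_d]
        rfl)
      exact ⟨_, (map_add _ _ _).trans (eq_sub_iff_add_eq.1 hw)⟩
    · refine ih hK' x ?_ hdx
      refine (fil_le_iff (P := P + 1)).2 (fun p q h hp x => ?_) hx
      exact incl_mem_fil h (by omega) x

end Elements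

end Bicomplex

namespace Bicomplex

/-! ### Exactness criteria adapted to the cyclic bicomplex. -/

section Cyclic

variable {k : Type u} [Field k]
  {K : HomologicalComplex₂ (ModuleCat.{w} k) (ComplexShape.down ℕ) (ComplexShape.down ℕ)}

/-- Exactness of a complex of vector spaces in degree `q`, in terms of elements. -/
def ExactIn (L : ChainComplex (ModuleCat.{w} k) ℕ) (q : ℕ) : Prop :=
  ∀ y : L.X q, (∀ q', q = q' + 1 → L.d q q' y = 0) → ∃ z, L.d (q + 1) q z = y

theorem ExactIn.isZero_homology {L : ChainComplex (ModuleCat.{w} k) ℕ} {q : ℕ}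
    (h : ExactIn L (q + 1)) : IsZero (L.homology (q + 1)) := by
  refine HomologicalComplex.ExactAt.isZero_homology ?_
  rw [HomologicalComplex.exactAt_iff' _ (q + 2) (q + 1) q (by simp) (by simp)]
  rw [ShortComplex.moduleCat_exact_iff]
  intro x hx
  exact h x fun q' e => by
    obtain rfl : q = q' := by omega
    exact hx

theorem exactIn_total {n : ℕ} (hK : ∀ p q, p + q = n + 1 → ExactIn (K.X p) q) :
    ExactIn (K.total (ComplexShape.down ℕ)) (n + 1) := fun x hx =>
  exists_d_eq_of_mem_fil (P := n + 2) (fun p q h _ => hK p q h) x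
    (by rw [fil_eq_top]; trivial) (hx n rfl)

/-- Exactness of the total complex in an odd degree. -/
theorem exactIn_total_of_even {p : ℕ} (hp : Even p)
    (hK : ∀ p' q, p' + q = p + 1 → p' < p → ExactIn (K.X p') q)
    (hp1 : ∀ (x : (K.X p).X 1) (y : (K.X (p + 1)).X 0),
      (K.X p).d 1 0 x + (K.d (p + 1) p).f 0 y = 0 →
      ∃ u z a, x = (K.X p).d 2 1 u + (K.d (p + 1) p).f 1 z ∧
        y = -(K.X (p + 1)).d 1 0 z + (K.d (p + 2) (p + 1)).f 0 a) :
    ExactIn (K.total (ComplexShape.down ℕ)) (p + 1) := by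
  intro x hx
  have hdx := hx p rfl
  obtain ⟨y, hy⟩ := exists_sub_incl_mem_fil (show p + 1 + 0 = p + 1 by omega)
    (x := x) (by rw [fil_eq_top]; trivial)
  obtain ⟨x₁, hx₁⟩ := exists_sub_incl_mem_fil (show p + 1 = p + 1 by omega) hy
  have h1 := d_mem_fil hx₁
  have h2 := d_incl_sub_mem_fil (n := p) (show p + (0 + 1) = p + 1 by omega) x₁
  rw [map_sub, map_sub, hdx, total_d_incl_zero_right] at h1
  rw [hp.neg_one_pow, one_smul] at h2
  have h3 := add_mem h1 h2
  -- The components of `x` in columns `p` and `p + 1` lie where the vertical homology need not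
  -- vanish, so they are treated together. Column `p` of the equation `d x = 0` is the hypothesis of
  -- `hp1`.
  obtain ⟨u, z, a, rfl, rfl⟩ := hp1 x₁ y (by
    refine eq_zero_of_incl_mem_fil (show p + 0 = p by omega) _ ?_
    rw [map_add, ← neg_mem_iff]
    convert h3 using 1
    abel)
  have h4 := d_incl_sub_mem_fil (n := p + 1) (show p + (1 + 1) = p + 1 + 1 by omega) u
  rw [hp.neg_one_pow, one_smul] at h4
  have h5 : (K.total (ComplexShape.down ℕ)).d (p + 1 + 1) (p + 1)
      (incl K (show p + 1 + (0 + 1) = p + 1 + 1 by omega) z) = _ := total_d_incl _ z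
  have h6 : (K.total (ComplexShape.down ℕ)).d (p + 1 + 1) (p + 1)
      (incl K (show p + 1 + 1 + 0 = p + 1 + 1 by omega) a) = _ := total_d_incl_zero_right _ a
  rw [hp.add_one.neg_one_pow, Units.neg_smul, one_smul] at h5
  -- The elements `u`, `z`, `a` in columns `p`, `p + 1`, `p + 2` have a boundary that cancels both
  -- components. The rest lies in columns below `p`, where `hK` applies.
  obtain ⟨v, hv⟩ := exists_d_eq_of_mem_fil (n := p) (P := p) hK (x -
    (K.total (ComplexShape.down ℕ)).d (p + 1 + 1) (p + 1)
      (incl K (show p + (1 + 1) = p + 1 + 1 by omega) u +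
       incl K (show p + 1 + (0 + 1) = p + 1 + 1 by omega) z +
       incl K (show p + 1 + 1 + 0 = p + 1 + 1 by omega) a))
    (by
      have h7 := sub_mem hx₁ h4
      rw [map_add, map_add, h5, h6]
      convert h7 using 1
      simp only [map_add, map_neg]
      abel)
    (by
      rw [map_sub, hdx, zero_sub, neg_eq_zero, ← ConcreteCategory.comp_apply,
        HomologicalComplex.d_comp_d]
      rfl)
  exact ⟨_, (map_add _ _ _).trans (eq_sub_iff_add_eq.1 hv)⟩

/-- Exactness of the total complex in an even degree. -/
theorem exactIn_total_of_odd {p : ℕ} (hp : Even p)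
    (hK : ∀ p' q, p' + q = p + 2 → p' < p + 2 → ExactIn (K.X p') q)
    (hp2 : ∀ (y₂ : (K.X (p + 2)).X 0) (y₁ : (K.X (p + 1)).X 1) (y₀ : (K.X p).X 2),
      (K.d (p + 2) (p + 1)).f 0 y₂ = (K.X (p + 1)).d 1 0 y₁ →
      (K.X p).d 2 1 y₀ + (K.d (p + 1) p).f 1 y₁ = 0 → ∃ w, (K.X (p + 2)).d 1 0 w = y₂) :
    ExactIn (K.total (ComplexShape.down ℕ)) (p + 2) := by
  intro x hx
  have hdx := hx (p + 1) rfl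
  obtain ⟨y₂, hy₂⟩ := exists_sub_incl_mem_fil (show p + 2 + 0 = p + 2 by omega)
    (x := x) (by rw [fil_eq_top]; trivial)
  obtain ⟨y₁, hy₁⟩ := exists_sub_incl_mem_fil (show p + 1 + (0 + 1) = p + 1 + 1 by omega) hy₂
  obtain ⟨y₀, hy₀⟩ := exists_sub_incl_mem_fil (show p + (1 + 1) = p + 1 + 1 by omega) hy₁
  have e2 : (K.total (ComplexShape.down ℕ)).d (p + 1 + 1) (p + 1)
      (incl K (show p + 2 + 0 = p + 2 by omega) y₂) = _ := total_d_incl_zero_right _ y₂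
  have e1 : (K.total (ComplexShape.down ℕ)).d (p + 1 + 1) (p + 1)
      (incl K (show p + 1 + (0 + 1) = p + 1 + 1 by omega) y₁) = _ := total_d_incl _ y₁
  rw [hp.add_one.neg_one_pow, Units.neg_smul, one_smul] at e1
  have e0 := d_incl_sub_mem_fil (n := p + 1) (show p + (1 + 1) = p + 1 + 1 by omega) y₀
  rw [hp.neg_one_pow, one_smul] at e0
  have h0 := d_mem_fil hy₀
  rw [map_sub, map_sub, map_sub, hdx, e2, e1] at h0
  have h1 := add_mem h0 e0
  -- This is column `p + 1` of `d x = 0`; column `p` gives the other hypothesis of `hp2`. The only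
  -- possibly obstructed component is `y₂`, in row zero of column `p + 2`.
  have c1 : (K.d (p + 2) (p + 1)).f 0 y₂ - (K.X (p + 1)).d 1 0 y₁ = 0 := by
    refine eq_zero_of_incl_mem_fil (show p + 1 + 0 = p + 1 by omega) _ ?_
    have h2 := fil_mono (show p ≤ p + 1 by omega) h1
    have h3 := add_mem (incl_mem_fil (P := p + 1) (show p + (0 + 1) = p + 1 by omega) (by omega)
      ((K.d (p + 1) p).f 1 y₁)) (incl_mem_fil (P := p + 1) (show p + 1 = p + 1 by omega) (by omega)
      ((K.X p).d 2 1 y₀))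
    rw [← neg_mem_iff]
    convert add_mem h2 h3 using 1
    simp only [map_sub]
    abel
  have c1' := congrArg (incl K (show p + 1 + 0 = p + 1 by omega)) (sub_eq_zero.1 c1)
  obtain ⟨w, rfl⟩ := hp2 y₂ y₁ y₀ (sub_eq_zero.1 c1) (by
    refine eq_zero_of_incl_mem_fil (show p + 1 = p + 1 by omega) _ ?_
    rw [← neg_mem_iff]
    convert h1 using 1
    rw [map_add]
    erw [c1']
    abel)
  have h4 := d_incl_sub_mem_fil (n := p + 2) (show p + 2 + (0 + 1) = p + 2 + 1 by omega) w
  rw [(hp.add even_two).neg_one_pow, one_smul] at h4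
  obtain ⟨v, hv⟩ := exists_d_eq_of_mem_fil (n := p + 1) (P := p + 2) hK (x -
    (K.total (ComplexShape.down ℕ)).d (p + 2 + 1) (p + 2)
      (incl K (show p + 2 + (0 + 1) = p + 2 + 1 by omega) w))
    (by simpa using sub_mem hy₂ h4)
    (by
      rw [map_sub, hdx, zero_sub, neg_eq_zero, ← ConcreteCategory.comp_apply,
        HomologicalComplex.d_comp_d]
      rfl)
  exact ⟨_, (map_add _ _ _).trans (eq_sub_iff_add_eq.1 hv)⟩

end Cyclic

end Bicomplex

/-! ### Vanishing of `H_*(CC^{2})` and `H_*(CC)` for retracts of free algebras. -/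

namespace Hochschild

open Bicomplex

variable {k : Type u} [Field k] (A : NUAlg.{u, v} k)

theorem cyclicBicomplex_d (p : ℕ) :
    ((cyclicBicomplex k).obj A).d (p + 1) p = (cyclicRow k p).app A :=
  congrArg (fun f => NatTrans.app f A)
    (ChainComplex.of_d (cyclicColumn.{u, v} k) (cyclicRow k) p)

theorem cyclicBicomplexTwo_d (p : ℕ) :
    ((cyclicBicomplexTwo k).obj A).d (p + 1) p = (cyclicRowTwo k p).app A :=
  congrArg (fun f => NatTrans.app f A)
    (ChainComplex.of_d (cyclicColumnTwo.{u, v} k) (cyclicRowTwo k) p)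

theorem hochschildComplex_d_apply (n : ℕ) (x : TPow k A (n + 2)) :
    ((hochschildComplex k).obj A).d (n + 1) n x = bHoch k A n x :=
  ConcreteCategory.congr_hom (hochschildObj_d k A n) x

theorem barComplex_d_apply (n : ℕ) (x : TPow k A (n + 2)) :
    ((barComplex k).obj A).d (n + 1) n x = bBar k A n x :=
  ConcreteCategory.congr_hom (barObj_d k A n) x

variable {A}

theorem cyc_zero : cyc k A 0 = 1 := by
  simpa using cyc_pow (k := k) (A := A) 0

theorem norm_zero : norm k A 0 = 1 := by
  simp [norm]

namespace IsFreeRetract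

theorem exactIn_hochschildComplex (hA : IsFreeRetract k A) (q : ℕ) :
    ExactIn ((hochschildComplex k).obj A) (q + 2) := by
  intro y hy
  obtain ⟨z, hz⟩ := hA.exists_bHoch_eq q y
    ((hochschildComplex_d_apply A _ _).symm.trans (hy (q + 1) rfl))
  exact ⟨z, (hochschildComplex_d_apply A _ _).trans hz⟩

theorem exactIn_barComplex (hA : IsFreeRetract k A) (q : ℕ) :
    ExactIn ((barComplex k).obj A) (q + 1) := by
  intro y hy
  obtain ⟨z, hz⟩ := hA.exists_bBar_eq q y
    ((barComplex_d_apply A _ _).symm.trans (hy q rfl))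
  exact ⟨z, (barComplex_d_apply A _ _).trans hz⟩

/-- In total degree at least two, the Hochschild column is met in degree at least two and the bar
column in degree at least one. Both are exact there, in any characteristic. -/
theorem exactIn_CCTwo (hA : IsFreeRetract k A) (n : ℕ) : ExactIn ((CCTwo k).obj A) (n + 2) := by
  refine exactIn_total (K := (cyclicBicomplexTwo k).obj A) (n := n + 1) fun p q h => ?_
  match p with
  | 0 =>
    obtain rfl : q = n + 2 := by omega
    exact hA.exactIn_hochschildComplex n
  | 1 =>
    obtain rfl : q = n + 1 := by omega
    exact hA.exactIn_barComplex n
  | p + 2 =>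
    intro y _
    have h0 : IsZero ((((cyclicBicomplexTwo k).obj A).X (p + 2)).X q) :=
      (HomologicalComplex.eval _ _ q).map_isZero
        (isZero_zero (NUAlg.{u, v} k ⥤ ChainComplex (ModuleCat.{max u v} k) ℕ) |>.obj A)
    have := ModuleCat.subsingleton_of_isZero h0
    exact ⟨0, Subsingleton.elim _ _⟩

/-- The excluded positions are row zero of every column and row one of the Hochschild columns, where
the homology need not vanish even for a free algebra. -/
theorem exactIn_cyclicColumn (hA : IsFreeRetract k A) :
    ∀ p q, 1 ≤ q → (Even p → 2 ≤ q) → ExactIn ((cyclicColumn k p).obj A) q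
  | 0, q, _, hq => by
    obtain ⟨q, rfl⟩ := Nat.exists_eq_add_of_le' (hq Even.zero)
    exact hA.exactIn_hochschildComplex q
  | 1, q, hq, _ => by
    obtain ⟨q, rfl⟩ := Nat.exists_eq_add_of_le' hq
    exact hA.exactIn_barComplex q
  | p + 2, q, hq, hq' =>
    exactIn_cyclicColumn hA p q hq fun hp => hq' (hp.add even_two)

variable [CharZero k]

/-- On `A^{⊗ 1}` both `t` and `N` are the identity. Hence `y` does not enter the hypothesis, which
reads `b x = 0`. Once `z` is chosen for `x`, the element `a = y + b' z` of the next Hochschild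
column corrects `y`. -/
theorem exists_of_add_eq_zero (hA : IsFreeRetract k A) (x : TPow k A 2) (y : TPow k A 1)
    (h : bHoch k A 0 x + (1 - cyc k A 0) y = 0) :
    ∃ (u : ((hochschildComplex k).obj A).X 2) (z : ((barComplex k).obj A).X 1)
      (a : ((hochschildComplex k).obj A).X 0),
      x = ((hochschildComplex k).obj A).d 2 1 u + ((oneSubCyc k).app A).f 1 z ∧
        y = -((barComplex k).obj A).d 1 0 z + ((normMap k).app A).f 0 a := by
  rw [cyc_zero, sub_self, LinearMap.zero_apply, add_zero] at h
  obtain ⟨u, z, rfl⟩ := hA.exists_bHoch_one_add_eq x h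
  refine ⟨u, z, y + bBar k A 0 z, ?_, ?_⟩
  · exact congrArg (fun t : TPow k A 2 => t + (1 - cyc k A 1) z)
      (hochschildComplex_d_apply A 1 u).symm
  · have h2 : y = -bBar k A 0 z + norm k A 0 (y + bBar k A 0 z) := by
      rw [norm_zero, Module.End.one_apply]
      abel
    exact h2.trans (congrArg (fun t : TPow k A 1 => -t + norm k A 0 (y + bBar k A 0 z))
      (barComplex_d_apply A 0 z).symm)

/-- Since `N = 1` on `A^{⊗ 1}`, the element `y₂` equals `b' y₁`, and `exists_bHoch_zero_eq` puts it
in the image of `b`. -/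
theorem exists_of_norm_eq (hA : IsFreeRetract k A) (y₂ : TPow k A 1) (y₁ : TPow k A 2)
    (y₀ : TPow k A 3) (h : norm k A 0 y₂ = bBar k A 0 y₁)
    (h' : bHoch k A 1 y₀ + (1 - cyc k A 1) y₁ = 0) :
    ∃ w, ((hochschildComplex k).obj A).d 1 0 w = y₂ := by
  rw [norm_zero, Module.End.one_apply] at h
  obtain ⟨w, hw⟩ := hA.exists_bHoch_zero_eq y₀ y₁ h'
  exact ⟨w, (hochschildComplex_d_apply A _ _).trans (hw.trans h.symm)⟩

theorem exists_of_cyclicColumn_even (hA : IsFreeRetract k A) : ∀ p, Even p →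
    ∀ (x : ((cyclicColumn k p).obj A).X 1) (y : ((cyclicColumn k (p + 1)).obj A).X 0),
      ((cyclicColumn k p).obj A).d 1 0 x + ((cyclicRow k p).app A).f 0 y = 0 →
      ∃ u z a, x = ((cyclicColumn k p).obj A).d 2 1 u + ((cyclicRow k p).app A).f 1 z ∧
        y = -((cyclicColumn k (p + 1)).obj A).d 1 0 z + ((cyclicRow k (p + 1)).app A).f 0 a
  | 0, _, x, y, h => exists_of_add_eq_zero hA x y
      ((congrArg (fun t : TPow k A 1 => t + (1 - cyc k A 0) y)
        (hochschildComplex_d_apply A 0 x).symm).trans h)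
  | 1, hp, _, _, _ => (Nat.not_even_one hp).elim
  -- Columns and rows are 2-periodic by definition, so the statement for `p + 2` unfolds to the one
  -- for `p`.
  | p + 2, hp, x, y, h =>
    exists_of_cyclicColumn_even hA p ((Nat.even_add.1 hp).2 even_two) x y h

theorem exists_of_cyclicColumn_odd (hA : IsFreeRetract k A) : ∀ p, Even p →
    ∀ (y₂ : ((cyclicColumn k (p + 2)).obj A).X 0) (y₁ : ((cyclicColumn k (p + 1)).obj A).X 1)
      (y₀ : ((cyclicColumn k p).obj A).X 2),
      ((cyclicRow k (p + 1)).app A).f 0 y₂ = ((cyclicColumn k (p + 1)).obj A).d 1 0 y₁ →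
      ((cyclicColumn k p).obj A).d 2 1 y₀ + ((cyclicRow k p).app A).f 1 y₁ = 0 →
      ∃ w, ((cyclicColumn k (p + 2)).obj A).d 1 0 w = y₂
  | 0, _, y₂, y₁, y₀, h, h' => exists_of_norm_eq hA y₂ y₁ y₀
      (h.trans (barComplex_d_apply A 0 y₁))
      ((congrArg (fun t : TPow k A 2 => t + (1 - cyc k A 1) y₁)
        (hochschildComplex_d_apply A 1 y₀).symm).trans h')
  | 1, hp, _, _, _, _, _ => (Nat.not_even_one hp).elim
  | p + 2, hp, y₂, y₁, y₀, h, h' =>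
    exists_of_cyclicColumn_odd hA p ((Nat.even_add.1 hp).2 even_two) y₂ y₁ y₀ h h'

/-- The parity of the total degree decides which kinds of column meet the two lowest rows. In odd
degrees a Hochschild column is met in row one and a bar column in row zero. In even degrees only row
zero of a Hochschild column is obstructed. -/
theorem exactIn_CC (hA : IsFreeRetract k A) (n : ℕ) : ExactIn ((CC k).obj A) (n + 1) := by
  rcases Nat.even_or_odd n with hn | ⟨m, rfl⟩
  · refine exactIn_total_of_even (K := (cyclicBicomplex k).obj A) hn
      (fun p q h hp => hA.exactIn_cyclicColumn p q (by omega) (fun _ => by omega)) ?_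
    rw [cyclicBicomplex_d, cyclicBicomplex_d]
    exact hA.exists_of_cyclicColumn_even n hn
  · refine exactIn_total_of_odd (K := (cyclicBicomplex k).obj A) (even_two_mul m)
      (fun p q h hp => hA.exactIn_cyclicColumn p q (by omega) (fun ⟨r, hr⟩ => by omega)) ?_
    rw [cyclicBicomplex_d, cyclicBicomplex_d]
    exact hA.exists_of_cyclicColumn_odd (2 * m) (even_two_mul m)

end IsFreeRetract

end Hochschild

namespace HomologicalComplex

variable {k : Type u} [Field k] (L : ChainComplex (ModuleCat.{w} k) ℕ)

theorem homologyπ_eq_zero_iff (n : ℕ) (x : L.cycles n) :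
    L.homologyπ n x = 0 ↔ ∃ z, L.d (n + 1) n z = L.iCycles n x := by
  have hex : (ShortComplex.mk (L.toCycles (n + 1) n) (L.homologyπ n) (by simp)).Exact :=
    ShortComplex.exact_of_g_is_cokernel _ (L.homologyIsCokernel (n + 1) n (by simp))
  have hi : Function.Injective (L.iCycles n) := (ModuleCat.mono_iff_injective _).1 inferInstance
  constructor
  · intro h
    obtain ⟨z, hz⟩ := (ShortComplex.moduleCat_exact_iff _).1 hex x h
    refine ⟨z, ?_⟩
    rw [← hz, ← ConcreteCategory.comp_apply]
    simp
  · rintro ⟨z, hz⟩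
    obtain rfl : L.toCycles (n + 1) n z = x := hi (by
      rw [← hz, ← ConcreteCategory.comp_apply]
      simp)
    rw [← ConcreteCategory.comp_apply]
    simp

end HomologicalComplex

namespace Hochschild

open Bicomplex

/-! ### `H_1(CC^{2}(A))` as `A/[A, A]`. -/

section ConnectingClass

variable {k : Type u} [Field k] (A : NUAlg.{u, v} k)

/-- The column of index `0` in `CC^{2}(A)`. -/
def inclHoch (q : ℕ) : TPow k A (q + 1) →ₗ[k] ((CCTwo k).obj A).X q :=
  incl ((cyclicBicomplexTwo k).obj A) (show 0 + q = q by omega)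

/-- The column of index `1` in `CC^{2}(A)`. -/
def inclBar (q : ℕ) : TPow k A (q + 1) →ₗ[k] ((CCTwo k).obj A).X (q + 1) :=
  incl ((cyclicBicomplexTwo k).obj A) (show 1 + q = q + 1 by omega)

theorem d_inclHoch (q : ℕ) (x : TPow k A (q + 2)) :
    ((CCTwo k).obj A).d (q + 1) q (inclHoch A (q + 1) x) = inclHoch A q (bHoch k A q x) :=
  (total_d_incl_zero_left (K := (cyclicBicomplexTwo k).obj A)
    (show 0 + (q + 1) = q + 1 by omega) x).trans
    (congrArg (inclHoch A q) (hochschildComplex_d_apply A q x))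

theorem d_inclBar (q : ℕ) (x : TPow k A (q + 2)) :
    ((CCTwo k).obj A).d (q + 2) (q + 1) (inclBar A (q + 1) x) =
      inclHoch A (q + 1) ((1 - cyc k A (q + 1)) x) - inclBar A q (bBar k A q x) := by
  refine (total_d_incl (K := (cyclicBicomplexTwo k).obj A)
    (show 0 + 1 + (q + 1) = q + 1 + 1 by omega) x).trans ?_
  rw [cyclicBicomplexTwo_d, Odd.neg_one_pow (show Odd (0 + 1) by decide), Units.neg_smul, one_smul,
    ← sub_eq_add_neg]
  exact congrArg (fun t => inclHoch A (q + 1) ((1 - cyc k A (q + 1)) x) - inclBar A q t)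
    (barComplex_d_apply A q x)

/-- On `A^{⊗ 1}` the operator `1 - t` is zero, so every element of `A` in the bar column is a
1-cycle. -/
theorem d_inclBar_zero (x : TPow k A 1) : ((CCTwo k).obj A).d 1 0 (inclBar A 0 x) = 0 := by
  refine (total_d_incl_zero_right (K := (cyclicBicomplexTwo k).obj A)
    (show 0 + 1 + 0 = 0 + 1 from rfl) x).trans ?_
  rw [cyclicBicomplexTwo_d]
  have : (1 - cyc k A 0) x = 0 := by simp [cyc_zero]
  exact (congrArg (inclHoch A 0) this).trans (map_zero _)

theorem subsingleton_cyclicBicomplexTwo (p q : ℕ) :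
    Subsingleton ((((cyclicBicomplexTwo k).obj A).X (p + 2)).X q) :=
  ModuleCat.subsingleton_of_isZero ((HomologicalComplex.eval _ _ q).map_isZero
    (isZero_zero (NUAlg.{u, v} k ⥤ ChainComplex (ModuleCat.{max u v} k) ℕ) |>.obj A))

theorem exists_eq_inclBar_add_inclHoch (n : ℕ) (x : ((CCTwo k).obj A).X (n + 1)) :
    ∃ y z, x = inclBar A n y + inclHoch A (n + 1) z := by
  have hle : fil ((cyclicBicomplexTwo k).obj A) (n + 1) (n + 2) ≤
      fil ((cyclicBicomplexTwo k).obj A) (n + 1) 2 := by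
    refine fil_le_iff.2 fun p q h _ y => ?_
    match p with
    | 0 | 1 => exact incl_mem_fil h (by omega) y
    | p + 2 =>
      have := subsingleton_cyclicBicomplexTwo A p q
      rw [Subsingleton.elim y 0, map_zero]
      exact zero_mem _
  rw [fil_eq_top] at hle
  obtain ⟨y, hy⟩ := exists_sub_incl_mem_fil (K := (cyclicBicomplexTwo k).obj A)
    (show 1 + n = n + 1 by omega) (x := x) (hle trivial)
  obtain ⟨z, hz⟩ := exists_sub_incl_mem_fil (show 0 + (n + 1) = n + 1 by omega) hy
  exact ⟨y, z, eq_add_of_sub_eq' (sub_eq_zero.1 hz)⟩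

variable {A} in
theorem inclHoch_injective (n : ℕ) : Function.Injective (inclHoch A n) := by
  refine (injective_iff_map_eq_zero _).2 fun y hy => ?_
  refine eq_zero_of_incl_mem_fil (K := (cyclicBicomplexTwo k).obj A)
    (show 0 + n = n by omega) _ ?_
  have : inclHoch A n y ∈ fil ((cyclicBicomplexTwo k).obj A) n 0 := by
    rw [hy]
    exact zero_mem _
  exact this

variable {A} in
theorem eq_zero_of_inclBar_eq_inclHoch {n : ℕ} {y : TPow k A (n + 1)} {z : TPow k A (n + 2)}
    (h : inclBar A n y = inclHoch A (n + 1) z) : y = 0 := by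
  refine eq_zero_of_incl_mem_fil (K := (cyclicBicomplexTwo k).obj A)
    (show 1 + n = n + 1 by omega) _ ?_
  have : inclBar A n y ∈ fil ((cyclicBicomplexTwo k).obj A) (n + 1) 1 := by
    rw [h]
    exact incl_mem_fil (show 0 + (n + 1) = n + 1 by omega) (by omega) _
  exact this

/-- The map `inclBar A 0`, as a morphism. -/
def inclBarZero : ModuleCat.of k (TPow k A 1) ⟶ ((CCTwo k).obj A).X 1 :=
  ModuleCat.ofHom (inclBar A 0)

/-- The map `A → Z_1(CC^{2}(A))`. -/
def connectingCycle : ModuleCat.of k (TPow k A 1) ⟶ ((CCTwo k).obj A).cycles 1 :=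
  ((CCTwo k).obj A).liftCycles (inclBarZero A) 0 (by simp)
    (ModuleCat.hom_ext (LinearMap.ext fun y => d_inclBar_zero A y))

theorem connectingCycle_iCycles :
    connectingCycle A ≫ ((CCTwo k).obj A).iCycles 1 = inclBarZero A :=
  HomologicalComplex.liftCycles_i _ _ _ _ _

theorem iCycles_connectingCycle (y : TPow k A 1) :
    ((CCTwo k).obj A).iCycles 1 (connectingCycle A y) = inclBar A 0 y :=
  ConcreteCategory.congr_hom (connectingCycle_iCycles A) y

/-- The map `A → H_1(CC^{2}(A))`. -/
def connectingClass : ModuleCat.of k (TPow k A 1) ⟶ ((CCTwo k).obj A).homology 1 :=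
  connectingCycle A ≫ ((CCTwo k).obj A).homologyπ 1

theorem connectingClass_eq_zero_iff (y : TPow k A 1) :
    connectingClass A y = 0 ↔ ∃ z, ((CCTwo k).obj A).d 2 1 z = inclBar A 0 y := by
  rw [connectingClass, ConcreteCategory.comp_apply, HomologicalComplex.homologyπ_eq_zero_iff,
    iCycles_connectingCycle]

theorem connectingClass_naturality {A B : NUAlg.{u, v} k} (f : A ⟶ B) (y : TPow k A 1) :
    HomologicalComplex.homologyMap ((CCTwo k).map f) 1 (connectingClass A y) =
      connectingClass B (tmap f.hom 1 y) := by
  have h : inclBarZero A ≫ ((CCTwo k).map f).f 1 =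
      ModuleCat.ofHom (tmap f.hom 1) ≫ inclBarZero B :=
    HomologicalComplex₂.ιTotal_map _ _ ((cyclicBicomplexTwo k).map f) (ComplexShape.down ℕ) 1 0 1 rfl
  have h2 : connectingClass A ≫ HomologicalComplex.homologyMap ((CCTwo k).map f) 1 =
      ModuleCat.ofHom (tmap f.hom 1) ≫ connectingClass B := by
    rw [connectingClass, connectingClass, Category.assoc, HomologicalComplex.homologyπ_naturality,
      ← Category.assoc, ← Category.assoc]
    congr 1
    rw [← cancel_mono (HomologicalComplex.iCycles _ _), Category.assoc, Category.assoc,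
      HomologicalComplex.cyclesMap_i, connectingCycle_iCycles, ← Category.assoc,
      connectingCycle_iCycles, h]
  exact ConcreteCategory.congr_hom h2 y

variable {A}

/-- On `A ⊗ A` one has `b = b' (1 + t)` and `(1 - t)(1 + t) = 1 - t^2 = 0`. So the boundary of `(1 +
t) w` in the bar column is `-b w`, with no component in the Hochschild column. This needs no
hypothesis on the characteristic. -/
theorem connectingClass_bHoch (w : TPow k A 2) : connectingClass A (bHoch k A 0 w) = 0 := by
  rw [connectingClass_eq_zero_iff]
  refine ⟨-inclBar A 1 ((1 + cyc k A 1) w), ?_⟩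
  have h1 : (1 - cyc k A 1) ((1 + cyc k A 1) w) = 0 := by
    rw [← Module.End.mul_apply]
    have : (1 - cyc k A 1) * (1 + cyc k A 1) = 1 - cyc k A 1 ^ 2 := by
      rw [sub_mul, mul_add, mul_add, one_mul, one_mul, mul_one, pow_two]
      abel
    rw [this, cyc_pow]
    simp
  have h2 : bHoch k A 0 w = bBar k A 0 ((1 + cyc k A 1) w) := by
    rw [bHoch_apply, bBar_apply, bBar_apply]
    simp
  rw [h2, map_neg, d_inclBar, h1, map_zero, zero_sub, neg_neg]

namespace IsFreeRetract

variable [CharZero k]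

theorem connectingClass_surjective (hA : IsFreeRetract k A) :
    Function.Surjective (connectingClass A) := by
  intro ξ
  obtain ⟨c, rfl⟩ := (ModuleCat.epi_iff_surjective (((CCTwo k).obj A).homologyπ 1)).1
    inferInstance ξ
  obtain ⟨y, x, hx⟩ := exists_eq_inclBar_add_inclHoch A 0 (((CCTwo k).obj A).iCycles 1 c)
  have h0 : ((CCTwo k).obj A).d 1 0 (((CCTwo k).obj A).iCycles 1 c) = 0 := by
    rw [← ConcreteCategory.comp_apply]
    simp
  rw [hx, map_add, d_inclBar_zero, zero_add, d_inclHoch] at h0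
  -- The Hochschild component `x` of a 1-cycle satisfies `b x = 0`. The boundary of `u` and `z`
  -- removes it and leaves `y + b' z` in the bar column.
  obtain ⟨u, z, rfl⟩ := hA.exists_bHoch_one_add_eq x
    (inclHoch_injective 0 (h0.trans (map_zero _).symm))
  refine ⟨y + bBar k A 0 z, ?_⟩
  rw [← sub_eq_zero, connectingClass, ConcreteCategory.comp_apply, ← map_sub,
    HomologicalComplex.homologyπ_eq_zero_iff]
  refine ⟨-(inclHoch A 2 u + inclBar A 1 z), ?_⟩
  rw [map_sub, hx, iCycles_connectingCycle, map_neg, map_add, d_inclHoch, d_inclBar]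
  simp only [map_add]
  abel

theorem exists_of_connectingClass_eq_zero (hA : IsFreeRetract k A) (y : TPow k A 1)
    (hy : connectingClass A y = 0) : ∃ w, bHoch k A 0 w = y := by
  obtain ⟨x, hx⟩ := (connectingClass_eq_zero_iff A y).1 hy
  obtain ⟨z, u, rfl⟩ := exists_eq_inclBar_add_inclHoch A 1 x
  rw [map_add, d_inclBar, d_inclHoch] at hx
  -- Comparison of columns gives `y = -b' z` and `b u + (1 - t) z = 0`, which is the situation of
  -- `exists_bHoch_zero_eq`.
  have h1 : inclBar A 0 (y + bBar k A 0 z) =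
      inclHoch A 1 (bHoch k A 1 u + (1 - cyc k A 1) z) := by
    rw [map_add, map_add, ← hx]
    abel
  have h2 := eq_zero_of_inclBar_eq_inclHoch h1
  rw [h2, map_zero] at h1
  obtain ⟨w, hw⟩ := hA.exists_bHoch_zero_eq u z
    (inclHoch_injective 1 (h1.symm.trans (map_zero _).symm))
  exact ⟨-w, by rw [map_neg, hw, eq_neg_of_add_eq_zero_left h2]⟩

end IsFreeRetract

end ConnectingClass

end Hochschild

namespace Bicomplex

/-! ### Total complexes preserve homotopies in the horizontal direction. -/

section Homotopy

variable {C : Type u} [Category.{v} C] [Preadditive C]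
  {K L : HomologicalComplex₂ C (ComplexShape.down ℕ) (ComplexShape.down ℕ)}
  [K.HasTotal (ComplexShape.down ℕ)] [L.HasTotal (ComplexShape.down ℕ)]
  {f g : K ⟶ L}

/-- The components of `totalHomotopy`. -/
def totalHomotopyHom (h : Homotopy f g) (n : ℕ) :
    (K.total (ComplexShape.down ℕ)).X n ⟶ (L.total (ComplexShape.down ℕ)).X (n + 1) :=
  K.totalDesc fun p q hpq => (h.hom p (p + 1)).f q ≫
    L.ιTotal (ComplexShape.down ℕ) (p + 1) q (n + 1) (by
      change p + q = n at hpq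
      change p + 1 + q = n + 1
      omega)

theorem ι_totalHomotopyHom (h : Homotopy f g) {p q n : ℕ} (hpq : p + q = n) :
    K.ιTotal (ComplexShape.down ℕ) p q n hpq ≫ totalHomotopyHom h n =
      (h.hom p (p + 1)).f q ≫ L.ιTotal (ComplexShape.down ℕ) (p + 1) q (n + 1)
        (show p + 1 + q = n + 1 by omega) := by
  rw [totalHomotopyHom, HomologicalComplex₂.ι_totalDesc]

/-- A homotopy between morphisms of bicomplexes (in the horizontal direction) induces a homotopy
between the morphisms of the total complexes. -/
def totalHomotopy (h : Homotopy f g) :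
    Homotopy (HomologicalComplex₂.total.map f (ComplexShape.down ℕ))
      (HomologicalComplex₂.total.map g (ComplexShape.down ℕ)) where
  hom i := Pi.single (i + 1) (totalHomotopyHom h i)
  zero i j hij := Pi.single_eq_of_ne (Ne.symm hij) _
  comm n := by
    have hc : ∀ p q, (f.f p).f q = (dNext p h.hom + prevD p h.hom + g.f p).f q := fun p q => by
      rw [h.comm p]
    rw [Homotopy.prevD_chainComplex, Pi.single_eq_same]
    refine HomologicalComplex₂.total.hom_ext _ fun p q hpq => ?_
    change p + q = n at hpq
    have e1 : K.ιTotal (ComplexShape.down ℕ) p q n hpq ≫ totalHomotopyHom h n ≫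
        (L.total (ComplexShape.down ℕ)).d (n + 1) n =
        (h.hom p (p + 1)).f q ≫ (L.d₁ (ComplexShape.down ℕ) (p + 1) q n +
          L.d₂ (ComplexShape.down ℕ) (p + 1) q n) := by
      rw [← Category.assoc, ι_totalHomotopyHom, Category.assoc, ι_d]
    rw [Preadditive.comp_add, Preadditive.comp_add, HomologicalComplex₂.ιTotal_map,
      HomologicalComplex₂.ιTotal_map, e1, hc, Homotopy.prevD_chainComplex, d₁_succ hpq]
    rcases n with - | n
    · obtain ⟨rfl, rfl⟩ : p = 0 ∧ q = 0 := by omega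
      rw [Homotopy.dNext_zero_chainComplex, Homotopy.dNext_zero_chainComplex, d₂_zero]
      simp
    · rw [Homotopy.dNext_succ_chainComplex, Pi.single_eq_same, ← Category.assoc, ι_d]
      rcases p with - | p <;> rcases q with - | q
      · omega
      · rw [Homotopy.dNext_zero_chainComplex, d₂_succ (show 0 + q = n by omega),
          d₂_succ (show 0 + 1 + q = n + 1 by omega), d₁_zero]
        simp [ι_totalHomotopyHom]
      · rw [Homotopy.dNext_succ_chainComplex, d₂_zero, d₂_zero, d₁_succ (show p + 0 = n by omega)]
        simp [ι_totalHomotopyHom]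
      · rw [Homotopy.dNext_succ_chainComplex, d₂_succ (show p + 1 + q = n by omega),
          d₂_succ (show p + 1 + 1 + q = n + 1 by omega), d₁_succ (show p + (q + 1) = n by omega)]
        -- The homotopy raises the column index by one and the vertical differential of column `p`
        -- carries `(-1)^p`. The two mixed terms therefore have opposite signs and cancel.
        simp [ι_totalHomotopyHom, pow_succ, Linear.units_smul_comp, Linear.comp_units_smul]
        abel

end Homotopy

/-! ### Bicomplexes concentrated in column zero. -/

section ColumnZero

variable {C : Type u} [Category.{v} C] [Preadditive C]
  (K : HomologicalComplex₂ C (ComplexShape.down ℕ) (ComplexShape.down ℕ))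
  [K.HasTotal (ComplexShape.down ℕ)]

/-- The inclusion of the column of index zero into the total complex. -/
def columnZero : K.X 0 ⟶ K.total (ComplexShape.down ℕ) where
  f n := K.ιTotal (ComplexShape.down ℕ) 0 n n (Nat.zero_add n)
  comm' i j hij := by
    obtain rfl : j + 1 = i := hij
    rw [ι_d, d₁_zero, d₂_succ (Nat.zero_add j)]
    simp

theorem columnZero_naturality {K L : HomologicalComplex₂ C (ComplexShape.down ℕ)
    (ComplexShape.down ℕ)} [K.HasTotal (ComplexShape.down ℕ)] [L.HasTotal (ComplexShape.down ℕ)]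
    (f : K ⟶ L) :
    columnZero K ≫ HomologicalComplex₂.total.map f (ComplexShape.down ℕ) =
      f.f 0 ≫ columnZero L := by
  ext n
  exact HomologicalComplex₂.ιTotal_map _ _ f (ComplexShape.down ℕ) 0 n n (Nat.zero_add n)

/-- The projection of the total complex to the column of index zero. -/
def toColumnZero (n : ℕ) : (K.total (ComplexShape.down ℕ)).X n ⟶ (K.X 0).X n :=
  K.totalDesc fun p q hpq => if hp : p = 0 then
    (K.XXIsoOfEq _ _ _ hp (show q = n by
      change p + q = n at hpq
      omega)).hom else 0

theorem isIso_columnZero (hK : ∀ p, IsZero (K.X (p + 1))) : IsIso (columnZero K) := by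
  have : ∀ n, IsIso ((columnZero K).f n) := fun n => by
    refine ⟨toColumnZero K n, ?_, ?_⟩
    · refine (HomologicalComplex₂.ι_totalDesc _ _ _ _ _).trans ?_
      simp
    · refine HomologicalComplex₂.total.hom_ext _ fun p q hpq => ?_
      change p + q = n at hpq
      rcases p with - | p
      · obtain rfl : q = n := by omega
        rw [toColumnZero, ← Category.assoc, HomologicalComplex₂.ι_totalDesc]
        simp [columnZero]
      · exact ((HomologicalComplex.eval _ _ q).map_isZero (hK p)).eq_of_src _ _
  exact HomologicalComplex.Hom.isIso_of_components _

end ColumnZero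

end Bicomplex

namespace Hochschild

/-! ### Augmented simplicial algebras with an extra degeneracy. -/

section Augmented

variable {k : Type u} [Field k] (Φ : NUAlg.{u, v} k ⥤ ChainComplex (ModuleCat.{max u v} k) ℕ)

/-- The augmentation `Tot Φ(X_*) → Φ(X_{-1})` of an augmented simplicial algebra `X`, where the
target is regarded as the total complex of a bicomplex with one column. -/
def totAugmentation (X : SimplicialObject.Augmented (NUAlg.{u, v} k)) :
    (totSimplicial Φ).obj X.left ⟶
      HomologicalComplex₂.total ((ChainComplex.single₀ _).obj (Φ.obj X.right))
        (ComplexShape.down ℕ) :=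
  HomologicalComplex₂.total.map (AlgebraicTopology.AlternatingFaceMapComplex.ε.app
    (((SimplicialObject.Augmented.whiskering _ _).obj Φ).obj X)) (ComplexShape.down ℕ)

theorem totAugmentation_naturality {X Y : SimplicialObject.Augmented (NUAlg.{u, v} k)}
    (f : X ⟶ Y) : (totSimplicial Φ).map f.left ≫ totAugmentation Φ Y =
      totAugmentation Φ X ≫ HomologicalComplex₂.total.map
        ((ChainComplex.single₀ _).map (Φ.map f.right)) (ComplexShape.down ℕ) := by
  have h := AlgebraicTopology.AlternatingFaceMapComplex.ε.naturality
    (((SimplicialObject.Augmented.whiskering _ _).obj Φ).map f)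
  have h2 := congrArg (fun φ => HomologicalComplex₂.total.map φ (ComplexShape.down ℕ)) h
  rw [HomologicalComplex₂.total.map_comp, HomologicalComplex₂.total.map_comp] at h2
  exact h2

/-- Any functor preserves an extra degeneracy, so `Φ` need not be additive or exact in any sense.
The resulting homotopy equivalence is in the simplicial direction, and `totalHomotopy` carries it to
total complexes. -/
theorem quasiIso_totAugmentation {X : SimplicialObject.Augmented (NUAlg.{u, v} k)}
    (ed : SimplicialObject.Augmented.ExtraDegeneracy X) : QuasiIso (totAugmentation Φ X) := by
  let e := (ed.map Φ).homotopyEquiv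
  let e' : HomotopyEquiv ((totSimplicial Φ).obj X.left)
      (HomologicalComplex₂.total ((ChainComplex.single₀ _).obj (Φ.obj X.right))
        (ComplexShape.down ℕ)) :=
    { hom := HomologicalComplex₂.total.map e.hom (ComplexShape.down ℕ)
      inv := HomologicalComplex₂.total.map e.inv (ComplexShape.down ℕ)
      homotopyHomInvId := (Homotopy.ofEq (HomologicalComplex₂.total.map_comp _ _ _).symm).trans
        ((Bicomplex.totalHomotopy e.homotopyHomInvId).trans
          (Homotopy.ofEq (HomologicalComplex₂.total.map_id _ _)))
      homotopyInvHomId := (Homotopy.ofEq (HomologicalComplex₂.total.map_comp _ _ _).symm).trans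
        ((Bicomplex.totalHomotopy e.homotopyInvHomId).trans
          (Homotopy.ofEq (HomologicalComplex₂.total.map_id _ _))) }
  exact e'.quasiIso_hom

instance isIso_columnZero_single₀ (L : ChainComplex (ModuleCat.{w} k) ℕ) :
    IsIso (Bicomplex.columnZero ((ChainComplex.single₀ (ChainComplex (ModuleCat.{w} k) ℕ)).obj L)) :=
  Bicomplex.isIso_columnZero _ fun p => HomologicalComplex.isZero_single_obj_X _ _ _ _ (by simp)

/-- A complex is the total complex of the bicomplex with this complex as its only column. -/
def totalSingle₀Iso (L : ChainComplex (ModuleCat.{w} k) ℕ) :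
    HomologicalComplex₂.total ((ChainComplex.single₀ (ChainComplex (ModuleCat.{w} k) ℕ)).obj L)
      (ComplexShape.down ℕ) ≅ L :=
  (asIso (Bicomplex.columnZero
    ((ChainComplex.single₀ (ChainComplex (ModuleCat.{w} k) ℕ)).obj L))).symm

theorem totalSingle₀Iso_naturality {L M : ChainComplex (ModuleCat.{w} k) ℕ} (f : L ⟶ M) :
    HomologicalComplex₂.total.map ((ChainComplex.single₀ _).map f) (ComplexShape.down ℕ) ≫
      (totalSingle₀Iso M).hom = (totalSingle₀Iso L).hom ≫ f := by
  have h : (totalSingle₀Iso L).inv ≫ HomologicalComplex₂.total.map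
      ((ChainComplex.single₀ _).map f) (ComplexShape.down ℕ) = f ≫ (totalSingle₀Iso M).inv :=
    (Bicomplex.columnZero_naturality ((ChainComplex.single₀ _).map f)).trans (by
      rw [ChainComplex.single₀_map_f_zero]
      rfl)
  rw [← Iso.inv_comp_eq, reassoc_of% h, Iso.inv_hom_id, Category.comp_id]

/-- For an augmented simplicial algebra with an extra degeneracy, `Tot Φ(X_*)` and `Φ(X_{-1})`
have the same homology. -/
def totHomologyIso {X : SimplicialObject.Augmented (NUAlg.{u, v} k)}
    (ed : SimplicialObject.Augmented.ExtraDegeneracy X) (n : ℕ) :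
    ((totSimplicial Φ).obj X.left).homology n ≅ (Φ.obj X.right).homology n :=
  have := quasiIso_totAugmentation Φ ed
  isoOfQuasiIsoAt (totAugmentation Φ X) n ≪≫
    HomologicalComplex.homologyMapIso (totalSingle₀Iso (Φ.obj X.right)) n

theorem totHomologyIso_naturality {X Y : SimplicialObject.Augmented (NUAlg.{u, v} k)}
    (ed : SimplicialObject.Augmented.ExtraDegeneracy X)
    (ed' : SimplicialObject.Augmented.ExtraDegeneracy Y) (f : X ⟶ Y) (n : ℕ) :
    HomologicalComplex.homologyMap ((totSimplicial Φ).map f.left) n ≫ (totHomologyIso Φ ed' n).hom =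
      (totHomologyIso Φ ed n).hom ≫ HomologicalComplex.homologyMap (Φ.map f.right) n := by
  have h1 := congrArg (fun φ => HomologicalComplex.homologyMap φ n)
    (totalSingle₀Iso_naturality (Φ.map f.right))
  have h2 := congrArg (fun φ => HomologicalComplex.homologyMap φ n) (totAugmentation_naturality Φ f)
  simp only [HomologicalComplex.homologyMap_comp] at h1 h2
  simp only [totHomologyIso, Iso.trans_hom, isoOfQuasiIsoAt_hom,
    HomologicalComplex.homologyMapIso_hom, Category.assoc]
  rw [reassoc_of% h2, h1]

end Augmented

end Hochschild

/-! ### Contractions of crossed modules and the extra degeneracy of the nerve. -/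

namespace XMod

variable {k : Type u} [Field k]

/-- A deformation retraction of a crossed module `(R, A, ρ)` with injective `ρ` to the algebra
`Q`: a homomorphism `A → Q` that vanishes on the image of `ρ`, with a section `s` and a linear map
`c : A → R` that lifts the difference of `s p` and the identity. -/
structure Contraction (X : XMod.{u, v} k) where
  Q : NUAlg.{u, v} k
  p : X.A →ₙₐ[k] Q
  s : Q →ₙₐ[k] X.A
  c : X.A →ₗ[k] X.R
  p_s : ∀ b, p (s b) = b
  p_ρ : ∀ r, p (X.ρ r) = 0
  ρ_c : ∀ a, X.ρ (c a) = s (p a) - a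
  ρ_injective : Function.Injective X.ρ

namespace Nerve

variable {X : XMod.{u, v} k} {n m : ℕ}

/-- The vertices of a simplex of the nerve. -/
def vertex (j : Fin (n + 1)) : X.Nerve n →ₙₐ[k] X.A where
  toFun x := X.ρ (tail j x) + x.2
  map_smul' c x := by
    rw [map_smul, map_smul, smul_snd, MonoidHom.id_apply, smul_add]
  map_zero' := by
    rw [map_zero, map_zero, zero_add]
    rfl
  map_add' x y := by
    rw [map_add, map_add, add_snd]
    abel
  map_mul' x y := by
    rw [tail_mul, mul_snd]
    simp only [map_add, map_mul, X.ρ_la, X.ρ_ra, mul_add, add_mul]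
    abel

theorem vertex_apply (j : Fin (n + 1)) (x : X.Nerve n) : vertex j x = X.ρ (tail j x) + x.2 := rfl

theorem vertex_last (x : X.Nerve n) : vertex (Fin.last n) x = x.2 := by
  rw [vertex_apply, tail_of_le _ _ (by simp), map_zero, zero_add]

theorem vertex_mapHom (θ : Fin (m + 1) →o Fin (n + 1)) (x : X.Nerve n) (j : Fin (m + 1)) :
    vertex j (mapHom θ x) = vertex (θ j) x := by
  rw [vertex_apply, mapHom_apply, tail_mapFun]
  change _ + (X.ρ (tail (θ (Fin.last m)) x) + x.2) = X.ρ (tail (θ j) x) + x.2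
  rw [map_sub]
  abel

/-- If `ρ` is injective, the internal category has at most one arrow between two objects. This
reduces all identities in the nerve below to vertices. In particular it makes `prepend`
multiplicative although `c` is only linear, because the new vertex depends on `a` through the
homomorphism `s p`. -/
theorem ext_vertex (hρ : Function.Injective X.ρ) {x y : X.Nerve n}
    (h : ∀ j, vertex j x = vertex j y) : x = y := by
  have h2 : x.2 = y.2 := by rw [← vertex_last, h, vertex_last]
  refine emb_injective (funext fun j => AlgAction.SemiDirect.ext ?_ h2)
  have := h j
  rw [vertex_apply, vertex_apply, h2] at this
  exact hρ (add_right_cancel this)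

end Nerve

namespace Contraction

variable {X : XMod.{u, v} k} (D : X.Contraction) {n : ℕ}

theorem p_vertex (j : Fin (n + 1)) (x : X.Nerve n) : D.p (Nerve.vertex j x) = D.p x.2 := by
  rw [Nerve.vertex_apply, map_add, D.p_ρ, zero_add]

/-- Add a new first vertex to a simplex of the nerve. -/
def prependFun (x : X.Nerve n) : X.Nerve (n + 1) :=
  -- The new arrow is chosen so that all arrows add up to `c(a)`. The new vertex is then `ρ(c(a)) +
  -- a = s(p(a))`.
  (Fin.cons (D.c x.2 - Nerve.tail 0 x) x.1, x.2)

theorem tail_succ_prependFun (x : X.Nerve n) (j : ℕ) :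
    Nerve.tail (j + 1) (D.prependFun x) = Nerve.tail j x := by
  change ∑ i : Fin (n + 1), (if j + 1 ≤ (i : ℕ) then _ else 0) =
    ∑ i : Fin n, (if j ≤ (i : ℕ) then _ else 0)
  rw [Fin.sum_univ_succ]
  simp [prependFun]

theorem tail_zero_prependFun (x : X.Nerve n) :
    Nerve.tail 0 (D.prependFun x) = D.c x.2 := by
  have h := Nerve.tail_eq (D.prependFun x) 0
  rw [Fin.val_zero, tail_succ_prependFun] at h
  rw [h]
  change D.c x.2 - Nerve.tail 0 x + Nerve.tail 0 x = D.c x.2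
  abel

theorem vertex_zero_prependFun (x : X.Nerve n) :
    Nerve.vertex 0 (D.prependFun x) = D.s (D.p x.2) := by
  rw [Nerve.vertex_apply, Fin.val_zero, tail_zero_prependFun, D.ρ_c]
  exact sub_add_cancel _ _

theorem vertex_succ_prependFun (x : X.Nerve n) (j : Fin (n + 1)) :
    Nerve.vertex j.succ (D.prependFun x) = Nerve.vertex j x := by
  rw [Nerve.vertex_apply, Fin.val_succ, tail_succ_prependFun]
  rfl

/-- The homomorphism of nerves that adds a new first vertex. -/
def prepend (n : ℕ) : X.Nerve n →ₙₐ[k] X.Nerve (n + 1) where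
  toFun := D.prependFun
  map_smul' c x := Nerve.ext_vertex D.ρ_injective fun j => by
    rw [map_smul, MonoidHom.id_apply]
    induction j using Fin.cases with
    | zero =>
      rw [vertex_zero_prependFun, vertex_zero_prependFun, Nerve.smul_snd, map_smul, map_smul]
    | succ j => rw [vertex_succ_prependFun, vertex_succ_prependFun, map_smul]
  map_zero' := Nerve.ext_vertex D.ρ_injective fun j => by
    rw [map_zero]
    induction j using Fin.cases with
    | zero =>
      rw [vertex_zero_prependFun]
      exact (congrArg D.s (map_zero D.p)).trans (map_zero D.s)
    | succ j => rw [vertex_succ_prependFun, map_zero]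
  map_add' x y := Nerve.ext_vertex D.ρ_injective fun j => by
    rw [map_add]
    induction j using Fin.cases with
    | zero =>
      rw [vertex_zero_prependFun, vertex_zero_prependFun, vertex_zero_prependFun, Nerve.add_snd,
        map_add, map_add]
    | succ j =>
      rw [vertex_succ_prependFun, vertex_succ_prependFun, vertex_succ_prependFun, map_add]
  map_mul' x y := Nerve.ext_vertex D.ρ_injective fun j => by
    rw [map_mul]
    induction j using Fin.cases with
    | zero =>
      rw [vertex_zero_prependFun, vertex_zero_prependFun, vertex_zero_prependFun, Nerve.mul_snd,
        map_mul, map_mul]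
    | succ j =>
      rw [vertex_succ_prependFun, vertex_succ_prependFun, vertex_succ_prependFun, map_mul]

theorem vertex_zero_prepend (x : X.Nerve n) :
    Nerve.vertex 0 (D.prepend n x) = D.s (D.p x.2) := D.vertex_zero_prependFun x

theorem vertex_succ_prepend (x : X.Nerve n) (j : Fin (n + 1)) :
    Nerve.vertex j.succ (D.prepend n x) = Nerve.vertex j x := D.vertex_succ_prependFun x j

theorem p_mapHom_snd {m : ℕ} (θ : Fin (m + 1) →o Fin (n + 1)) (x : X.Nerve n) :
    D.p (Nerve.mapHom θ x).2 = D.p x.2 := by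
  rw [← Nerve.vertex_last, Nerve.vertex_mapHom, p_vertex]

/-- The map `θ'` is `θ` with a new least element adjoined. The new vertex is preserved because all
vertices of a simplex have the same image in `Q`. This covers the face and the degeneracy identities
of an extra degeneracy at once. -/
theorem mapHom_prepend {m : ℕ} (θ : Fin (m + 1) →o Fin (n + 1))
    (θ' : Fin (m + 2) →o Fin (n + 2)) (h0 : θ' 0 = 0) (h : ∀ j : Fin (m + 1), θ' j.succ = (θ j).succ)
    (x : X.Nerve n) : Nerve.mapHom θ' (D.prepend n x) = D.prepend m (Nerve.mapHom θ x) :=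
  Nerve.ext_vertex D.ρ_injective fun j => by
    rw [Nerve.vertex_mapHom]
    induction j using Fin.cases with
    | zero => rw [h0, vertex_zero_prepend, vertex_zero_prepend, p_mapHom_snd]
    | succ j => rw [h, vertex_succ_prepend, vertex_succ_prepend, Nerve.vertex_mapHom]

/-- The homomorphism that sends a simplex of the nerve to the common image of its vertices in
`Q`. -/
def augmentation (n : ℕ) : X.Nerve n →ₙₐ[k] D.Q :=
  D.p.comp (Nerve.vertex (Fin.last n))

theorem augmentation_apply (x : X.Nerve n) : D.augmentation n x = D.p x.2 := by
  rw [augmentation, NonUnitalAlgHom.comp_apply, Nerve.vertex_last]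

theorem augmentation_mapHom {m : ℕ} (θ : Fin (m + 1) →o Fin (n + 1)) (x : X.Nerve n) :
    D.augmentation m (Nerve.mapHom θ x) = D.augmentation n x := by
  rw [augmentation_apply, augmentation_apply, p_mapHom_snd]

/-- The augmented simplicial algebra `𝔑_*(R, A, ρ) → Q`. -/
def augmented : SimplicialObject.Augmented (NUAlg.{u, v} k) where
  left := (nerve k).obj X
  right := D.Q
  hom :=
    { app := fun Δ => ⟨D.augmentation Δ.unop.len⟩
      naturality := fun _ _ f => NUAlg.Hom.ext (NonUnitalAlgHom.ext fun x =>
        D.augmentation_mapHom f.unop.toOrderHom x) }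

/-- The algebra `A` as the algebra of zero-simplices of the nerve. -/
def constHom : D.Q →ₙₐ[k] X.Nerve 0 where
  toFun b := (Fin.elim0, D.s b)
  map_smul' c b := Nerve.ext (fun i => i.elim0) (map_smul D.s c b)
  map_zero' := Nerve.ext (fun i => i.elim0) (map_zero D.s)
  map_add' b b' := Nerve.ext (fun i => i.elim0) (map_add D.s b b')
  map_mul' b b' := Nerve.ext (fun i => i.elim0) (map_mul D.s b b')

theorem vertex_constHom (b : D.Q) (j : Fin 1) : Nerve.vertex j (D.constHom b) = D.s b := by
  obtain rfl : j = Fin.last 0 := Subsingleton.elim _ _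
  rw [Nerve.vertex_last]
  rfl

/-- The extra degeneracy of the augmented nerve. -/
def extraDegeneracy : SimplicialObject.Augmented.ExtraDegeneracy D.augmented where
  s' := ⟨D.constHom⟩
  s n := ⟨D.prepend n⟩
  s'_comp_ε := NUAlg.Hom.ext (NonUnitalAlgHom.ext fun b =>
    (D.augmentation_apply (D.constHom b)).trans (D.p_s b))
  s₀_comp_δ₁ := NUAlg.Hom.ext (NonUnitalAlgHom.ext fun x =>
    Nerve.ext_vertex D.ρ_injective fun (j : Fin 1) => by
      obtain rfl : j = 0 := Subsingleton.elim _ _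
      refine (Nerve.vertex_mapHom _ _ _).trans ?_
      refine (D.vertex_zero_prepend x).trans ?_
      refine Eq.trans ?_ (D.vertex_constHom _ _).symm
      exact congrArg D.s (D.augmentation_apply x).symm)
  s_comp_δ₀ n := NUAlg.Hom.ext (NonUnitalAlgHom.ext fun x =>
    Nerve.ext_vertex D.ρ_injective fun (j : Fin (n + 1)) => by
      refine (Nerve.vertex_mapHom _ _ _).trans ?_
      exact D.vertex_succ_prepend x j)
  s_comp_δ n i := NUAlg.Hom.ext (NonUnitalAlgHom.ext fun x =>
    D.mapHom_prepend (SimplexCategory.δ i).toOrderHom (SimplexCategory.δ i.succ).toOrderHom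
      (Fin.succ_succAbove_zero i) (fun j => Fin.succ_succAbove_succ i j) x)
  s_comp_σ n i := NUAlg.Hom.ext (NonUnitalAlgHom.ext fun x =>
    D.mapHom_prepend (SimplexCategory.σ i).toOrderHom (SimplexCategory.σ i.succ).toOrderHom
      (Fin.predAbove_right_zero (i := i.succ)) (fun j => Fin.succ_predAbove_succ i j) x)

end Contraction

/-- The contraction of `(0, A, 0)` to `A`. -/
def contractionOfAlg (A : NUAlg.{u, v} k) : (ofAlg A).Contraction where
  Q := A
  p := NonUnitalAlgHom.id k A
  s := NonUnitalAlgHom.id k A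
  c := 0
  p_s _ := rfl
  p_ρ _ := rfl
  ρ_c _ := (sub_self _).symm
  ρ_injective _ _ _ := rfl

namespace Contraction

variable {X : XMod.{u, v} k} (D : X.Contraction)

/-- The morphism of augmented nerves induced by `(0, A, 0) ⟶ (R, A, ρ)`. -/
def ofBaseAugmented : (contractionOfAlg X.A).augmented ⟶ D.augmented where
  left := (nerve k).map X.ofBase
  right := ⟨D.p⟩
  w := by
    ext Δ : 2
    refine NUAlg.Hom.ext (NonUnitalAlgHom.ext fun x => ?_)
    exact (D.augmentation_apply _).trans
      (congrArg D.p ((contractionOfAlg X.A).augmentation_apply x).symm)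

variable (Φ : NUAlg.{u, v} k ⥤ ChainComplex (ModuleCat.{max u v} k) ℕ)

/-- `H_n(Φ(R, A, ρ)) = H_n(Φ(Q))`. -/
def homologyIso (n : ℕ) : ((tot Φ).obj X).homology n ≅ (Φ.obj D.Q).homology n :=
  Hochschild.totHomologyIso Φ D.extraDegeneracy n

/-- `H_n(Φ(0, A, 0)) = H_n(Φ(A))`. -/
def _root_.XMod.ofAlgHomologyIso (A : NUAlg.{u, v} k) (n : ℕ) :
    ((tot Φ).obj (ofAlg A)).homology n ≅ (Φ.obj A).homology n :=
  (contractionOfAlg A).homologyIso Φ n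

/-- The homomorphism `p`, as a morphism of algebras. -/
def baseHom : X.A ⟶ D.Q := ⟨D.p⟩

/-- The vanishing statements use only the homology groups. For `H_2(β)` the map itself is needed: it
becomes the one that `p : A → Q` induces. -/
theorem homologyIso_naturality (n : ℕ) :
    HomologicalComplex.homologyMap ((tot Φ).map X.ofBase) n ≫ (D.homologyIso Φ n).hom =
      (ofAlgHomologyIso Φ X.A n).hom ≫ HomologicalComplex.homologyMap (Φ.map D.baseHom) n :=
  Hochschild.totHomologyIso_naturality Φ (contractionOfAlg X.A).extraDegeneracy
    D.extraDegeneracy D.ofBaseAugmented n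

end Contraction

end XMod

namespace XMod

open Hochschild

/-! ### Consequences of a section of the counit. -/

section ProjectiveClass

variable {k : Type u} [Field k] {X : XMod.{u, v} k}

/-- The free algebra on `R × A`. -/
abbrev freeBase (X : XMod.{u, v} k) : NUAlg.{u, max u v} k := ⟨FreeAlg k (X.R × X.A)⟩

/-- The retraction `p_2` of the base of the free crossed module on `R × A`. -/
def cotripleRetraction (X : XMod.{u, v} k) : X.cotriple.A →ₙₐ[k] X.freeBase :=
  retraction X.freeBase

/-- The inclusion `u_2` to the base of the free crossed module on `R × A`. -/
def cotripleInr (X : XMod.{u, v} k) : X.freeBase →ₙₐ[k] X.cotriple.A :=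
  AlgCoprod.inr k X.freeBase X.freeBase

theorem cotripleRetraction_inr (b : X.freeBase) :
    X.cotripleRetraction (X.cotripleInr b) = b := AlgCoprod.lift_inr _ _ _

theorem cotripleRetraction_ρ (r : X.cotriple.R) :
    X.cotripleRetraction (X.cotriple.ρ r) = 0 := r.2

theorem cotriple_ρ_injective : Function.Injective X.cotriple.ρ := Subtype.val_injective

/-- The idempotent `u_2 p_2` of the base of the free crossed module on `R × A`. -/
def secondFactor (X : XMod.{u, v} k) : X.cotriple.A →ₙₐ[k] X.cotriple.A :=
  X.cotripleInr.comp X.cotripleRetraction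

theorem secondFactor_ρ (r : X.cotriple.R) : X.secondFactor (X.cotriple.ρ r) = 0 := by
  rw [secondFactor, NonUnitalAlgHom.comp_apply, cotripleRetraction_ρ, map_zero]

theorem cotripleRetraction_secondFactor_sub (x : X.cotriple.A) :
    X.cotripleRetraction (X.secondFactor x - x) = 0 := by
  rw [map_sub, secondFactor, NonUnitalAlgHom.comp_apply, cotripleRetraction_inr, sub_self]

/-- The lift of `u_2(p_2(x)) - x` to the kernel of `p_2`. -/
def secondFactorSubFun (X : XMod.{u, v} k) (x : X.cotriple.A) : X.cotriple.R :=
  ⟨X.secondFactor x - x, cotripleRetraction_secondFactor_sub x⟩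

theorem ρ_secondFactorSubFun (x : X.cotriple.A) :
    X.cotriple.ρ (X.secondFactorSubFun x) = X.secondFactor x - x := rfl

/-- The linear map `x ↦ u_2(p_2(x)) - x` to the kernel of `p_2`. -/
def secondFactorSub (X : XMod.{u, v} k) : X.cotriple.A →ₗ[k] X.cotriple.R where
  toFun := X.secondFactorSubFun
  map_add' x y := cotriple_ρ_injective (by
    rw [map_add, ρ_secondFactorSubFun, ρ_secondFactorSubFun, ρ_secondFactorSubFun, map_add]
    abel)
  map_smul' c x := cotriple_ρ_injective (by
    rw [map_smul, ρ_secondFactorSubFun, ρ_secondFactorSubFun, map_smul, smul_sub,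
      RingHom.id_apply])

theorem ρ_secondFactorSub (x : X.cotriple.A) :
    X.cotriple.ρ (X.secondFactorSub x) = X.secondFactor x - x := rfl

theorem secondFactorSub_ρ (r : X.cotriple.R) :
    X.secondFactorSub (X.cotriple.ρ r) = -r := cotriple_ρ_injective (by
  rw [ρ_secondFactorSub, secondFactor_ρ, zero_sub, map_neg])

variable (θ : Hom X X.cotriple)

/-- The endomorphism of `A` induced by the idempotent `secondFactor`. -/
def transported : X.A →ₙₐ[k] X.A := X.counit.ν.comp (X.secondFactor.comp θ.ν)

theorem transported_ρ (r : X.R) : transported θ (X.ρ r) = 0 := by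
  rw [transported, NonUnitalAlgHom.comp_apply, NonUnitalAlgHom.comp_apply, ← θ.comm,
    secondFactor_ρ, map_zero]

/-- The linear map `A → R` induced by `secondFactorSub`. -/
def transportedLift : X.A →ₗ[k] X.R :=
  (X.counit.μ : X.cotriple.R →ₗ[k] X.R) ∘ₗ X.secondFactorSub ∘ₗ (θ.ν : X.A →ₗ[k] X.cotriple.A)

variable {θ}

theorem ρ_transportedLift (hθ : X.counit.comp θ = Hom.id X) (a : X.A) :
    X.ρ (transportedLift θ a) = transported θ a - a := by
  have h : X.counit.ν (θ.ν a) = a := NonUnitalAlgHom.congr_fun (congrArg Hom.ν hθ) a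
  refine (X.counit.comm _).trans ?_
  change X.counit.ν (X.cotriple.ρ (X.secondFactorSub (θ.ν a))) = _
  rw [ρ_secondFactorSub, map_sub, h]
  rfl

/-- On `ker p_2` the idempotent `u_2 p_2` is zero, so `u_2 p_2 - 1` is `-1` there, and `τ θ = 1`
transports this to `R`. The injectivity of `ρ` follows. -/
theorem transportedLift_ρ (hθ : X.counit.comp θ = Hom.id X) (r : X.R) :
    transportedLift θ (X.ρ r) = -r := by
  have h : X.counit.μ (θ.μ r) = r := NonUnitalAlgHom.congr_fun (congrArg Hom.μ hθ) r
  change X.counit.μ (X.secondFactorSub (θ.ν (X.ρ r))) = -r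
  rw [← θ.comm, secondFactorSub_ρ, map_neg, h]

/-- A crossed module in the projective class contracts to an algebra. -/
def contractionOfSection (hθ : X.counit.comp θ = Hom.id X) : X.Contraction where
  Q := ⟨NonUnitalAlgHom.range (transported θ)⟩
  p := NonUnitalAlgHom.codRestrict (transported θ) _ fun a => ⟨a, rfl⟩
  s := NonUnitalSubalgebraClass.subtype _
  c := transportedLift θ
  p_s := by
    rintro ⟨_, a, rfl⟩
    refine Subtype.ext ?_
    change transported θ (transported θ a) = transported θ a
    -- The difference `φ(a) - a` lies in the image of `ρ`, which `φ` kills; so `φ` is idempotent.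
    rw [← sub_eq_zero, ← map_sub, ← ρ_transportedLift hθ, transported_ρ]
  p_ρ r := Subtype.ext (transported_ρ θ r)
  ρ_c a := ρ_transportedLift hθ a
  ρ_injective := by
    refine (injective_iff_map_eq_zero _).2 fun r hr => ?_
    rw [← neg_eq_zero, ← transportedLift_ρ hθ, hr, map_zero]

/-- The base of a crossed module in the projective class is a retract of a free algebra. -/
theorem isFreeRetract_of_section (hθ : X.counit.comp θ = Hom.id X) : IsFreeRetract k X.A := by
  let ε : WordAlg k X.A →ₙₐ[k] X.A := MonoidAlgebra.liftMagma k (FreeSemigroup.lift id)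
  have hε : ∀ a, ε (word k (FreeSemigroup.of a)) = a := fun a => by
    simp [ε, word]
  obtain ⟨σ, hσ⟩ := LinearMap.exists_rightInverse_of_surjective
    (ε : WordAlg k X.A →ₗ[k] X.A) (LinearMap.range_eq_top.2 fun a => ⟨_, hε a⟩)
  have hσ' : ∀ a, ε (σ a) = a := fun a => LinearMap.congr_fun hσ a
  -- By freeness of `T(V) ∗ T(V)`, the base part of the counit factors through the surjection `ε`
  -- from a free algebra, with `σ` choosing lifts of the generators. Then `ε g θ = 1` exhibits `A`
  -- as a retract, and no free generators of the coproduct are needed.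
  let g : X.cotriple.A →ₙₐ[k] WordAlg k X.A := AlgCoprod.lift
    (FreeAlg.lift (σ ∘ₗ (X.ρ : X.R →ₗ[k] X.A) ∘ₗ LinearMap.fst k X.R X.A))
    (FreeAlg.lift (σ ∘ₗ LinearMap.snd k X.R X.A))
  have hg : ε.comp g = X.counit.ν := by
    have h1 : ε.comp (FreeAlg.lift (σ ∘ₗ (X.ρ : X.R →ₗ[k] X.A) ∘ₗ LinearMap.fst k X.R X.A)) =
        X.ρ.comp (FreeAlg.lift (LinearMap.fst k X.R X.A)) := FreeAlg.hom_ext fun v => by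
      rw [NonUnitalAlgHom.comp_apply, NonUnitalAlgHom.comp_apply, FreeAlg.lift_ι, FreeAlg.lift_ι]
      exact hσ' _
    have h2 : ε.comp (FreeAlg.lift (σ ∘ₗ LinearMap.snd k X.R X.A)) =
        FreeAlg.lift (LinearMap.snd k X.R X.A) := FreeAlg.hom_ext fun v => by
      rw [NonUnitalAlgHom.comp_apply, FreeAlg.lift_ι, FreeAlg.lift_ι]
      exact hσ' _
    refine AlgCoprod.hom_ext (fun a => ?_) (fun a => ?_)
    · refine (congrArg ε (AlgCoprod.lift_inl _ _ a)).trans ?_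
      exact (NonUnitalAlgHom.congr_fun h1 a).trans (AlgCoprod.lift_inl _ _ a).symm
    · refine (congrArg ε (AlgCoprod.lift_inr _ _ a)).trans ?_
      exact (NonUnitalAlgHom.congr_fun h2 a).trans (AlgCoprod.lift_inr _ _ a).symm
  refine ⟨X.A, g.comp θ.ν, ε, fun a => ?_⟩
  exact (NonUnitalAlgHom.congr_fun hg (θ.ν a)).trans
    (NonUnitalAlgHom.congr_fun (congrArg Hom.ν hθ) a)

end ProjectiveClass

end XMod

namespace XMod

open Hochschild

/-! ### The long exact sequence of the cokernel. -/

section Cokernel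

variable {k : Type u} [Field k] (X : XMod.{u, v} k)
  (Φ : NUAlg.{u, v} k ⥤ ChainComplex (ModuleCat.{max u v} k) ℕ)

/-- The last vertex, as a homomorphism of nerves `𝔑_n(R, A, ρ) → 𝔑_n(0, A, 0)`. -/
def nerveRetraction (n : ℕ) : X.Nerve n →ₙₐ[k] (ofAlg X.A).Nerve n where
  toFun x := (fun _ => PUnit.unit, x.2)
  map_smul' _ _ := rfl
  map_zero' := rfl
  map_add' _ _ := rfl
  map_mul' _ _ := rfl

/-- The homomorphism `nerveRetraction`, as a morphism of algebras. -/
def nerveRetractionHom (n : ℕ) :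
    ((nerve k).obj X).obj (Opposite.op (SimplexCategory.mk n)) ⟶
      ((nerve k).obj (ofAlg X.A)).obj (Opposite.op (SimplexCategory.mk n)) :=
  ⟨X.nerveRetraction n⟩

theorem nerve_map_ofBase_comp (n : ℕ) :
    ((nerve k).map X.ofBase).app (Opposite.op (SimplexCategory.mk n)) ≫
      X.nerveRetractionHom n = 𝟙 _ := rfl

/-- The bicomplex `Φ(𝔑_*(R, A, ρ))`. -/
abbrev nerveBicomplex : HomologicalComplex₂ (ModuleCat.{max u v} k) (ComplexShape.down ℕ)
    (ComplexShape.down ℕ) :=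
  (AlgebraicTopology.alternatingFaceMapComplex _).obj
    (((SimplicialObject.whiskering _ _).obj Φ).obj ((nerve k).obj X))

/-- A retraction of `Φ(0, A, 0) → Φ(R, A, ρ)` in each degree. -/
def totRetraction (n : ℕ) : ((tot Φ).obj X).X n ⟶ ((tot Φ).obj (ofAlg X.A)).X n :=
  HomologicalComplex₂.totalDesc (nerveBicomplex X Φ) fun p q h =>
    (Φ.map (X.nerveRetractionHom p)).f q ≫
      HomologicalComplex₂.ιTotal (nerveBicomplex (ofAlg X.A) Φ) (ComplexShape.down ℕ) p q n h

theorem tot_map_ofBase_comp_totRetraction (n : ℕ) :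
    ((tot Φ).map X.ofBase).f n ≫ X.totRetraction Φ n = 𝟙 _ := by
  refine HomologicalComplex₂.total.hom_ext (K := nerveBicomplex (ofAlg X.A) Φ) _ fun p q h => ?_
  have h1 := HomologicalComplex₂.ιTotal_map (nerveBicomplex (ofAlg X.A) Φ) (nerveBicomplex X Φ)
    ((AlgebraicTopology.alternatingFaceMapComplex _).map
      (((SimplicialObject.whiskering _ _).obj Φ).map ((nerve k).map X.ofBase)))
    (ComplexShape.down ℕ) p q n h
  refine (Category.assoc _ _ _).symm.trans ?_
  refine (congrArg (· ≫ X.totRetraction Φ n) h1).trans ?_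
  refine (Category.assoc _ _ _).trans ?_
  refine (congrArg (_ ≫ ·) (HomologicalComplex₂.ι_totalDesc _ _ _ _ _)).trans ?_
  refine (Category.assoc _ _ _).symm.trans ?_
  have h2 : (Φ.map (((nerve k).map X.ofBase).app (Opposite.op (SimplexCategory.mk p)))).f q ≫
      (Φ.map (X.nerveRetractionHom p)).f q = 𝟙 _ := by
    have := congrArg (fun f => (Φ.map f).f q) (X.nerve_map_ofBase_comp p)
    rw [Φ.map_comp, Φ.map_id] at this
    exact this
  refine (congrArg (· ≫ _) h2).trans ?_
  exact (Category.id_comp _).trans (Category.comp_id _).symm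

/-- A degreewise retraction suffices. The last vertex is not a simplicial map, since the last face
changes it, so the splitting is not claimed for the complexes. -/
instance mono_tot_map_ofBase : Mono ((tot Φ).map X.ofBase) := by
  have : ∀ n, Mono (((tot Φ).map X.ofBase).f n) := fun n =>
    (SplitMono.mk _ (X.tot_map_ofBase_comp_totRetraction Φ n)).mono
  exact HomologicalComplex.mono_of_mono_f _ this

/-- The short exact sequence of `Φ(0, A, 0) → Φ(R, A, ρ)` and its cokernel. -/
def cokernelSequence : ShortComplex (ChainComplex (ModuleCat.{max u v} k) ℕ) :=
  ShortComplex.mk ((tot Φ).map X.ofBase) (cokernel.π ((tot Φ).map X.ofBase)) (by simp)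

theorem shortExact_cokernelSequence : (X.cokernelSequence Φ).ShortExact where
  exact := ShortComplex.exact_cokernel _
  mono_f := X.mono_tot_map_ofBase Φ
  epi_g := by
    dsimp only [cokernelSequence]
    infer_instance

variable {X} (D : X.Contraction)

theorem Contraction.isZero_homology_cokernel (n : ℕ)
    (hQ : IsZero ((Φ.obj D.Q).homology (n + 1))) (hA : IsZero ((Φ.obj X.A).homology n)) :
    IsZero ((cokernel ((tot Φ).map X.ofBase)).homology (n + 1)) :=
  ((X.shortExact_cokernelSequence Φ).homology_exact₃ (n + 1) n rfl).isZero_of_both_zeros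
    ((hQ.of_iso (D.homologyIso Φ (n + 1))).eq_zero_of_src _)
    ((hA.of_iso (ofAlgHomologyIso Φ X.A n)).eq_zero_of_tgt _)

/-- The homology of the cokernel is the kernel of the map in homology one degree below, if
`H_{n+1}(Φ(Q))` vanishes. -/
theorem Contraction.exists_injective_range_eq_ker (n : ℕ)
    (hQ : IsZero ((Φ.obj D.Q).homology (n + 1))) :
    ∃ δ : (cokernel ((tot Φ).map X.ofBase)).homology (n + 1) →ₗ[k] (Φ.obj X.A).homology n,
      Function.Injective δ ∧ LinearMap.range δ =
        LinearMap.ker (HomologicalComplex.homologyMap (Φ.map D.baseHom) n).hom := by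
  have hS := X.shortExact_cokernelSequence Φ
  let e := ofAlgHomologyIso Φ X.A n
  refine ⟨(hS.δ (n + 1) n rfl ≫ e.hom).hom, ?_, ?_⟩
  -- The preceding map of the long exact sequence starts at `H_{n+1}(Φ(Q)) = 0`.
  · have h1 : Mono (hS.δ (n + 1) n rfl) := (hS.homology_exact₃ (n + 1) n rfl).mono_g
      ((hQ.of_iso (D.homologyIso Φ (n + 1))).eq_zero_of_src _)
    have h2 : Mono (hS.δ (n + 1) n rfl ≫ e.hom) :=
      @mono_comp _ _ _ _ _ _ h1 _ (inferInstanceAs (Mono (ofAlgHomologyIso Φ X.A n).hom))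
    exact (ModuleCat.mono_iff_injective _).1 h2
  · have hex := (ShortComplex.moduleCat_exact_iff _).1 (hS.homology_exact₁ (n + 1) n rfl)
    have hnat := D.homologyIso_naturality Φ n
    have hf : ∀ x : ((tot Φ).obj (ofAlg X.A)).homology n,
        HomologicalComplex.homologyMap ((tot Φ).map X.ofBase) n x = 0 ↔
        HomologicalComplex.homologyMap (Φ.map D.baseHom) n (e.hom x) = 0 := fun x => by
      have h := ConcreteCategory.congr_hom hnat x
      rw [ConcreteCategory.comp_apply, ConcreteCategory.comp_apply] at h
      have hinj : Function.Injective (D.homologyIso Φ n).hom :=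
        (ModuleCat.mono_iff_injective _).1 inferInstance
      constructor
      · intro h0
        rw [h0, map_zero] at h
        exact h.symm
      · intro h0
        exact hinj ((h.trans h0).trans (map_zero _).symm)
    ext y
    constructor
    · rintro ⟨x, rfl⟩
      exact (hf _).1 (ConcreteCategory.congr_hom (hS.δ_comp (n + 1) n rfl) x)
    · intro hy
      obtain ⟨z, rfl⟩ := (ModuleCat.epi_iff_surjective e.hom).1 inferInstance y
      obtain ⟨x, hx⟩ := hex z ((hf z).2 hy)
      exact ⟨x, congrArg e.hom hx⟩

end Cokernel

end XMod

/-! ### Identification of `A^{⊗ 1}` with `A`. -/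

namespace Hochschild

variable {k : Type u} [Field k] {A : Type v} [NonUnitalRing A] [Module k A]

/-- The identification of `A` with `A^{⊗ 1}`. -/
def tpowOne (k : Type u) [Field k] (A : Type v) [NonUnitalRing A] [Module k A] :
    A ≃ₗ[k] TPow k A 1 :=
  (PiTensorProduct.subsingletonEquiv (s := fun _ : Fin 1 => A) (0 : Fin 1)).symm

theorem tpowOne_apply (a : A) : tpowOne k A a = PiTensorProduct.tprod k fun _ => a := by
  refine (PiTensorProduct.subsingletonEquiv_symm_apply (s := fun _ : Fin 1 => A) 0 a).trans ?_
  congr 1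
  ext j
  obtain rfl : j = 0 := Subsingleton.elim _ _
  simp

theorem tmap_tpowOne [IsScalarTower k A A] [SMulCommClass k A A] {B : Type w} [NonUnitalRing B]
    [Module k B] [IsScalarTower k B B] [SMulCommClass k B B] (f : A →ₙₐ[k] B) (a : A) :
    tmap f 1 (tpowOne k A a) = tpowOne k B (f a) := by
  rw [tpowOne_apply, tpowOne_apply, tmap_tprod]

theorem bHoch_zero_tprod [IsScalarTower k A A] [SMulCommClass k A A] (a : Fin 2 → A) :
    bHoch k A 0 (PiTensorProduct.tprod k a) = tpowOne k A (a 0 * a 1 - a 1 * a 0) := by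
  have h1 : ∀ (x : A) (f : Fin 0 → A), (Fin.cons x f : Fin 1 → A) = fun _ => x := fun x f => by
    ext j
    obtain rfl : j = 0 := Fin.fin_one_eq_zero j
    rfl
  have h : PiTensorProduct.tprod k a =
      tcons (k := k) 1 (a 0) (tcons 0 (a 1) (PiTensorProduct.tprod k Fin.elim0)) := by
    rw [tcons_tprod, tcons_tprod, h1]
    congr 1
    ext j
    fin_cases j <;> rfl
  rw [h, bHoch_zero_tcons, tcons_tprod, tcons_tprod, h1, h1, map_sub, tpowOne_apply, tpowOne_apply]

end Hochschild

namespace XMod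

open Hochschild

/-! ### The computation of `H_2(β)`. -/

section Commutator

variable {k : Type u} [Field k] {X : XMod.{u, v} k} (D : X.Contraction)

theorem sub_mem_commutator (a : X.A) (r : X.R) :
    X.act.la a r - X.act.ra r a ∈ X.commutator :=
  Submodule.subset_span ⟨a, r, rfl⟩

namespace Contraction

theorem c_ρ (r : X.R) : D.c (X.ρ r) = -r := D.ρ_injective (by
  rw [D.ρ_c, D.p_ρ, map_zero, zero_sub, map_neg])

/-- Expand `s p(a a') = s p(a) s p(a')` with `s p = 1 + ρ c` and cancel the injective `ρ`. -/
theorem c_mul (a a' : X.A) : D.c (a * a') =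
    X.act.la a (D.c a') + X.act.ra (D.c a) a' + D.c a * D.c a' := D.ρ_injective (by
  have h : ∀ a, D.s (D.p a) = a + X.ρ (D.c a) := fun a => by
    rw [D.ρ_c]
    abel
  rw [D.ρ_c, map_mul, map_mul, h, h, map_add, map_add, X.ρ_la, X.ρ_ra, map_mul, mul_add, add_mul,
    add_mul]
  abel)

/-- By `c_mul` the element is `[a, c a'] - [a', c a] + [c a, c a']`. By the Peiffer identities the
last bracket is the commutator of `ρ(c a)` with `c a'`. -/
theorem c_commutator_mem (a a' : X.A) : D.c (a * a' - a' * a) ∈ X.commutator := by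
  have h := add_mem (sub_mem (sub_mem_commutator a (D.c a')) (sub_mem_commutator a' (D.c a)))
    (sub_mem_commutator (X.ρ (D.c a)) (D.c a'))
  rw [X.peiffer_left, X.peiffer_right] at h
  rw [map_sub, D.c_mul, D.c_mul]
  convert h using 1
  abel

theorem c_bHoch_mem (w : TPow k X.A 2) :
    D.c ((tpowOne k X.A).symm (bHoch k X.A 0 w)) ∈ X.commutator := by
  have h : X.commutator.mkQ ∘ₗ D.c ∘ₗ (tpowOne k X.A).symm.toLinearMap ∘ₗ bHoch k X.A 0 = 0 := by
    refine PiTensorProduct.ext (MultilinearMap.ext fun a => ?_)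
    simp only [LinearMap.compMultilinearMap_apply, LinearMap.comp_apply, LinearEquiv.coe_coe,
      bHoch_zero_tprod, LinearEquiv.symm_apply_apply]
    exact (Submodule.Quotient.mk_eq_zero _).2 (D.c_commutator_mem _ _)
  exact (Submodule.Quotient.mk_eq_zero _).1 (LinearMap.congr_fun h w)

/-- The map `R → A → H_1(CC^{2}(A))`. -/
def classOfR (X : XMod.{u, v} k) : X.R →ₗ[k] ((CCTwo k).obj X.A).homology 1 :=
  (connectingClass X.A).hom ∘ₗ (tpowOne k X.A).toLinearMap ∘ₗ (X.ρ : X.R →ₗ[k] X.A)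

theorem classOfR_apply (r : X.R) :
    classOfR X r = connectingClass X.A (tpowOne k X.A (X.ρ r)) := rfl

theorem isFreeRetract_Q (hA : IsFreeRetract k X.A) : IsFreeRetract k D.Q :=
  hA.of_retract D.s D.p D.p_s

variable [CharZero k]

/-- If the class of `ρ(r)` vanishes, then `ρ(r)` is in the image of `b`, that is, in `[A, A]`, and
`c` sends it both to `-r` and into `[A, R]`. Conversely `ρ(a r - r a) = [a, ρ(r)]` has class zero.
-/
theorem ker_classOfR (D : X.Contraction) (hA : IsFreeRetract k X.A) : LinearMap.ker (classOfR X) = X.commutator := by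
  refine le_antisymm (fun r hr => ?_) (Submodule.span_le.2 ?_)
  · obtain ⟨w, hw⟩ := hA.exists_of_connectingClass_eq_zero
      (tpowOne k X.A (X.ρ r)) hr
    have h := D.c_bHoch_mem w
    rw [hw, LinearEquiv.symm_apply_apply, D.c_ρ, neg_mem_iff] at h
    exact h
  · rintro _ ⟨a, r, rfl⟩
    have h := connectingClass_bHoch (A := X.A) (PiTensorProduct.tprod k ![a, X.ρ r])
    rw [bHoch_zero_tprod] at h
    change classOfR X _ = 0
    rw [classOfR_apply, map_sub, X.ρ_la, X.ρ_ra]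
    exact h

theorem range_classOfR (hA : IsFreeRetract k X.A) : LinearMap.range (classOfR X) =
    LinearMap.ker (HomologicalComplex.homologyMap ((CCTwo k).map D.baseHom) 1).hom := by
  have hnat : ∀ a, HomologicalComplex.homologyMap ((CCTwo k).map D.baseHom) 1
      (connectingClass X.A (tpowOne k X.A a)) = connectingClass D.Q (tpowOne k D.Q (D.p a)) :=
    fun a => (connectingClass_naturality D.baseHom _).trans
      (congrArg (connectingClass D.Q) (tmap_tpowOne D.p a))
  ext y
  constructor
  · rintro ⟨r, rfl⟩
    refine (hnat (X.ρ r)).trans ?_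
    rw [D.p_ρ, map_zero, map_zero]
  · intro hy
    obtain ⟨t, rfl⟩ := hA.connectingClass_surjective y
    obtain ⟨a, rfl⟩ := (tpowOne k X.A).surjective t
    -- Here `p(a)` is in `[Q, Q]`, so `s(p(a))` is in `[A, A]` and has class zero. As `a = s(p(a)) -
    -- ρ(c(a))`, the class of `a` comes from `-c(a)`.
    obtain ⟨w, hw⟩ := (D.isFreeRetract_Q hA).exists_of_connectingClass_eq_zero _
      ((hnat a).symm.trans hy)
    have h := connectingClass_bHoch (tmap D.s 2 w)
    rw [← tmap_bHoch_apply, hw, tmap_tpowOne] at h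
    refine ⟨-D.c a, ?_⟩
    rw [classOfR_apply, map_neg, D.ρ_c, neg_sub, map_sub, map_sub, h, sub_zero]

/-- `H_2(β(R, A, ρ)) ≅ R / [A, R]`. -/
theorem nonempty_homology_beta_equiv (D : X.Contraction) (hA : IsFreeRetract k X.A) :
    Nonempty (X.beta.homology 2 ≃ₗ[k] X.R ⧸ X.commutator) := by
  -- The input is `H_2(CC^{2}(Q)) = 0`. The connecting map then embeds `H_2(β)` in `H_1(CC^{2}(A))`
  -- with the same image as `classOfR`.
  obtain ⟨δ, hδ, hδ'⟩ := D.exists_injective_range_eq_ker (CCTwo k) 1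
    ((D.isFreeRetract_Q hA).exactIn_CCTwo 0).isZero_homology
  rw [← D.range_classOfR hA] at hδ'
  exact ⟨(LinearEquiv.ofInjective δ hδ).trans ((LinearEquiv.ofEq _ _ hδ').trans
    ((classOfR X).quotKerEquivRange.symm.trans
      (Submodule.quotEquivOfEq _ _ (D.ker_classOfR hA))))⟩

end Contraction

end Commutator

end XMod

end

theorem proposition5p3 {k : Type u} [Field k] (X : XMod.{u, max u v} k) (hX : X.InProjectiveClass) :
    (∀ n : ℕ, 2 < n → CategoryTheory.Limits.IsZero (X.beta.homology n)) ∧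
    (CharZero k →
      (∀ n : ℕ, 1 < n → CategoryTheory.Limits.IsZero (X.gamma.homology n)) ∧
      Nonempty (X.beta.homology 2 ≃ₗ[k] X.R ⧸ X.commutator)) := by
  obtain ⟨θ, hθ⟩ := hX
  let D := XMod.contractionOfSection hθ
  have hA := XMod.isFreeRetract_of_section hθ
  have hQ := D.isFreeRetract_Q hA
  refine ⟨fun n hn => ?_, fun _ => ⟨fun n hn => ?_, D.nonempty_homology_beta_equiv hA⟩⟩
  · obtain ⟨n, rfl⟩ := Nat.exists_eq_add_of_le' hn
    -- The degree is now `n + 3`; its neighbours are `H_{n+3}(CC^{2}(Q))` and `H_{n+2}(CC^{2}(A))`.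
    -- For `γ` below, the degree is `n + 2` and the neighbours are `H_{n+2}(CC(Q))` and
    -- `H_{n+1}(CC(A))`.
    exact D.isZero_homology_cokernel (Hochschild.CCTwo k) (n + 2)
      (hQ.exactIn_CCTwo (n + 1)).isZero_homology (hA.exactIn_CCTwo n).isZero_homology
  · obtain ⟨n, rfl⟩ := Nat.exists_eq_add_of_le' hn
    exact D.isZero_homology_cokernel (Hochschild.CC k) (n + 1)
      (hQ.exactIn_CC (n + 1)).isZero_homology (hA.exactIn_CC n).isZero_homology
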